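/- Let $n\ge 3$, and let $k_1,\dots,k_n$ be vectors in a complex vector space with a symmetric bilinear form (for instance complexified $D$-dimensional Minkowski space; real momenta are a special case). Assume that they are massless, $k_i^2=k_i\cdot k_i=0$, that momentum is conserved, $\sum_i k_i=0$, and that they are generic in the following sense. Write $k_I=\sum_{i\in I}k_i$ for $I\subset\{1,\dots,n\}$ and $k_{12\dots i}=k_1+\dots+k_i$, let $\sigma_{ij}=\sigma_i-\sigma_j$, and let $$E_a(\sigma)=\sum_{b\ne a}\frac{2\,k_a\cdot k_b}{\sigma_{ab}},\qquad a=1,\dots,n .$$ Genericity means: (i) $k_I^2\neq0$ for every $I$ with $2\le|I|\le n-2$; (ii) every solution $\sigma$, with pairwise distinct $\sigma_i\in\mathbb C$, of the scattering equations $E_1=\dots=E_n=0$ is simple modulo $\mathrm{SL}(2,\mathbb C)$, i.e. the reduced Jacobian determinant defined next does not vanish there. Let $\mathfrak M_{0,n}$ be the space of $n$ distinct points of the Riemann sphere modulo $\mathrm{SL}(2,\mathbb C)$. For ordered triples $p=(p_1,p_2,p_3)$ and $q=(q_1,q_2,q_3)$ of distinct labels, let $\det{}^{p}_{q}\big(\partial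 E/\partial\sigma\big)$ be the determinant of the matrix obtained from $(\partial E_a/\partial\sigma_b)_{a,b}$ by replacing row $q_m$ by the unit vector at position $p_m$ for $m=1,2,3$. This is the minor with rows $q$ and columns $p$ deleted, with its cofactor sign. The tree-level CHY integral $$\int_{\mathfrak M_{0,n}}d\mu_n^{\rm CHY}\,\mathcal I,\qquad d\mu_n^{\rm CHY}=\frac{d^n\sigma}{\mathrm{vol}\,\mathrm{SL}(2,\mathbb C)}\prod_a{}'\,\bar\delta(E_a),$$ in which the punctures $p$ are fixed and the constraints $q$ are dropped, denotes the sum over its localisation points $$\sum_{\substack{[\sigma]\in\mathfrak M_{0,n}\\ E_a(\sigma)=0\ \forall a\notin\{q_1,q_2,q_3\}}}\frac{(\sigma_{p_1p_2}\sigma_{p_2p_3}\sigma_{p_3p_1})(\sigma_{q_1q_2}\sigma_{q_2q_3}\sigma_{q_3q_1})}{\det{}^{p}_{q}(\partial E/\partial\sigma)}\;\mathcal I(\sigma),$$ where each class is evaluated at a representative with all $\sigma_i\in\mathbb C$. Let $(12\dots n)=\sigma_{12}\sigma_{23}\cdots\sigma_{n1}$. Then, for every choice of $p$, $q$ and of the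 representatives, $$\int_{\mathfrak M_{0,n}}d\mu_n^{\rm CHY}\left(\frac1{\sigma_{1n}^2}\prod_{j=2}^{n-1}\frac{\sigma_{1n}}{\sigma_{1j}\,\sigma_{jn}}\right)\frac1{(12\dots n)}=\frac{(-1)^n}{k_{12}^2\,k_{123}^2\cdots k_{12\dots n-2}^2},$$ or equivalently, with the opposite orientation of the numerators, $$\int_{\mathfrak M_{0,n}}d\mu_n^{\rm CHY}\left(\frac1{\sigma_{1n}^2}\prod_{j=2}^{n-1}\frac{\sigma_{n1}}{\sigma_{1j}\,\sigma_{jn}}\right)\frac1{(12\dots n)}=\frac{1}{k_{12}^2\,k_{123}^2\cdots k_{12\dots n-2}^2},$$ the half-ladder diagram with ordering $(12\dots n)$ and endpoints $1$ and $n$ (for $n=3$ the product of propagators is empty and equals $1$). -/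

import Mathlib

noncomputable section

namespace CHY

/-- Configurations of `n` pairwise distinct punctures in the affine chart `ℂ` of the sphere. -/
def Config (n : ℕ) : Type := {σ : Fin n → ℂ // Function.Injective σ}

/-- Two configurations are equivalent if some Möbius transformation maps one to the other. -/
def MoebiusRel {n : ℕ} (σ τ : Config n) : Prop :=
  ∃ a b c d : ℂ, a * d - b * c = 1 ∧
    ∀ i, c * σ.1 i + d ≠ 0 ∧ τ.1 i = (a * σ.1 i + b) / (c * σ.1 i + d)

theorem moebiusRel_refl {n : ℕ} (σ : Config n) : MoebiusRel σ σ :=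
  ⟨1, 0, 0, 1, by simp, fun i => by simp⟩

theorem moebiusRel_symm {n : ℕ} {σ τ : Config n} (h : MoebiusRel σ τ) : MoebiusRel τ σ := by
  obtain ⟨a, b, c, d, hdet, h⟩ := h
  refine ⟨d, -b, -c, a, by linear_combination hdet, fun i => ?_⟩
  obtain ⟨hne, hi⟩ := h i
  have key : -c * τ.1 i + a = 1 / (c * σ.1 i + d) := by
    rw [hi]; field_simp; linear_combination hdet
  refine ⟨by rw [key]; exact one_div_ne_zero hne, ?_⟩
  rw [key, hi, eq_div_iff (one_div_ne_zero hne), mul_one_div, div_eq_iff hne, add_mul,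
    mul_assoc d, div_mul_cancel₀ _ hne]
  linear_combination (-σ.1 i) * hdet

theorem moebiusRel_trans {n : ℕ} {σ τ υ : Config n}
    (h₁ : MoebiusRel σ τ) (h₂ : MoebiusRel τ υ) : MoebiusRel σ υ := by
  obtain ⟨a, b, c, d, hdet, h⟩ := h₁
  obtain ⟨a', b', c', d', hdet', h'⟩ := h₂
  refine ⟨a' * a + b' * c, a' * b + b' * d, c' * a + d' * c, c' * b + d' * d, ?_, fun i => ?_⟩
  · linear_combination (a' * d' - b' * c') * hdet + hdet'
  · obtain ⟨hne, hi⟩ := h i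
    obtain ⟨hne', hi'⟩ := h' i
    have key : (c' * a + d' * c) * σ.1 i + (c' * b + d' * d)
        = (c' * τ.1 i + d') * (c * σ.1 i + d) := by
      rw [hi]; field_simp; ring
    have key' : (a' * a + b' * c) * σ.1 i + (a' * b + b' * d)
        = (a' * τ.1 i + b') * (c * σ.1 i + d) := by
      rw [hi]; field_simp; ring
    refine ⟨by rw [key]; exact mul_ne_zero hne' hne, ?_⟩
    rw [key, key', mul_div_mul_right _ _ hne, hi']

instance configSetoid (n : ℕ) : Setoid (Config n) where
  r := MoebiusRel
  iseqv := ⟨moebiusRel_refl, moebiusRel_symm, moebiusRel_trans⟩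

/-- The moduli space `M_{0,n}` of `n` distinct marked points on the Riemann sphere modulo
`SL(2,ℂ)`. Every class of points of the projective line has a representative none of whose
(finitely many) points is at infinity, so affine configurations suffice. -/
abbrev ModuliSpace (n : ℕ) : Type := Quotient (configSetoid n)

variable {V : Type*} [AddCommGroup V] [Module ℂ V]

/-- Massless momenta with momentum conservation, all particles incoming. -/
structure IsMasslessKinematics {n : ℕ} (B : LinearMap.BilinForm ℂ V) (k : Fin n → V) : Prop where
  null : ∀ i, B (k i) (k i) = 0
  conservation : ∑ i, k i = 0

/-- `k_I²`, the square of the total momentum of the particles in `I`. -/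
def momentumSq {n : ℕ} (B : LinearMap.BilinForm ℂ V) (k : Fin n → V) (I : Finset (Fin n)) : ℂ :=
  B (∑ i ∈ I, k i) (∑ i ∈ I, k i)

/-- The left-hand side of the scattering equation of particle `i`,
`E_i = ∑_{j ≠ i} 2 k_i · k_j / (σ_i - σ_j)`. -/
def scatteringFn {n : ℕ} (B : LinearMap.BilinForm ℂ V) (k : Fin n → V) (σ : Fin n → ℂ)
    (i : Fin n) : ℂ :=
  ∑ j ∈ Finset.univ.erase i, 2 * B (k i) (k j) / (σ i - σ j)

/-- The Jacobian matrix `∂E_i / ∂σ_j`. -/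
def scatteringJacobian {n : ℕ} (B : LinearMap.BilinForm ℂ V) (k : Fin n → V) (σ : Fin n → ℂ) :
    Matrix (Fin n) (Fin n) ℂ :=
  Matrix.of fun i j => deriv (fun z => scatteringFn B k (Function.update σ j z) i) (σ j)

/-- The signed `(n-3) × (n-3)` minor of the Jacobian matrix in which the rows (constraints)
`q 0, q 1, q 2` and the columns (punctures) `p 0, p 1, p 2` are removed: row `q m` is replaced by
the unit vector at `p m`, which produces the minor with its cofactor sign. For `p = q` it is the
principal minor. -/
def reducedMinor {n : ℕ} (B : LinearMap.BilinForm ℂ V) (k : Fin n → V) (p q : Fin 3 ↪ Fin n)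
    (σ : Fin n → ℂ) : ℂ :=
  Matrix.det (Matrix.of fun i j : Fin n =>
    if i = q 0 then (if j = p 0 then (1 : ℂ) else 0)
    else if i = q 1 then (if j = p 1 then (1 : ℂ) else 0)
    else if i = q 2 then (if j = p 2 then (1 : ℂ) else 0)
    else scatteringJacobian B k σ i j)

/-- The Faddeev-Popov factor `σ_{ab} σ_{bc} σ_{ca}` of the triple `(a, b, c) = (p 0, p 1, p 2)`. -/
def tripleFactor {n : ℕ} (p : Fin 3 ↪ Fin n) (σ : Fin n → ℂ) : ℂ :=
  (σ (p 0) - σ (p 1)) * (σ (p 1) - σ (p 2)) * (σ (p 2) - σ (p 0))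

/-- The tree-level CHY integral `∫ dμ_n I` over `M_{0,n}` with
`dμ_n = dⁿσ / vol SL(2,ℂ) ∏' δ̄(E_a)`. The holomorphic delta functions localise it onto the
solutions of the scattering equations and contribute the inverse of their Jacobian. The punctures
in `p` are fixed and the constraints in `q` are dropped, each at the cost of the corresponding
factor `σ_{ab} σ_{bc} σ_{ca}`; `rep` selects a representative of each point of `M_{0,n}`. -/
def integral {n : ℕ} (B : LinearMap.BilinForm ℂ V) (k : Fin n → V) (p q : Fin 3 ↪ Fin n)
    (rep : ModuliSpace n → Config n) (I : (Fin n → ℂ) → ℂ) : ℂ :=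
  ∑ᶠ x ∈ {x : ModuliSpace n | ∀ a, a ∉ Set.range q → scatteringFn B k (rep x).1 a = 0},
    tripleFactor p (rep x).1 * tripleFactor q (rep x).1 / reducedMinor B k p q (rep x).1
      * I (rep x).1

/-- The inverse Parke-Taylor factor `(12…n) = σ_{12} σ_{23} ⋯ σ_{n1}`. -/
def parkeTaylor {n : ℕ} (σ : Fin n → ℂ) : ℂ :=
  ∏ i, (σ i - σ (finRotate n i))

/-- The half-integrand `σ_{ab}⁻² ∏_{j ≠ a, b} σ_{ab} / (σ_{aj} σ_{jb})`. -/
def halfLadderFactor {n : ℕ} (a b : Fin n) (σ : Fin n → ℂ) : ℂ :=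
  1 / (σ a - σ b) ^ 2 *
    ∏ j ∈ (Finset.univ.erase a).erase b, (σ a - σ b) / ((σ a - σ j) * (σ j - σ b))

/-- The half-integrand with the opposite orientation of the numerators,
`σ_{ab}⁻² ∏_{j ≠ a, b} σ_{ba} / (σ_{aj} σ_{jb})`. -/
def halfLadderFactorRev {n : ℕ} (a b : Fin n) (σ : Fin n → ℂ) : ℂ :=
  1 / (σ a - σ b) ^ 2 *
    ∏ j ∈ (Finset.univ.erase a).erase b, (σ b - σ a) / ((σ a - σ j) * (σ j - σ b))

/-- The half-ladder diagram with ordering `(12…n)` and endpoints `1` and `n`,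
`1 / (k_{12}² k_{123}² ⋯ k_{12…n-2}²)`. Particle `j` has index `j - 1` in `Fin n`. -/
def halfLadderDiagram {n : ℕ} (B : LinearMap.BilinForm ℂ V) (k : Fin n → V) : ℂ :=
  1 / ∏ i ∈ Finset.Icc 2 (n - 2), momentumSq B k (Finset.univ.filter fun j : Fin n => j.val < i)

end CHY

end

/-! Möbius invariance allows `σ_1 = ∞`, `σ_{n-1} = 1`, `σ_n = 0`, which leaves `N = n - 3`
coordinates `x_0, …, x_{N-1}`. In this gauge the scattering equations become the polynomial
equations of Dolan and Goddard, `h_m = ∑_{|I| = m+1} k_{1 ∪ I}² ∏_{a ∈ I} y_a = 0` for `m < N`,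
where `y` lists the punctures `2, …, n` (`sum_eval_ladderPoly`). Genericity (i) acts twice: the top
forms of the `h_m` have only the trivial common zero, so there are no solutions at infinity, and no
polynomial solution has colliding punctures (`gaugeFix_injective`). Localisation points therefore
correspond bijectively to the zeros of the `h_m`.

Once every Jacobian and gauge factor is collected, a localisation point contributes `g / det(∂h/∂x)`
with `g = ∏_m ∏_{i<m} (x_i - x_{m+1})` and `x_N = 1` (`localisation_term_eq`). The zeros are simple
by (ii), so the integral is the global residue of the polynomial `g` (`globalResidue_eq_sum`). The
residue functional is built in `exists_globalResidue` by the transformation law, from the elementary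
residue at infinity of systems `X_i ^ D + lower`.

The degree of `g` is at most the critical degree `∑ (deg h_m - 1)`. The residue vanishes below that
degree, and it equals 1 on the determinant of any suitably bounded matrix `Δ` for which `∑_j Δ_ij
(X_j - ξ_j)` agrees with `h_i` up to lower degree. Reduction modulo the `h_m` replaces `g` by the
monomial `∏_m ∏_{i<m} x_i` (`residue_numerator`). This monomial times `∏_m k_{12…m+2}²` is the
determinant of a triangular `Δ` (`exists_triangular_decomposition`), so the residue is the inverse
product of propagators. -/

namespace CHY

open MvPolynomial

/-! ### Residue at infinity of a system `X_i ^ D + l_i` with `l_i` of lower degree. -/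

section Residue

variable {ι K : Type*} [Fintype ι] [Field K]

/-- The exponent all of whose entries are `c`. -/
noncomputable def constExp (ι : Type*) [Fintype ι] (c : ℕ) : ι →₀ ℕ :=
  Finsupp.equivFunOnFinite.symm fun _ => c

@[simp]
theorem constExp_apply (c : ℕ) (i : ι) : constExp ι c i = c := rfl

theorem degree_constExp (c : ℕ) : (constExp ι c).degree = Fintype.card ι * c := by
  simp [Finsupp.degree_eq_sum]

theorem coeff_eq_zero_of_lt_degree {ι K : Type*} [Field K] {p : MvPolynomial ι K} {e : ι →₀ ℕ}
    (h : p.totalDegree < e.degree) : coeff e p = 0 :=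
  coeff_eq_zero_of_totalDegree_lt h

/-- The terms of the expansion of the residue at infinity of `p / ∏ (X_i ^ D + l_i)`. -/
noncomputable def residueTerm (D : ℕ) (l : ι → MvPolynomial ι K) (p : MvPolynomial ι K)
    (m : ι →₀ ℕ) : K :=
  coeff (D • m + constExp ι (D - 1)) (p * ∏ i, (-l i) ^ m i)

variable {D : ℕ} {l : ι → MvPolynomial ι K}

/-- In the geometric series `1 / ∏ (X_i^D + l_i) = ∑_m ∏ (-l_i)^{m_i} X_i^{-D(m_i+1)}` the residue
of the `m`-th term is a coefficient in degree `D|m| + N(D-1)`, with `N` the number of variables. The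
polynomial in question has degree at most `deg p + |m|(D-1)`, so only finitely many `m` contribute.
-/
theorem residueTerm_eq_zero (hD : 1 ≤ D) (hl : ∀ i, (l i).totalDegree ≤ D - 1)
    {p : MvPolynomial ι K} {m : ι →₀ ℕ}
    (h : p.totalDegree < m.degree + Fintype.card ι * (D - 1)) : residueTerm D l p m = 0 := by
  apply coeff_eq_zero_of_lt_degree
  have h1 : (∏ i, (-l i) ^ m i).totalDegree ≤ m.degree * (D - 1) := by
    refine (totalDegree_finsetProd _ _).trans ?_
    rw [Finsupp.degree_eq_sum, Finset.sum_mul]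
    refine Finset.sum_le_sum fun i _ => (totalDegree_pow _ _).trans ?_
    rw [totalDegree_neg]
    exact Nat.mul_le_mul_left _ (hl i)
  have h2 := totalDegree_mul p (∏ i, (-l i) ^ m i)
  rw [map_add, map_nsmul, degree_constExp, smul_eq_mul]
  obtain ⟨E, rfl⟩ : ∃ E, D = E + 1 := ⟨D - 1, by omega⟩
  simp only [Nat.add_sub_cancel] at *
  nlinarith

theorem residueTerm_hasFiniteSupport (hD : 1 ≤ D) (hl : ∀ i, (l i).totalDegree ≤ D - 1)
    (p : MvPolynomial ι K) : Function.HasFiniteSupport (residueTerm D l p) := by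
  refine (Finsupp.finite_of_degree_le p.totalDegree).subset fun m hm => ?_
  by_contra hlt
  simp only [Set.mem_ofPred_eq, not_le] at hlt
  exact hm (residueTerm_eq_zero hD hl (by omega))

/-- The residue at infinity of `p / ∏ (X_i ^ D + l_i)`. -/
noncomputable def residueAtInfinity (hD : 1 ≤ D) (hl : ∀ i, (l i).totalDegree ≤ D - 1) :
    MvPolynomial ι K →ₗ[K] K where
  toFun p := ∑ᶠ m, residueTerm D l p m
  map_add' p q := by
    rw [← finsum_add_distrib (residueTerm_hasFiniteSupport hD hl p)
      (residueTerm_hasFiniteSupport hD hl q)]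
    simp [residueTerm, add_mul]
  map_smul' c p := by
    rw [RingHom.id_apply, smul_finsum' _ (residueTerm_hasFiniteSupport hD hl p)]
    simp [residueTerm]

theorem residueAtInfinity_of_totalDegree_lt (hD : 1 ≤ D) (hl : ∀ i, (l i).totalDegree ≤ D - 1)
    {p : MvPolynomial ι K} (hp : p.totalDegree < Fintype.card ι * (D - 1)) :
    residueAtInfinity hD hl p = 0 :=
  finsum_eq_zero_of_forall_eq_zero fun _ => residueTerm_eq_zero hD hl (by omega)

theorem residueAtInfinity_of_totalDegree_le (hD : 1 ≤ D) (hl : ∀ i, (l i).totalDegree ≤ D - 1)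
    {p : MvPolynomial ι K} (hp : p.totalDegree ≤ Fintype.card ι * (D - 1)) :
    residueAtInfinity hD hl p = coeff (constExp ι (D - 1)) p := by
  change ∑ᶠ m, residueTerm D l p m = _
  rw [finsum_eq_single _ 0 fun m hm => ?_]
  · simp [residueTerm]
  · refine residueTerm_eq_zero hD hl ?_
    have : m.degree ≠ 0 := fun h => hm ((Finsupp.degree_eq_zero_iff m).1 h)
    omega

/-- The series telescopes: the term of `p * -l i` at `m` is the term of `p * X i ^ D` at `m + e_i`.
-/
theorem residueAtInfinity_mul [DecidableEq ι] (hD : 1 ≤ D) (hl : ∀ i, (l i).totalDegree ≤ D - 1)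
    (p : MvPolynomial ι K) (i : ι) :
    residueAtInfinity hD hl (p * (X i ^ D + l i)) = 0 := by
  have key : residueAtInfinity hD hl (p * X i ^ D) = residueAtInfinity hD hl (p * -l i) := by
    change ∑ᶠ m, residueTerm D l _ m = ∑ᶠ m, residueTerm D l _ m
    have hshift : ∀ m, residueTerm D l (p * -l i) m
        = residueTerm D l (p * X i ^ D) (m + Finsupp.single i 1) := by
      intro m
      have h1 : ∏ j, (-l j) ^ ((m + Finsupp.single i 1 : ι →₀ ℕ) j) = -l i * ∏ j, (-l j) ^ m j := by
        simp only [Finsupp.add_apply, pow_add, Finset.prod_mul_distrib]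
        rw [mul_comm]
        congr 1
        rw [Finset.prod_eq_single i]
        · simp
        · intro j _ hj
          simp [hj.symm]
        · simp
      unfold residueTerm
      rw [h1, X_pow_eq_monomial, mul_right_comm p (monomial _ _), mul_comm _ (monomial _ _),
        coeff_monomial_mul', if_pos, one_mul]
      · congr 1
        · ext j
          simp only [smul_add, Finsupp.smul_single, smul_eq_mul, mul_one, Finsupp.coe_add,
            Finsupp.coe_tsub, Pi.add_apply, Pi.sub_apply]
          omega
        · ring
      · intro j
        simp only [smul_add, Finsupp.smul_single, smul_eq_mul, mul_one, Finsupp.coe_add,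
          Pi.add_apply]
        omega
    -- For `m i = 0` the extracted exponent of `X i` is `D - 1`, too small for a multiple of `X i ^
    -- D`. Hence the shifted indices exhaust the support.
    have hzero : ∀ m : ι →₀ ℕ, m i = 0 → residueTerm D l (p * X i ^ D) m = 0 := by
      intro m hm
      unfold residueTerm
      rw [X_pow_eq_monomial, mul_right_comm p (monomial _ _), mul_comm _ (monomial _ _),
        coeff_monomial_mul', if_neg]
      intro h
      have := h i
      simp [hm] at this
      omega
    have hinj : Function.Injective fun m : ι →₀ ℕ => m + Finsupp.single i 1 :=
      fun a b h => add_right_cancel h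
    rw [finsum_congr hshift, ← finsum_mem_range (f := residueTerm D l (p * X i ^ D)) hinj,
      ← finsum_mem_univ]
    refine finsum_mem_inter_support_eq' _ _ _ fun m hm => ⟨fun _ => ?_, fun _ => trivial⟩
    have hmi : m i ≠ 0 := fun h => hm (hzero m h)
    refine ⟨m - Finsupp.single i 1, ?_⟩
    ext j
    by_cases hj : i = j
    · subst hj
      simp
      omega
    · simp [hj]
  rw [mul_add, map_add, key, ← map_add]
  simp

end Residue

/-! ### Leading coefficients of determinants of polynomial matrices. -/

section Determinant

variable {ι K : Type*} [Fintype ι] [DecidableEq ι] [Field K]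

theorem totalDegree_det_le {M : Matrix ι ι (MvPolynomial ι K)} {r : ι → ℕ}
    (h : ∀ i j, (M i j).totalDegree ≤ r i) : M.det.totalDegree ≤ ∑ i, r i := by
  -- After transposition the Leibniz product runs over rows, so the bound `r i` applies factor by
  -- factor.
  rw [Matrix.det_apply', ← Matrix.det_apply', ← Matrix.det_transpose, Matrix.det_apply]
  refine totalDegree_finsetSum_le fun σ _ => (totalDegree_smul_le _ _).trans ?_
  exact (totalDegree_finsetProd _ _).trans (Finset.sum_le_sum fun i _ => h i (σ i))

theorem totalDegree_adjugate_le {M : Matrix ι ι (MvPolynomial ι K)} {c : ℕ}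
    (h : ∀ i j, (M i j).totalDegree ≤ c) (i j : ι) :
    (M.adjugate i j).totalDegree + c ≤ Fintype.card ι * c := by
  rw [Matrix.adjugate_apply]
  have := totalDegree_det_le (M := M.updateRow j (Pi.single i 1))
    (r := fun k => if k = j then 0 else c) fun k m => by
      by_cases hk : k = j
      · subst hk
        by_cases hm : m = i
        · subst hm; simp
        · simp [hm]
      · simp [hk, h]
  have hs : ∑ k, (if k = j then 0 else c) + c = Fintype.card ι * c := by
    have : ∀ k, (if k = j then 0 else c) + (if k = j then c else 0) = c := fun k => by
      split_ifs <;> simp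
    calc _ = ∑ k, (if k = j then 0 else c) + ∑ k, (if k = j then c else 0) := by simp
      _ = ∑ k, c := by rw [← Finset.sum_add_distrib]; exact Finset.sum_congr rfl fun k _ => this k
      _ = _ := by simp
  omega

/-- By Cramer's rule `(X i - ξ i) det M` is the combination of the entries of `M (X - ξ)` with
adjugate coefficients. The coefficient of `X i` times the critical monomial is the one sought. The
`i`-th entry and the lower parts of the others have too small a degree to reach it, and `X k ^ D`
with `k ≠ i` does not divide that monomial. -/
theorem coeff_det_updateRow_eq_zero {D : ℕ} (hD : 1 ≤ D) (ξ : ι → K)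
    {M : Matrix ι ι (MvPolynomial ι K)} (hM : ∀ i j, (M i j).totalDegree ≤ D - 1) (i : ι)
    (hi : (∑ j, M i j * (X j - C (ξ j))).totalDegree ≤ D - 1)
    (hk : ∀ k, k ≠ i → (∑ j, M k j * (X j - C (ξ j)) - X k ^ D).totalDegree ≤ D - 1) :
    coeff (constExp ι (D - 1)) M.det = 0 := by
  set e := constExp ι (D - 1)
  have he : (Finsupp.single i 1 + e).degree = Fintype.card ι * (D - 1) + 1 := by
    rw [map_add, degree_constExp, Finsupp.degree_single, add_comm]
  have hdet : M.det.totalDegree ≤ Fintype.card ι * (D - 1) := by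
    simpa using totalDegree_det_le hM
  have h1 : (X i - C (ξ i)) * M.det
      = ∑ k, M.adjugate i k * ∑ j, M k j * (X j - C (ξ j)) := by
    have := congrArg (fun A => (A.mulVec fun j => X j - C (ξ j)) i) (Matrix.adjugate_mul M)
    simp only [← Matrix.mulVec_mulVec, Matrix.smul_mulVec, Matrix.one_mulVec] at this
    simpa [Matrix.mulVec, dotProduct, mul_comm] using this.symm
  have h2 : coeff (Finsupp.single i 1 + e) ((X i - C (ξ i)) * M.det) = coeff e M.det := by
    rw [sub_mul, coeff_sub, coeff_X_mul, coeff_C_mul,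
      coeff_eq_zero_of_lt_degree (p := M.det) (e := Finsupp.single i 1 + e) (by omega),
      mul_zero, sub_zero]
  have hlow : ∀ k (q : MvPolynomial ι K), q.totalDegree ≤ D - 1 →
      coeff (Finsupp.single i 1 + e) (M.adjugate i k * q) = 0 := by
    intro k q hq
    refine coeff_eq_zero_of_lt_degree ?_
    have := totalDegree_mul (M.adjugate i k) q
    have := totalDegree_adjugate_le hM i k
    omega
  rw [← h2, h1, coeff_sum]
  refine Finset.sum_eq_zero fun k _ => ?_
  by_cases hki : k = i
  · subst hki
    exact hlow _ _ hi
  · rw [← sub_add_cancel (∑ j, M k j * (X j - C (ξ j))) (X k ^ D), mul_add, coeff_add,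
      hlow _ _ (hk k hki), zero_add, mul_comm, X_pow_eq_monomial, coeff_monomial_mul', if_neg]
    intro h
    have := h k
    have h0 : e k = D - 1 := rfl
    simp [Ne.symm hki, h0] at this
    omega

/-- The rows are exchanged one at a time for those of the diagonal matrix with entries `X i ^
(D-1)`. Each exchange changes the determinant by one whose `i`-th row is a difference of two
admissible rows, so its product with `X - ξ` loses the term `X i ^ D` and the preceding lemma
applies. -/
theorem coeff_det_eq_one {D : ℕ} (hD : 1 ≤ D) (ξ : ι → K)
    {M : Matrix ι ι (MvPolynomial ι K)} (hM : ∀ i j, (M i j).totalDegree ≤ D - 1)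
    (hk : ∀ k, (∑ j, M k j * (X j - C (ξ j)) - X k ^ D).totalDegree ≤ D - 1) :
    coeff (constExp ι (D - 1)) M.det = 1 := by
  set R : ι → ι → MvPolynomial ι K := fun i j => if j = i then X i ^ (D - 1) else 0
  have hRdeg : ∀ i j, (R i j).totalDegree ≤ D - 1 := by
    intro i j
    by_cases h : j = i <;> simp [R, h]
  have hR : ∀ i, ∑ j, R i j * (X j - C (ξ j)) = X i ^ D - C (ξ i) * X i ^ (D - 1) := by
    intro i
    simp only [R, ite_mul, zero_mul, Finset.sum_ite_eq', Finset.mem_univ, if_true]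
    obtain ⟨E, rfl⟩ : ∃ E, D = E + 1 := ⟨D - 1, by omega⟩
    simp only [Nat.add_sub_cancel]
    ring
  have hR' : ∀ i, (∑ j, R i j * (X j - C (ξ j)) - X i ^ D).totalDegree ≤ D - 1 := by
    intro i
    rw [hR, sub_sub_cancel_left, totalDegree_neg]
    exact (totalDegree_mul _ _).trans (by simp)
  set Q : Finset ι → Matrix ι ι (MvPolynomial ι K) := fun s => Matrix.of fun i j =>
    if i ∈ s then R i j else M i j
  have hQ : ∀ s i j, (Q s i j).totalDegree ≤ D - 1 := by
    intro s i j
    by_cases h : i ∈ s <;> simp [Q, h, hM, hRdeg]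
  have hQ' : ∀ s i, (∑ j, Q s i j * (X j - C (ξ j)) - X i ^ D).totalDegree ≤ D - 1 := by
    intro s i
    by_cases h : i ∈ s <;> simp only [Q, h, Matrix.of_apply, if_true, if_false, hR', hk]
  have step : ∀ s, coeff (constExp ι (D - 1)) (Q s).det = coeff (constExp ι (D - 1)) M.det := by
    intro s
    induction s using Finset.induction_on with
    | empty => rfl
    | insert i s his ih =>
      rw [← ih]
      have e1 : Q (insert i s) = (Q s).updateRow i (R i) := by
        ext1 a b
        by_cases ha : a = i
        · subst ha; simp [Q]
        · simp [Q, ha]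
      have e2 : Q s = (Q s).updateRow i (R i + (M i - R i)) := by
        ext1 a b
        by_cases ha : a = i
        · subst ha; simp [Q, his]
        · simp [ha]
      rw [e1, e2, Matrix.updateRow_idem, Matrix.det_updateRow_add, coeff_add, left_eq_add]
      refine coeff_det_updateRow_eq_zero hD ξ (fun a b => ?_) i ?_ fun k hki => ?_
      · by_cases ha : a = i
        · subst ha
          simp only [Matrix.updateRow_self, Pi.sub_apply]
          exact (totalDegree_sub _ _).trans (max_le (hM _ _) (hRdeg _ _))
        · simpa [ha] using hQ s a b
      · have : ∑ j, (Q s).updateRow i (M i - R i) i j * (X j - C (ξ j))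
            = (∑ j, M i j * (X j - C (ξ j)) - X i ^ D)
              - (∑ j, R i j * (X j - C (ξ j)) - X i ^ D) := by
          simp only [Matrix.updateRow_self, Pi.sub_apply, sub_mul, Finset.sum_sub_distrib]
          ring
        rw [this]
        exact (totalDegree_sub _ _).trans (max_le (hk i) (hR' i))
      · simpa [hki] using hQ' s k
  rw [← step Finset.univ]
  have : Q Finset.univ = Matrix.diagonal fun i => X i ^ (D - 1) := by
    ext1 a b
    by_cases h : a = b
    · subst h; simp [Q, R]
    · simp [Q, R, h, Ne.symm h]
  rw [this, Matrix.det_diagonal]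
  have hm : ∏ i : ι, (X i : MvPolynomial ι K) ^ (D - 1) = monomial (constExp ι (D - 1)) 1 := by
    rw [monomial_eq, C_1, one_mul, Finsupp.prod_fintype _ _ (by simp)]
    simp
  rw [hm, coeff_monomial, if_pos rfl]

end Determinant

end CHY

namespace CHY

open MvPolynomial

/-! ### The global residue of a complete intersection, and the Euler-Jacobi formula. -/

section GlobalResidue

variable {ι K : Type*} [Fintype ι] [DecidableEq ι] [Field K]

theorem homogeneousComponent_mul_of_isHomogeneous {ι K : Type*} [Field K]
    {p q : MvPolynomial ι K} {d D : ℕ} (hq : q.IsHomogeneous d) (hd : d ≤ D) :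
    homogeneousComponent D (p * q) = homogeneousComponent (D - d) p * q := by
  let _ : GradedAlgebra (homogeneousSubmodule ι K) := gradedAlgebra
  have e : ∀ (φ : MvPolynomial ι K) n,
      (DirectSum.decompose (homogeneousSubmodule ι K) φ n : MvPolynomial ι K)
        = homogeneousComponent n φ := fun φ n => decomposition.decompose'_apply φ n
  have h := DirectSum.coe_decompose_mul_of_right_mem (homogeneousSubmodule ι K) (a := p) D
    ((mem_homogeneousSubmodule d q).2 hq)
  rwa [if_pos hd, e, e] at h

/-- By the Nullstellensatz each variable is nilpotent modulo the top forms. Keeping only the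
component of degree `D - d j` of each coefficient bounds the degrees in the resulting relation. -/
theorem exists_X_pow_eq_sum {ι K : Type*} [Fintype ι] [Field K] [IsAlgClosed K]
    {top : ι → MvPolynomial ι K} {d : ι → ℕ}
    (htop : ∀ i, (top i).IsHomogeneous (d i))
    (hzero : ∀ x : ι → K, (∀ i, eval x (top i) = 0) → x = 0) :
    ∃ D : ℕ, 1 ≤ D ∧ (∀ j, d j ≤ D) ∧ ∃ A : Matrix ι ι (MvPolynomial ι K),
      (∀ i j, (A i j).totalDegree ≤ D - d j) ∧ ∀ i, ∑ j, A i j * top j = X i ^ D := by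
  set I := Ideal.span (Set.range top)
  have hrad : ∀ i, ∃ e : ℕ, (X i : MvPolynomial ι K) ^ e ∈ I := by
    intro i
    have : (X i : MvPolynomial ι K) ∈ I.radical := by
      rw [← vanishingIdeal_zeroLocus_eq_radical (K := K)]
      intro x hx
      have hx0 : x = 0 := hzero x fun j => by
        simpa [aeval_eq_eval] using hx (top j) (Ideal.subset_span ⟨j, rfl⟩)
      simp [hx0]
    exact this
  choose e he using hrad
  -- One common `D`, positive and at least as large as every nilpotency exponent `e i` and every
  -- degree `d j`.
  refine ⟨∑ i, e i + ∑ i, d i + 1, by omega, fun j => ?_, ?_⟩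
  · have := Finset.single_le_sum (f := d) (fun _ _ => Nat.zero_le _) (Finset.mem_univ j)
    omega
  set D := ∑ i, e i + ∑ i, d i + 1
  have hD : ∀ i, ∃ c : ι → MvPolynomial ι K, ∑ j, c j * top j = X i ^ D := by
    intro i
    apply Ideal.mem_span_range_iff_exists_fun.1
    have := Finset.single_le_sum (f := e) (fun _ _ => Nat.zero_le _) (Finset.mem_univ i)
    rw [show D = (D - e i) + e i by omega, pow_add]
    exact Ideal.mul_mem_left _ _ (he i)
  choose c hc using hD
  refine ⟨fun i j => homogeneousComponent (D - d j) (c i j), fun i j =>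
    (homogeneousComponent_isHomogeneous _ _).totalDegree_le, fun i => ?_⟩
  have h := congrArg (homogeneousComponent D) (hc i)
  rw [map_sum, homogeneousComponent_eq_self (isHomogeneous_X_pow i D)] at h
  rw [← h]
  refine Finset.sum_congr rfl fun j _ => ?_
  rw [homogeneousComponent_mul_of_isHomogeneous (htop j)]
  have := Finset.single_le_sum (f := d) (fun _ _ => Nat.zero_le _) (Finset.mem_univ j)
  omega

/-- A complete intersection without solutions at infinity has a global residue functional. -/
theorem exists_globalResidue [IsAlgClosed K] {f top : ι → MvPolynomial ι K} {d : ι → ℕ}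
    (hd : ∀ i, 1 ≤ d i) (htop : ∀ i, (top i).IsHomogeneous (d i))
    (hlow : ∀ i, (f i - top i).totalDegree ≤ d i - 1)
    (hzero : ∀ x : ι → K, (∀ i, eval x (top i) = 0) → x = 0) :
    ∃ τ : MvPolynomial ι K →ₗ[K] K,
      (∀ p i, τ (p * f i) = 0) ∧
      (∀ p : MvPolynomial ι K, p.totalDegree < ∑ i, (d i - 1) → τ p = 0) ∧
      ∀ (ξ : ι → K) (Δ : Matrix ι ι (MvPolynomial ι K)),
        (∀ i j, (Δ i j).totalDegree ≤ d i - 1) →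
        (∀ i, (∑ j, Δ i j * (X j - C (ξ j)) - f i).totalDegree ≤ d i - 1) → τ Δ.det = 1 := by
  obtain ⟨D, hD, hdD, A, hA, hAtop⟩ := exists_X_pow_eq_sum htop hzero
  set l : ι → MvPolynomial ι K := fun i => ∑ j, A i j * (f j - top j)
  have hl : ∀ i, (l i).totalDegree ≤ D - 1 := by
    intro i
    refine totalDegree_finsetSum_le fun j _ => (totalDegree_mul _ _).trans ?_
    have := hA i j
    have := hlow j
    have := hd j
    have := hdD j
    omega
  have hAf : ∀ i, ∑ j, A i j * f j = X i ^ D + l i := by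
    intro i
    rw [← hAtop i, ← Finset.sum_add_distrib]
    exact Finset.sum_congr rfl fun j _ => by ring
  have hdet : A.det.totalDegree + ∑ i, (d i - 1) ≤ Fintype.card ι * (D - 1) := by
    have h1 : A.det.totalDegree ≤ ∑ j, (D - d j) := by
      rw [← Matrix.det_transpose]
      exact totalDegree_det_le fun i j => hA j i
    have h2 : ∑ j, (D - d j) + ∑ i, (d i - 1) = Fintype.card ι * (D - 1) := by
      rw [← Finset.sum_add_distrib, ← smul_eq_mul, ← Finset.card_univ, ← Finset.sum_const]
      refine Finset.sum_congr rfl fun j _ => ?_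
      have := hd j
      have := hdD j
      omega
    omega
  -- Transformation law: since `A f = (X_i ^ D + l_i)`, the residue of `p` with respect to `f` is
  -- that of `det A * p` with respect to the new system.
  refine ⟨(residueAtInfinity hD hl).comp (LinearMap.mulLeft K A.det), fun p i => ?_,
    fun p hp => ?_, fun ξ Δ hΔ hΔf => ?_⟩
  · have h : A.det * f i = ∑ k, A.adjugate i k * (X k ^ D + l k) := by
      have := congrArg (fun B => B.mulVec f i) (Matrix.adjugate_mul A)
      simp only [← Matrix.mulVec_mulVec, Matrix.smul_mulVec, Matrix.one_mulVec] at this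
      simp only [← hAf]
      simpa [Matrix.mulVec, dotProduct] using this.symm
    rw [LinearMap.comp_apply, LinearMap.mulLeft_apply, mul_left_comm, h, Finset.mul_sum, map_sum]
    refine Finset.sum_eq_zero fun k _ => ?_
    rw [← mul_assoc, residueAtInfinity_mul]
  · rw [LinearMap.comp_apply, LinearMap.mulLeft_apply]
    refine residueAtInfinity_of_totalDegree_lt hD hl ?_
    have := totalDegree_mul A.det p
    omega
  · rw [LinearMap.comp_apply, LinearMap.mulLeft_apply, ← Matrix.det_mul]
    have hdeg : ∀ i j, ((A * Δ) i j).totalDegree ≤ D - 1 := by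
      intro i j
      refine totalDegree_finsetSum_le fun k _ => (totalDegree_mul _ _).trans ?_
      dsimp only
      have := hA i k
      have := hΔ k j
      have := hd k
      have := hdD k
      omega
    rw [residueAtInfinity_of_totalDegree_le hD hl (by simpa using totalDegree_det_le hdeg)]
    refine coeff_det_eq_one hD ξ hdeg fun k => ?_
    -- Multiplication by `A` carries a matrix adapted to `f` to one adapted to `X_k ^ D`, with an
    -- error of degree at most `D - 1`.
    have : ∑ j, (A * Δ) k j * (X j - C (ξ j)) - X k ^ D
        = ∑ m, A k m * (∑ j, Δ m j * (X j - C (ξ j)) - f m) + l k := by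
      rw [eq_comm, ← sub_eq_zero]
      simp only [mul_sub, Finset.sum_sub_distrib, hAf k, Matrix.mul_apply, Finset.sum_mul,
        Finset.mul_sum]
      rw [Finset.sum_comm, Finset.sum_comm (f := fun i m => A k m * Δ m i * C (ξ i))]
      simp only [mul_assoc]
      ring
    rw [this]
    refine (totalDegree_add _ _).trans (max_le (totalDegree_finsetSum_le fun m _ =>
      (totalDegree_mul _ _).trans ?_) (hl k))
    have := hA k m
    have := hΔf m
    have := hd m
    have := hdD m
    omega

/-- A first-order Taylor formula at `ξ` with control of degrees, obtained by peeling one variable at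
a time off each monomial. -/
theorem exists_sub_eval_eq_sum {ι K : Type*} [Fintype ι] [Field K] (ξ : ι → K)
    (p : MvPolynomial ι K) :
    ∃ Δ : ι → MvPolynomial ι K, (∀ j, (Δ j).totalDegree ≤ p.totalDegree - 1) ∧
      p - C (eval ξ p) = ∑ j, Δ j * (X j - C (ξ j)) := by
  classical
  have hmon : ∀ s : ι →₀ ℕ, ∃ Δ : ι → MvPolynomial ι K,
      (∀ j, (Δ j).totalDegree ≤ s.degree - 1) ∧
        monomial s (1 : K) - C (eval ξ (monomial s 1)) = ∑ j, Δ j * (X j - C (ξ j)) := by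
    intro s
    induction hn : s.degree generalizing s with
    | zero =>
      obtain rfl := (Finsupp.degree_eq_zero_iff s).1 hn
      exact ⟨0, by simp, by simp⟩
    | succ n ih =>
      obtain ⟨i, hi⟩ : ∃ i, s i ≠ 0 := by
        by_contra! h
        have : s = 0 := by ext i; simp [h]
        simp [this] at hn
      obtain ⟨t, rfl⟩ : ∃ t, s = Finsupp.single i 1 + t :=
        ⟨s - Finsupp.single i 1, by
          ext j
          by_cases hj : i = j
          · subst hj; simp; omega
          · simp [hj]⟩
      have ht : t.degree = n := by
        rw [map_add, Finsupp.degree_single] at hn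
        omega
      obtain ⟨Δ, hΔ, h⟩ := ih t ht
      have hX : (monomial (Finsupp.single i 1 + t) (1 : K)) = X i * monomial t 1 := by
        rw [X, monomial_mul, one_mul]
      refine ⟨fun j => C (ξ i) * Δ j + if j = i then monomial t 1 else 0, fun j => ?_, ?_⟩
      · refine (totalDegree_add _ _).trans (max_le ((totalDegree_mul _ _).trans ?_) ?_)
        · have := hΔ j
          rw [totalDegree_C]
          omega
        · split_ifs
          · refine (totalDegree_monomial_le _ _).trans ?_
            rw [← ht, Finsupp.degree_eq_sum, Finsupp.sum_fintype _ _ (fun _ => rfl)] 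
            simp [Finsupp.degree_eq_sum] at ht ⊢
          · simp
      · simp only [add_mul, Finset.sum_add_distrib, mul_assoc, ← Finset.mul_sum, ← h, ite_mul,
          zero_mul, Finset.sum_ite_eq', Finset.mem_univ, if_true, hX, eval_mul, eval_X, C_mul]
        ring
  choose Δ hΔ h using hmon
  refine ⟨fun j => ∑ s ∈ p.support, C (coeff s p) * Δ s j, fun j => ?_, ?_⟩
  · refine totalDegree_finsetSum_le fun s hs => (totalDegree_mul _ _).trans ?_
    have h1 := le_totalDegree hs
    have h2 := hΔ s j
    rw [totalDegree_C]
    have h3 : s.degree = s.sum fun _ e => e := rfl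
    omega
  · simp only [Finset.sum_mul]
    rw [Finset.sum_comm]
    simp only [mul_assoc, ← Finset.mul_sum, ← h]
    conv_lhs => rw [p.as_sum]
    rw [map_sum, map_sum, ← Finset.sum_sub_distrib]
    refine Finset.sum_congr rfl fun s _ => ?_
    rw [mul_sub, C_mul_monomial, mul_one, ← C_mul]
    congr 2
    simp [eval_monomial]

/-- The Euler-Jacobi formula: a global residue is the sum of the local ones. -/
theorem globalResidue_eq_sum [IsAlgClosed K] {f : ι → MvPolynomial ι K}
    {τ : MvPolynomial ι K →ₗ[K] K} (hf : ∀ p i, τ (p * f i) = 0)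
    (hdet : ∀ (ξ : ι → K) (Δ : Matrix ι ι (MvPolynomial ι K)),
        (∀ i j, (Δ i j).totalDegree ≤ (f i).totalDegree - 1) →
        (∀ i, ∑ j, Δ i j * (X j - C (ξ j)) = f i) → τ Δ.det = 1)
    (hJ : ∀ ξ : ι → K, (∀ i, eval ξ (f i) = 0) →
      (Matrix.of fun i j => eval ξ (pderiv j (f i))).det ≠ 0) :
    ∃ Z : Finset (ι → K), (∀ ξ, ξ ∈ Z ↔ ∀ i, eval ξ (f i) = 0) ∧
      ∀ g, τ g = ∑ ξ ∈ Z, eval ξ g / (Matrix.of fun i j => eval ξ (pderiv j (f i))).det := by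
  classical
  set I := Ideal.span (Set.range f)
  set V := {ξ : ι → K // ∀ i, eval ξ (f i) = 0}
  have hex : ∀ ξ : V, ∃ Δ : Matrix ι ι (MvPolynomial ι K),
      (∀ i j, (Δ i j).totalDegree ≤ (f i).totalDegree - 1) ∧
        ∀ i, ∑ j, Δ i j * (X j - C (ξ.1 j)) = f i := by
    intro ξ
    choose Δ h1 h2 using fun i => exists_sub_eval_eq_sum ξ.1 (f i)
    exact ⟨Δ, h1, fun i => by rw [← h2 i, ξ.2 i, C_0, sub_zero]⟩
  choose Δ hΔ hΔf using hex
  set b : V → MvPolynomial ι K := fun ξ => (Δ ξ).det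
  set J : (ι → K) → K := fun ξ => (Matrix.of fun i j => eval ξ (pderiv j (f i))).det
  have hI : ∀ p ∈ I, τ p = 0 := by
    intro p hp
    obtain ⟨c, rfl⟩ := Ideal.mem_span_range_iff_exists_fun.1 hp
    rw [map_sum]
    exact Finset.sum_eq_zero fun i _ => hf _ _
  have hIeval : ∀ p ∈ I, ∀ ξ : V, eval ξ.1 p = 0 := by
    intro p hp ξ
    obtain ⟨c, rfl⟩ := Ideal.mem_span_range_iff_exists_fun.1 hp
    simp [ξ.2]
  have hbX : ∀ (ξ : V) j, b ξ * (X j - C (ξ.1 j)) ∈ I := by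
    intro ξ j
    have := congrArg (fun B => (B.mulVec fun j => X j - C (ξ.1 j)) j)
      (Matrix.adjugate_mul (Δ ξ))
    simp only [← Matrix.mulVec_mulVec, Matrix.smul_mulVec, Matrix.one_mulVec] at this
    have h2 : (Δ ξ).mulVec (fun j => X j - C (ξ.1 j)) = f := by
      ext1 i
      simpa [Matrix.mulVec, dotProduct] using hΔf ξ i
    rw [h2] at this
    simp only [Pi.smul_apply, smul_eq_mul] at this
    change (Δ ξ).det * _ ∈ I
    rw [← this]
    exact Ideal.sum_mem _ fun k _ => Ideal.mul_mem_left _ _ (Ideal.subset_span ⟨k, rfl⟩)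
  -- Modulo `I` the element `b ξ` sees a polynomial only through its value at `ξ`; up to the factor
  -- `J ξ` it behaves as the idempotent of that zero.
  have hbp : ∀ (ξ : V) p, b ξ * p - C (eval ξ.1 p) * b ξ ∈ I := by
    intro ξ p
    obtain ⟨q, -, hq⟩ := exists_sub_eval_eq_sum ξ.1 p
    have : b ξ * p - C (eval ξ.1 p) * b ξ = ∑ j, q j * (b ξ * (X j - C (ξ.1 j))) := by
      rw [mul_comm (C _), ← mul_sub, hq, Finset.mul_sum]
      exact Finset.sum_congr rfl fun j _ => by ring
    rw [this]
    exact Ideal.sum_mem _ fun k _ => Ideal.mul_mem_left _ _ (hbX ξ k)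
  have hbJ : ∀ ξ : V, eval ξ.1 (b ξ) = J ξ.1 := by
    intro ξ
    change eval ξ.1 (Δ ξ).det = _
    rw [RingHom.map_det]
    congr 1
    ext i j
    simp only [RingHom.mapMatrix_apply, Matrix.map_apply, Matrix.of_apply]
    rw [← hΔf ξ i, map_sum, map_sum, Finset.sum_eq_single j]
    · simp
    · intro k _ hk
      simp [pderiv_X, hk.symm]
    · simp
  have hbne : ∀ ξ η : V, ξ ≠ η → eval η.1 (b ξ) = 0 := by
    intro ξ η hne
    obtain ⟨j, hj⟩ := Function.ne_iff.1 fun h => hne (Subtype.ext h)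
    have := hIeval _ (hbX ξ j) η
    simp only [eval_mul, eval_sub, eval_X, eval_C, mul_eq_zero] at this
    exact this.resolve_right (sub_ne_zero.2 hj.symm)
  -- A common zero of `I` and all `b ξ` would be a zero of `f` with vanishing Jacobian. The
  -- Nullstellensatz thus yields a partition of unity, in which only finitely many `b ξ` occur.
  obtain ⟨c, hc⟩ : ∃ c : V →₀ MvPolynomial ι K, 1 - ∑ ξ ∈ c.support, c ξ * b ξ ∈ I := by
    have h1 : (1 : MvPolynomial ι K) ∈ I ⊔ Ideal.span (Set.range b) := by
      have : I ⊔ Ideal.span (Set.range b) = ⊤ := by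
        rw [← Ideal.radical_eq_top, ← vanishingIdeal_zeroLocus_eq_radical (K := K),
          Ideal.eq_top_iff_one]
        intro x hx
        exfalso
        have hxf : ∀ i, eval x (f i) = 0 := fun i => by
          simpa [aeval_eq_eval] using
            hx (f i) (Ideal.mem_sup_left (Ideal.subset_span ⟨i, rfl⟩))
        have hxb : eval x (b ⟨x, hxf⟩) = 0 := by
          simpa [aeval_eq_eval] using
            hx (b ⟨x, hxf⟩) (Ideal.mem_sup_right (Ideal.subset_span ⟨_, rfl⟩))
        exact hJ x hxf ((hbJ ⟨x, hxf⟩).symm.trans hxb)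
      rw [this]
      trivial
    obtain ⟨u, hu, v, hv, huv⟩ := Submodule.mem_sup.1 h1
    obtain ⟨c, hc⟩ := Finsupp.mem_ideal_span_range_iff_exists_finsupp.1 hv
    refine ⟨c, ?_⟩
    rw [← huv, ← hc]
    simpa [Finsupp.sum] using hu
  have hcJ : ∀ ξ ∈ c.support, eval ξ.1 (c ξ) * J ξ.1 = 1 := by
    intro ξ hξ
    have := hIeval _ hc ξ
    rw [map_sub, map_sum, Finset.sum_eq_single ξ] at this
    · rw [eval_mul, hbJ, map_one, sub_eq_zero] at this
      exact this.symm
    · intro η _ hη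
      rw [eval_mul, hbne η ξ hη, mul_zero]
    · exact fun h => absurd hξ h
  -- Evaluation of the partition of unity at `ξ` forces `ξ` into its support. This is where
  -- finiteness of the zero set comes from.
  have hall : ∀ ξ : V, ξ ∈ c.support := by
    intro ξ
    by_contra hξ
    have := hIeval _ hc ξ
    rw [map_sub, map_sum, Finset.sum_eq_zero fun η hη => ?_] at this
    · simp at this
    · rw [eval_mul, hbne η ξ fun h => hξ (h ▸ hη), mul_zero]
  refine ⟨c.support.map ⟨Subtype.val, Subtype.val_injective⟩, fun ξ => ?_, fun g => ?_⟩
  · simp only [Finset.mem_map, Function.Embedding.coeFn_mk]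
    exact ⟨fun ⟨η, _, h⟩ => h ▸ η.2, fun h => ⟨⟨ξ, h⟩, hall _, rfl⟩⟩
  · rw [Finset.sum_map]
    have h1 : τ g = τ (∑ ξ ∈ c.support, g * c ξ * b ξ) := by
      rw [← sub_eq_zero, ← map_sub]
      apply hI
      have := Ideal.mul_mem_left I g hc
      rw [mul_sub, mul_one, Finset.mul_sum] at this
      simpa only [mul_assoc] using this
    rw [h1, map_sum]
    refine Finset.sum_congr rfl fun ξ hξ => ?_
    have h2 : τ (g * c ξ * b ξ) = τ (C (eval ξ.1 (g * c ξ)) * b ξ) := by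
      rw [← sub_eq_zero, ← map_sub]
      apply hI
      rw [mul_comm]
      exact hbp ξ _
    rw [h2, ← smul_eq_C_mul, map_smul, hdet ξ.1 _ (hΔ ξ) (hΔf ξ), smul_eq_mul, mul_one, eval_mul,
      Function.Embedding.coeFn_mk, eq_div_iff (hJ ξ.1 ξ.2), mul_assoc]
    exact (congrArg _ (hcJ ξ hξ)).trans (mul_one _)

end GlobalResidue

end CHY

namespace CHY

open MvPolynomial

/-! ### The residue of the ladder numerator for multilinear top forms. -/

section Ladder

variable {K : Type*} [Field K] {N : ℕ}

/-- The multilinear form of degree `m + 1` with coefficients `c`. -/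
noncomputable def multilinearForm (c : Finset (Fin N) → K) (m : Fin N) : MvPolynomial (Fin N) K :=
  ∑ I ∈ Finset.powersetCard (m.val + 1) Finset.univ, C (c I) * ∏ i ∈ I, X i

theorem prod_X_isHomogeneous (I : Finset (Fin N)) :
    (∏ i ∈ I, (X i : MvPolynomial (Fin N) K)).IsHomogeneous I.card := by
  simpa using IsHomogeneous.prod I (fun i => (X i : MvPolynomial (Fin N) K)) (fun _ => 1)
    fun i _ => isHomogeneous_X K i

theorem multilinearForm_isHomogeneous (c : Finset (Fin N) → K) (m : Fin N) :
    (multilinearForm c m).IsHomogeneous (m.val + 1) := by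
  refine IsHomogeneous.sum _ _ _ fun I hI => ?_
  rw [Finset.mem_powersetCard] at hI
  have := (isHomogeneous_C (Fin N) (c I)).mul (prod_X_isHomogeneous (K := K) I)
  rwa [zero_add, hI.2] at this

/-- If `S` is the set of nonzero coordinates of `x`, then in the form of degree `|S|` only the
monomial of `S` survives at `x`, and its coefficient is nonzero. -/
theorem eq_zero_of_multilinearForm_eq_zero {c : Finset (Fin N) → K}
    (hc : ∀ I, I.Nonempty → c I ≠ 0) {x : Fin N → K}
    (hx : ∀ m, eval x (multilinearForm c m) = 0) : x = 0 := by
  classical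
  by_contra hne
  set S := Finset.univ.filter fun i => x i ≠ 0
  have hS : S.Nonempty := by
    obtain ⟨i, hi⟩ := Function.ne_iff.1 hne
    exact ⟨i, by simpa [S] using hi⟩
  have hcard := Finset.card_pos.2 hS
  have hle : S.card ≤ N := by simpa using S.card_le_univ
  have h := hx ⟨S.card - 1, by omega⟩
  simp only [multilinearForm, map_sum, eval_mul, eval_C, eval_prod, eval_X] at h
  rw [Finset.sum_eq_single S] at h
  · refine mul_ne_zero (hc S hS) (Finset.prod_ne_zero_iff.2 fun i hi => ?_) h
    simpa [S] using hi
  · intro I hI hIS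
    rw [Finset.mem_powersetCard] at hI
    obtain ⟨i, hi, hiS⟩ : ∃ i ∈ I, i ∉ S := by
      by_contra! hsub
      exact hIS (Finset.eq_of_subset_of_card_le hsub (by rw [hI.2]; omega))
    rw [Finset.prod_eq_zero hi (by simpa [S] using hiS), mul_zero]
  · intro hI
    exact absurd (Finset.mem_powersetCard.2 ⟨Finset.subset_univ _,
      by omega⟩) hI

/-- Each squarefree monomial is divided by its variable of largest index `j` and placed in column
`j`. A set of `m + 1` indices has maximum at least `m`, with equality only for `Iic m`, so the
matrix is triangular with one monomial per diagonal entry. -/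
theorem exists_triangular_decomposition (c : Finset (Fin N) → K) :
    ∃ Δ : Matrix (Fin N) (Fin N) (MvPolynomial (Fin N) K),
      (∀ i j, (Δ i j).totalDegree ≤ i.val) ∧
      (∀ i, ∑ j, Δ i j * X j = multilinearForm c i) ∧
      Δ.det = ∏ m, (C (c (Finset.Iic m)) * ∏ i ∈ Finset.Iio m, X i) := by
  classical
  set F : Fin N → Fin N → Finset (Finset (Fin N)) := fun m j =>
    (Finset.powersetCard (m.val + 1) Finset.univ).filter fun I => j ∈ I ∧ ∀ i ∈ I, i ≤ j
  refine ⟨Matrix.of fun m j => ∑ I ∈ F m j, C (c I) * ∏ i ∈ I.erase j, X i, fun m j => ?_,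
    fun m => ?_, ?_⟩
  · rw [Matrix.of_apply]
    refine totalDegree_finsetSum_le fun I hI => (totalDegree_mul (C (c I)) _).trans ?_
    simp only [F, Finset.mem_filter, Finset.mem_powersetCard] at hI
    have := (prod_X_isHomogeneous (K := K) (I.erase j)).totalDegree_le
    rw [Finset.card_erase_of_mem hI.2.1] at this
    rw [totalDegree_C]
    omega
  · simp only [Matrix.of_apply, Finset.sum_mul, F, Finset.sum_filter, multilinearForm]
    rw [Finset.sum_comm]
    refine Finset.sum_congr rfl fun I hI => ?_
    rw [Finset.mem_powersetCard] at hI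
    have hne : I.Nonempty := Finset.card_pos.1 (by omega)
    rw [Finset.sum_eq_single (I.max' hne)]
    · rw [if_pos ⟨I.max'_mem hne, fun i hi => I.le_max' i hi⟩, mul_assoc, mul_comm (∏ i ∈ _, _),
        Finset.mul_prod_erase I _ (I.max'_mem hne)]
    · intro j _ hj
      rw [if_neg, zero_mul]
      rintro ⟨h1, h2⟩
      exact hj (le_antisymm (I.le_max' j h1) (h2 _ (I.max'_mem hne)))
    · simp
  · have htri : (Matrix.of fun m j => ∑ I ∈ F m j, C (c I) * ∏ i ∈ I.erase j,
        (X i : MvPolynomial (Fin N) K)).BlockTriangular id := by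
      intro m j hjm
      simp only [Matrix.of_apply]
      rw [Finset.sum_eq_zero]
      intro I hI
      exfalso
      simp only [F, Finset.mem_filter, Finset.mem_powersetCard] at hI
      have h1 : I ⊆ Finset.Iic j := fun i hi => Finset.mem_Iic.2 (hI.2.2 i hi)
      have h2 := Finset.card_le_card h1
      rw [Fin.card_Iic, hI.1.2] at h2
      have : j.val < m.val := hjm
      omega
    rw [Matrix.det_of_isUpperTriangular htri]
    refine Finset.prod_congr rfl fun m _ => ?_
    have hF : F m m = {Finset.Iic m} := by
      ext I
      simp only [F, Finset.mem_filter, Finset.mem_powersetCard, Finset.mem_singleton]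
      constructor
      · rintro ⟨⟨-, h1⟩, -, h2⟩
        refine Finset.eq_of_subset_of_card_le (fun i hi => Finset.mem_Iic.2 (h2 i hi)) ?_
        rw [Fin.card_Iic, h1]
      · rintro rfl
        simp
    rw [Matrix.of_apply, hF, Finset.sum_singleton, Finset.Iic_erase]

/-- The product of the staircase monomials `∏ i < l, X i` over `l ≥ m`. -/
noncomputable def staircase (K : Type*) [Field K] (N m : ℕ) : MvPolynomial (Fin N) K :=
  ∏ l ∈ Finset.univ.filter (fun l : Fin N => m ≤ l.val), ∏ i ∈ Finset.Iio l, X i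

theorem filter_le_eq_insert (m : Fin N) :
    Finset.univ.filter (fun l : Fin N => m.val ≤ l.val)
      = insert m (Finset.univ.filter fun l : Fin N => m.val + 1 ≤ l.val) := by
  ext l
  simp only [Finset.mem_filter, Finset.mem_univ, true_and, Finset.mem_insert, Fin.ext_iff]
  omega

theorem filter_lt_succ_eq_insert (m : Fin N) :
    Finset.univ.filter (fun l : Fin N => l.val < m.val + 1)
      = insert m (Finset.univ.filter fun l : Fin N => l.val < m.val) := by
  ext l
  simp only [Finset.mem_filter, Finset.mem_univ, true_and, Finset.mem_insert, Fin.ext_iff]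
  omega

theorem staircase_eq_mul (m : Fin N) :
    staircase K N m = (∏ i ∈ Finset.Iio m, X i) * staircase K N (m + 1) := by
  rw [staircase, filter_le_eq_insert, Finset.prod_insert (by simp), staircase]

theorem sum_filter_le_eq_add (m : Fin N) :
    ∑ l ∈ Finset.univ.filter (fun l : Fin N => m.val ≤ l.val), l.val
      = m + ∑ l ∈ Finset.univ.filter (fun l : Fin N => m.val + 1 ≤ l.val), l.val := by
  rw [filter_le_eq_insert, Finset.sum_insert (by simp)]

theorem staircase_eq_one {m : ℕ} (h : N ≤ m) : staircase K N m = 1 := by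
  rw [staircase, Finset.filter_false_of_mem, Finset.prod_empty]
  intro l _
  omega

theorem totalDegree_prod_X_le (I : Finset (Fin N)) :
    (∏ i ∈ I, (X i : MvPolynomial (Fin N) K)).totalDegree ≤ I.card :=
  (prod_X_isHomogeneous I).totalDegree_le

theorem totalDegree_staircase_le (m : ℕ) : (staircase K N m).totalDegree
    ≤ ∑ l ∈ Finset.univ.filter (fun l : Fin N => m ≤ l.val), l.val := by
  refine (totalDegree_finsetProd _ _).trans (Finset.sum_le_sum fun l _ => ?_)
  simpa using totalDegree_prod_X_le (K := K) (Finset.Iio l)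

/-- The alternative `s = 0` is needed for empty `S`, where the degree bound would fail in `ℕ`. -/
theorem prod_sub_sub_prod_eq_mul (S : Finset (Fin N)) {z : MvPolynomial (Fin N) K}
    (hz : z.totalDegree ≤ 1) :
    ∃ s : MvPolynomial (Fin N) K, ∏ i ∈ S, (X i - z) - ∏ i ∈ S, X i = z * s ∧
      (s = 0 ∨ s.totalDegree + 1 ≤ S.card) := by
  induction S using Finset.induction_on with
  | empty => exact ⟨0, by simp, Or.inl rfl⟩
  | insert a S ha ih =>
    obtain ⟨s, hs, hdeg⟩ := ih
    have h1 : (∏ i ∈ S, (X i - z)).totalDegree ≤ S.card := by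
      refine (totalDegree_finsetProd _ _).trans ?_
      rw [Finset.card_eq_sum_ones]
      exact Finset.sum_le_sum fun i _ => (totalDegree_sub _ _).trans (by simpa using hz)
    refine ⟨X a * s - ∏ i ∈ S, (X i - z), ?_, Or.inr ?_⟩
    · rw [Finset.prod_insert ha, Finset.prod_insert ha]
      linear_combination X a * hs
    · rw [Finset.card_insert_of_notMem ha]
      refine Nat.add_le_add_right ((totalDegree_sub _ _).trans (max_le ?_ h1)) 1
      rcases hdeg with rfl | hdeg
      · simp
      · refine (totalDegree_mul _ _).trans ?_
        rw [totalDegree_X]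
        omega

variable {c : Finset (Fin N) → K} {f : Fin N → MvPolynomial (Fin N) K}
  {τ : MvPolynomial (Fin N) K →ₗ[K] K}

/-- The relation `f m` trades the monomial of `Iic m` for monomials that contain a variable of index
above `m`. Those are multiples of `staircase (m+1) * X i` with `i > m`, so the claim descends from
`m + 1` to `m`. At `m = N` no index is left. -/
theorem residue_staircase_mul_X_mul (hc : ∀ I, I.Nonempty → c I ≠ 0)
    (hlow : ∀ m, (f m - multilinearForm c m).totalDegree ≤ m.val)
    (hτ : ∀ p i, τ (p * f i) = 0)
    (hτ' : ∀ p : MvPolynomial (Fin N) K, p.totalDegree < ∑ l : Fin N, l.val → τ p = 0)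
    {m : ℕ} (hm : m ≤ N) {j : Fin N} (hj : m ≤ j.val) (r : MvPolynomial (Fin N) K)
    (hr : r.totalDegree + 1 + ∑ l ∈ Finset.univ.filter (fun l : Fin N => m ≤ l.val), l.val
      ≤ ∑ l : Fin N, l.val) :
    τ (staircase K N m * X j * r) = 0 := by
  classical
  induction hm using Nat.decreasingInduction generalizing j r with
  | self => exact absurd j.isLt (by omega)
  | of_succ m hm ih =>
    set M : Fin N := ⟨m, hm⟩
    have hs : staircase K N m = (∏ i ∈ Finset.Iio M, X i) * staircase K N (m + 1) :=
      staircase_eq_mul M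
    have hsum : ∑ l ∈ Finset.univ.filter (fun l : Fin N => m ≤ l.val), l.val
      = m + ∑ l ∈ Finset.univ.filter (fun l : Fin N => m + 1 ≤ l.val), l.val :=
      sum_filter_le_eq_add M
    have hdq := totalDegree_staircase_le (K := K) (N := N) (m + 1)
    rcases Nat.lt_or_ge m j.val with hlt | hge
    · rw [hs, show (∏ i ∈ Finset.Iio M, X i) * staircase K N (m + 1) * X j * r
        = staircase K N (m + 1) * X j * ((∏ i ∈ Finset.Iio M, X i) * r) by ring]
      refine ih hlt _ ?_
      have h1 := totalDegree_mul (∏ i ∈ Finset.Iio M, (X i : MvPolynomial (Fin N) K)) r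
      have h2 := totalDegree_prod_X_le (K := K) (Finset.Iio M)
      simp only [Fin.card_Iio, M] at h2 h1 ⊢
      omega
    · obtain rfl : j = M := Fin.ext (le_antisymm hge hj)
      have hmono : (∏ i ∈ Finset.Iio M, (X i : MvPolynomial (Fin N) K)) * X M
          = ∏ i ∈ Finset.Iic M, X i := by
        rw [← Finset.Iic_erase, Finset.prod_erase_mul _ _ (by simp)]
      -- The product with `f M` has residue zero, and the product with `f M - multilinearForm c M`
      -- falls below the critical degree.
      have htop : τ (staircase K N (m + 1) * r * multilinearForm c M) = 0 := by
        have h1 : staircase K N (m + 1) * r * multilinearForm c M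
            = staircase K N (m + 1) * r * f M
              - staircase K N (m + 1) * r * (f M - multilinearForm c M) := by ring
        rw [h1, map_sub, hτ, zero_sub, neg_eq_zero]
        apply hτ'
        have h2 := totalDegree_mul (staircase K N (m + 1) * r) (f M - multilinearForm c M)
        have h3 := totalDegree_mul (staircase K N (m + 1)) r
        have h4 := hlow M
        simp only [M] at h4 h2 ⊢
        omega
      rw [multilinearForm, ← Finset.add_sum_erase _ _ (a := Finset.Iic M)
        (Finset.mem_powersetCard.2 ⟨Finset.subset_univ _, by simp⟩), mul_add, map_add,
        Finset.mul_sum, map_sum, Finset.sum_eq_zero, add_zero] at htop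
      · have h1 : staircase K N m * X M * r
            = staircase K N (m + 1) * r * ∏ i ∈ Finset.Iic M, X i := by
          rw [hs, ← hmono]; ring
        rw [mul_left_comm, ← smul_eq_C_mul, map_smul, smul_eq_mul] at htop
        rw [h1]
        exact (mul_eq_zero.1 htop).resolve_left (hc _ ⟨M, by simp⟩)
      · intro I hI
        rw [Finset.mem_erase, Finset.mem_powersetCard] at hI
        obtain ⟨hne, -, hcard⟩ := hI
        obtain ⟨i, hi, hMi⟩ : ∃ i ∈ I, i ∉ Finset.Iic M := by
          by_contra! hsub
          exact hne (Finset.eq_of_subset_of_card_le hsub (by rw [hcard, Fin.card_Iic]))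
        have hlt : M < i := by simpa using hMi
        rw [← Finset.mul_prod_erase I _ hi, show staircase K N (m + 1) * r * (C (c I) *
          (X i * ∏ a ∈ I.erase i, X a))
          = staircase K N (m + 1) * X i * (C (c I) * (∏ a ∈ I.erase i, X a) * r) by ring]
        refine ih hlt _ ?_
        have h1 := totalDegree_mul (C (c I) * ∏ a ∈ I.erase i, X a) r
        have h2 := totalDegree_mul (C (c I)) (∏ a ∈ I.erase i, X a)
        have h3 := totalDegree_prod_X_le (K := K) (I.erase i)
        rw [totalDegree_C] at h2
        rw [Finset.card_erase_of_mem hi, hcard] at h3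
        simp only [M] at h3
        omega

/-- The numerator `∏_{i < m} (X i - z m)`, whose residue is that of the staircase. -/
theorem residue_numerator (hc : ∀ I, I.Nonempty → c I ≠ 0)
    (hlow : ∀ m, (f m - multilinearForm c m).totalDegree ≤ m.val)
    (hτ : ∀ p i, τ (p * f i) = 0)
    (hτ' : ∀ p : MvPolynomial (Fin N) K, p.totalDegree < ∑ l : Fin N, l.val → τ p = 0)
    {z : Fin N → MvPolynomial (Fin N) K} (hz : ∀ m, (z m).totalDegree ≤ 1)
    (hz' : ∀ m, (∃ j : Fin N, m.val + 1 ≤ j.val ∧ z m = X j) ∨ (m.val + 1 = N ∧ z m = 1)) :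
    τ (∏ m, ∏ i ∈ Finset.Iio m, (X i - z m)) = τ (staircase K N 0) := by
  classical
  set G : Fin N → MvPolynomial (Fin N) K := fun m => ∏ i ∈ Finset.Iio m, (X i - z m)
  -- `H m` has the true factors for `l < m` and the staircase factors for `l ≥ m`; it interpolates
  -- between the staircase `H 0` and the numerator `H N`.
  set H : ℕ → MvPolynomial (Fin N) K := fun m =>
    (∏ l ∈ Finset.univ.filter (fun l : Fin N => l.val < m), G l) * staircase K N m
  have hG : ∀ m, (G m).totalDegree ≤ m.val := by
    intro m
    refine (totalDegree_finsetProd _ _).trans ?_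
    refine (Finset.sum_le_sum (g := fun _ => 1) fun i _ =>
      (totalDegree_sub _ _).trans (by simpa using hz m)).trans ?_
    simp
  have step : ∀ m ≤ N, τ (H m) = τ (H 0) := by
    intro m
    induction m with
    | zero => simp
    | succ m ih =>
      intro hm
      rw [← ih (by omega), ← sub_eq_zero, ← map_sub]
      set M : Fin N := ⟨m, hm⟩
      obtain ⟨s, hs, hdeg⟩ := prod_sub_sub_prod_eq_mul (Finset.Iio M) (hz M)
      set P := ∏ l ∈ Finset.univ.filter (fun l : Fin N => l.val < m), G l
      have hH : H (m + 1) - H m = staircase K N (m + 1) * z M * (P * s) := by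
        have h1 : staircase K N m = (∏ i ∈ Finset.Iio M, X i) * staircase K N (m + 1) :=
          staircase_eq_mul M
        have h2 : ∏ l ∈ Finset.univ.filter (fun l : Fin N => l.val < m + 1), G l = G M * P := by
          have := filter_lt_succ_eq_insert M
          simp only [M] at this
          rw [this, Finset.prod_insert (by simp)]
        simp only [H]
        rw [h1, h2]
        change _ = _ at hs
        linear_combination P * staircase K N (m + 1) * hs
      rw [hH]
      rcases hdeg with rfl | hdeg
      · simp
      have hP : P.totalDegree
          ≤ ∑ l ∈ Finset.univ.filter (fun l : Fin N => l.val < m), l.val :=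
        (totalDegree_finsetProd _ _).trans (Finset.sum_le_sum fun l _ => hG l)
      have hsplit : ∑ l ∈ Finset.univ.filter (fun l : Fin N => l.val < m), l.val
          + ∑ l ∈ Finset.univ.filter (fun l : Fin N => m ≤ l.val), l.val = ∑ l : Fin N, l.val := by
        rw [← Finset.sum_filter_add_sum_filter_not Finset.univ (fun l : Fin N => l.val < m)]
        simp only [not_lt]
      have hsum : ∑ l ∈ Finset.univ.filter (fun l : Fin N => m ≤ l.val), l.val
        = m + ∑ l ∈ Finset.univ.filter (fun l : Fin N => m + 1 ≤ l.val), l.val :=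
        sum_filter_le_eq_add M
      have hPs := totalDegree_mul P s
      simp only [Fin.card_Iio, M] at hdeg
      -- If `z M` is a later variable, the difference is a multiple of `staircase (m+1) * X j`, of
      -- residue zero. If `z M = 1`, the degree drops below the critical one.
      rcases hz' M with ⟨j, hj, hzj⟩ | ⟨hN, hz1⟩
      · rw [hzj]
        refine residue_staircase_mul_X_mul hc hlow hτ hτ' hm hj _ ?_
        omega
      · have hN' : m + 1 = N := hN
        rw [hz1, staircase_eq_one (by omega), one_mul, one_mul]
        apply hτ'
        omega
  have h := step N le_rfl
  have h0 : H 0 = staircase K N 0 := by simp [H]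
  have hN : H N = ∏ m, G m := by
    simp [H, staircase_eq_one]
  rwa [h0, hN] at h

/-- The global residue of the ladder numerator is the inverse of the leading coefficients. -/
theorem exists_sum_numerator_div_jacobian [IsAlgClosed K]
    (hc : ∀ I, I.Nonempty → c I ≠ 0)
    (hlow : ∀ m, (f m - multilinearForm c m).totalDegree ≤ m.val)
    {z : Fin N → MvPolynomial (Fin N) K} (hz : ∀ m, (z m).totalDegree ≤ 1)
    (hz' : ∀ m, (∃ j : Fin N, m.val + 1 ≤ j.val ∧ z m = X j) ∨ (m.val + 1 = N ∧ z m = 1))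
    (hJ : ∀ ξ : Fin N → K, (∀ i, eval ξ (f i) = 0) →
      (Matrix.of fun i j => eval ξ (pderiv j (f i))).det ≠ 0) :
    ∃ Z : Finset (Fin N → K), (∀ ξ, ξ ∈ Z ↔ ∀ i, eval ξ (f i) = 0) ∧
      ∑ ξ ∈ Z, eval ξ (∏ m, ∏ i ∈ Finset.Iio m, (X i - z m))
        / (Matrix.of fun i j => eval ξ (pderiv j (f i))).det = 1 / ∏ m, c (Finset.Iic m) := by
  obtain ⟨τ, hτ, hτ', hdet⟩ := exists_globalResidue (f := f) (top := multilinearForm c)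
    (d := fun m => m.val + 1) (fun _ => by omega) (multilinearForm_isHomogeneous c)
    hlow (fun x hx => eq_zero_of_multilinearForm_eq_zero hc hx)
  simp only [Nat.add_sub_cancel] at hτ' hdet
  have hfdeg : ∀ i, (f i).totalDegree ≤ i.val + 1 := by
    intro i
    rw [← sub_add_cancel (f i) (multilinearForm c i)]
    exact (totalDegree_add _ _).trans (max_le ((hlow i).trans (by omega))
      (multilinearForm_isHomogeneous c i).totalDegree_le)
  obtain ⟨Z, hZ, hsum⟩ := globalResidue_eq_sum hτ (fun ξ Δ h1 h2 => hdet ξ Δ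
    (fun i j => (h1 i j).trans (by have := hfdeg i; omega)) fun i => by simp [h2 i]) hJ
  refine ⟨Z, hZ, ?_⟩
  rw [← hsum, residue_numerator hc hlow hτ hτ' hz hz']
  -- The triangular matrix is adapted to `f` at `ξ = 0`, so its determinant, a constant times the
  -- staircase, has residue 1.
  obtain ⟨Δ, hΔ, hΔtop, hΔdet⟩ := exists_triangular_decomposition c
  have h1 := hdet 0 Δ hΔ fun i => by
    have : ∑ j, Δ i j * (X j - C ((0 : Fin N → K) j)) = multilinearForm c i := by
      simpa using hΔtop i
    rw [this, ← totalDegree_neg, neg_sub]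
    exact hlow i
  have h2 : Δ.det = C (∏ m, c (Finset.Iic m)) * staircase K N 0 := by
    rw [hΔdet, Finset.prod_mul_distrib, map_prod, staircase]
    simp
  rw [h2, ← smul_eq_C_mul, map_smul, smul_eq_mul] at h1
  rw [eq_div_iff, mul_comm, h1]
  exact Finset.prod_ne_zero_iff.2 fun m _ => hc _ ⟨m, by simp⟩

end Ladder

end CHY

namespace CHY

open Matrix

/-! ### Bordered determinants of a matrix with prescribed kernel vectors. -/

section Bordered

variable {ι κ K : Type*} [Fintype ι] [DecidableEq ι] [Fintype κ] [DecidableEq κ] [Field K]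

/-- The border `Y` matters only through its restriction `Y W` to the kernel vectors: a column
operation along `W` leaves `Φ` unchanged and turns `Y` into `G Y'`, where `G = (Y W)(Y' W)⁻¹`. -/
theorem det_bordered_mul_det {Φ : Matrix ι ι K} {X : Matrix ι κ K} {Y Y' : Matrix κ ι K}
    {W : Matrix ι κ K} (hW : Φ * W = 0) (hY : (Y * W).det ≠ 0) (hY' : (Y' * W).det ≠ 0) :
    (fromBlocks Φ X Y 0).det * (Y' * W).det = (fromBlocks Φ X Y' 0).det * (Y * W).det := by
  have hu : IsUnit (Y * W).det := hY.isUnit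
  have hu' : IsUnit (Y' * W).det := hY'.isUnit
  set G := Y * W * (Y' * W)⁻¹
  have hG : G * Y' * W = Y * W := by
    rw [Matrix.mul_assoc, Matrix.mul_assoc, Matrix.nonsing_inv_mul _ hu', Matrix.mul_one]
  set L := 1 + W * ((Y * W)⁻¹ * (G * Y' - Y))
  -- By `det (1 + AB) = det (1 + BA)`, as `G * Y' - Y` annihilates `W`.
  have hL : L.det = 1 := by
    rw [Matrix.det_one_add_mul_comm, Matrix.mul_assoc, Matrix.sub_mul, hG, sub_self,
      Matrix.mul_zero, add_zero, Matrix.det_one]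
  have hΦL : Φ * L = Φ := by
    rw [Matrix.mul_add, Matrix.mul_one, ← Matrix.mul_assoc, hW, Matrix.zero_mul, add_zero]
  have hYL : Y * L = G * Y' := by
    rw [Matrix.mul_add, Matrix.mul_one, ← Matrix.mul_assoc, ← Matrix.mul_assoc,
      Matrix.mul_nonsing_inv _ hu, Matrix.one_mul, add_sub_cancel]
  have h1 : fromBlocks Φ X Y 0 * fromBlocks L 0 0 1 = fromBlocks 1 0 0 G * fromBlocks Φ X Y' 0 := by
    simp [fromBlocks_multiply, hΦL, hYL]
  have h2 := congrArg Matrix.det h1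
  simp only [Matrix.det_mul, Matrix.det_fromBlocks_zero₂₁, Matrix.det_one, hL, mul_one,
    one_mul] at h2
  have h3 : G.det * (Y' * W).det = (Y * W).det := by
    rw [← Matrix.det_mul, ← Matrix.mul_assoc, hG]
  rw [h2, ← h3]
  ring

/-- For a selection matrix `X` the sum `Φ + X (Y - Xᵀ Φ)` is `Φ` with the selected rows replaced by
those of `Y`. Block elimination identifies the two determinants up to `det (-1)`. -/
theorem det_replace_rows_eq {Φ : Matrix ι ι K} {X : Matrix ι κ K} {Y : Matrix κ ι K}
    (hX : Xᵀ * X = 1) :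
    (fromBlocks Φ X Y 0).det = (Φ + X * (Y - Xᵀ * Φ)).det * (-1 : Matrix κ κ K).det := by
  set M := Φ + X * (Y - Xᵀ * Φ)
  have hM : Xᵀ * M = Y := by
    rw [Matrix.mul_add, ← Matrix.mul_assoc, hX, Matrix.one_mul, add_sub_cancel]
  have h1 : fromBlocks 1 0 (-Xᵀ) 1 * (fromBlocks Φ X Y 0 * fromBlocks 1 0 (Y - Xᵀ * Φ) 1)
      = fromBlocks M X 0 (-1) := by
    rw [fromBlocks_multiply, fromBlocks_multiply]
    simp only [Matrix.mul_one, Matrix.mul_zero, zero_add, Matrix.one_mul, Matrix.zero_mul,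
      add_zero, Matrix.neg_mul, hX]
    rw [show Φ + X * (Y - Xᵀ * Φ) = M from rfl, hM, neg_add_cancel]
  have h2 := congrArg Matrix.det h1
  simpa only [Matrix.det_mul, Matrix.det_fromBlocks_zero₂₁, Matrix.det_fromBlocks_zero₁₂,
    Matrix.det_one, one_mul, mul_one] using h2

end Bordered

/-! ### The scattering Jacobian, its `SL(2)` kernel and the independence of `p` and `q`. -/

section Jacobian

variable {V : Type*} [AddCommGroup V] [Module ℂ V] {B : LinearMap.BilinForm ℂ V} {n : ℕ}
  {k : Fin n → V} {σ : Fin n → ℂ}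

/-- The selection matrix of a triple of labels. -/
def tripleRows (p : Fin 3 ↪ Fin n) : Matrix (Fin 3) (Fin n) ℂ :=
  Matrix.of fun m j => if j = p m then 1 else 0

theorem tripleRows_mul {κ : Type*} (p : Fin 3 ↪ Fin n) (M : Matrix (Fin n) κ ℂ) :
    tripleRows p * M = Matrix.of fun m j => M (p m) j := by
  ext m j
  simp [tripleRows, Matrix.mul_apply]

theorem reducedMinor_eq_det_bordered (p q : Fin 3 ↪ Fin n) :
    reducedMinor B k p q σ
      = -(fromBlocks (scatteringJacobian B k σ) (tripleRows q)ᵀ (tripleRows p) 0).det := by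
  rw [det_replace_rows_eq]
  · have h : (-1 : Matrix (Fin 3) (Fin 3) ℂ).det = -1 := by
      rw [Matrix.det_neg]; norm_num
    rw [h, mul_neg_one, neg_neg, reducedMinor]
    congr 1
    ext i j
    have h01 : q 0 ≠ q 1 := q.injective.ne (by decide)
    have h02 : q 0 ≠ q 2 := q.injective.ne (by decide)
    have h12 : q 1 ≠ q 2 := q.injective.ne (by decide)
    rw [transpose_transpose, tripleRows_mul]
    simp only [Matrix.of_apply, Matrix.add_apply, Matrix.mul_apply, Matrix.transpose_apply,
      Matrix.sub_apply, Fin.sum_univ_three, tripleRows]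
    by_cases h0 : i = q 0
    · subst h0; simp [h01, h02]
    by_cases h1 : i = q 1
    · subst h1; simp [h01.symm, h12]
    by_cases h2 : i = q 2
    · subst h2; simp [h02.symm, h12.symm]
    simp [h0, h1, h2]
  · rw [transpose_transpose, tripleRows_mul]
    ext a b
    simp only [tripleRows, Matrix.of_apply, Matrix.transpose_apply, q.injective.eq_iff,
      Matrix.one_apply]

/-- The matrix of the generators of `SL(2,ℂ)` acting on the punctures. -/
def generatorMatrix (σ : Fin n → ℂ) : Matrix (Fin n) (Fin 3) ℂ :=
  Matrix.of fun a m => σ a ^ m.val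

theorem det_tripleRows_mul_generatorMatrix (p : Fin 3 ↪ Fin n) :
    (tripleRows p * generatorMatrix σ).det = tripleFactor p σ := by
  rw [tripleRows_mul, Matrix.det_fin_three]
  simp [generatorMatrix, tripleFactor]
  ring

theorem tripleFactor_ne_zero (hσ : Function.Injective σ) (p : Fin 3 ↪ Fin n) :
    tripleFactor p σ ≠ 0 := by
  have h : ∀ i j, i ≠ j → σ (p i) - σ (p j) ≠ 0 := fun i j hij =>
    sub_ne_zero.2 (hσ.ne (p.injective.ne hij))
  exact mul_ne_zero (mul_ne_zero (h _ _ (by decide)) (h _ _ (by decide))) (h _ _ (by decide))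

theorem sum_erase_pairing_eq_zero (hk : IsMasslessKinematics B k) (a : Fin n) :
    ∑ b ∈ Finset.univ.erase a, B (k a) (k b) = 0 := by
  have h : ∑ b, B (k a) (k b) = 0 := by rw [← map_sum, hk.conservation, map_zero]
  rwa [← Finset.add_sum_erase _ _ (Finset.mem_univ a), hk.null, zero_add] at h

theorem scatteringJacobian_apply_self (hσ : Function.Injective σ) (a : Fin n) :
    scatteringJacobian B k σ a a
      = -∑ b ∈ Finset.univ.erase a, 2 * B (k a) (k b) / (σ a - σ b) ^ 2 := by
  rw [scatteringJacobian, Matrix.of_apply]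
  apply HasDerivAt.deriv
  have h : (fun z => scatteringFn B k (Function.update σ a z) a)
      = fun z => ∑ b ∈ Finset.univ.erase a, 2 * B (k a) (k b) * (z - σ b)⁻¹ := by
    ext z
    refine Finset.sum_congr rfl fun b hb => ?_
    rw [Function.update_self, Function.update_of_ne (Finset.ne_of_mem_erase hb), div_eq_mul_inv]
  rw [h, ← Finset.sum_neg_distrib]
  refine HasDerivAt.fun_sum fun b hb => ?_
  have hne : σ a - σ b ≠ 0 := sub_ne_zero.2 (hσ.ne (Finset.ne_of_mem_erase hb).symm)
  have := ((hasDerivAt_id' (σ a)).sub_const (σ b)).fun_inv hne |>.const_mul (2 * B (k a) (k b))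
  exact this.congr_deriv (by ring)

theorem scatteringJacobian_apply_ne (hσ : Function.Injective σ) {a c : Fin n} (hac : a ≠ c) :
    scatteringJacobian B k σ a c = 2 * B (k a) (k c) / (σ a - σ c) ^ 2 := by
  rw [scatteringJacobian, Matrix.of_apply]
  apply HasDerivAt.deriv
  have hc : c ∈ Finset.univ.erase a := by simp [hac.symm]
  have h : (fun z => scatteringFn B k (Function.update σ c z) a)
      = fun z => 2 * B (k a) (k c) * (σ a - z)⁻¹
        + ∑ b ∈ (Finset.univ.erase a).erase c, 2 * B (k a) (k b) / (σ a - σ b) := by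
    ext z
    rw [scatteringFn, ← Finset.add_sum_erase _ _ hc, Function.update_self,
      Function.update_of_ne hac, div_eq_mul_inv]
    congr 1
    refine Finset.sum_congr rfl fun b hb => ?_
    rw [Function.update_of_ne (Finset.ne_of_mem_erase hb)]
  rw [h]
  have hne : σ a - σ c ≠ 0 := sub_ne_zero.2 (hσ.ne hac)
  have := (((hasDerivAt_id' (σ c)).const_sub (σ a)).fun_inv hne |>.const_mul
    (2 * B (k a) (k c))).add_const
      (∑ b ∈ (Finset.univ.erase a).erase c, 2 * B (k a) (k b) / (σ a - σ b))
  exact this.congr_deriv (by ring)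

theorem differentiableAt_scatteringFn (hσ : Function.Injective σ) (a c : Fin n) :
    DifferentiableAt ℂ (fun z => scatteringFn B k (Function.update σ c z) a) (σ c) := by
  unfold scatteringFn
  refine DifferentiableAt.fun_sum fun b hb => ?_
  have hab : a ≠ b := (Finset.ne_of_mem_erase hb).symm
  have h : ∀ d, DifferentiableAt ℂ (fun z => Function.update σ c z d) (σ c) := by
    intro d
    by_cases hd : d = c
    · subst hd; simp
    · simp [hd]
  refine (differentiableAt_const _).div ((h a).sub (h b)) ?_
  simpa using sub_ne_zero.2 (hσ.ne hab)

/-- Infinitesimal Möbius covariance: the columns `1, σ, σ²` are the `SL(2)` vector fields. The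
powers give respectively `0`, `-E_a`, and a sum that vanishes by momentum conservation and `E_a =
0`. -/
theorem scatteringJacobian_mul_generatorMatrix (hk : IsMasslessKinematics B k)
    (hσ : Function.Injective σ) (hE : ∀ a, scatteringFn B k σ a = 0) :
    scatteringJacobian B k σ * generatorMatrix σ = 0 := by
  have key : ∀ a (e : ℕ), ∑ b, scatteringJacobian B k σ a b * σ b ^ e
      = ∑ b ∈ Finset.univ.erase a,
        2 * B (k a) (k b) / (σ a - σ b) ^ 2 * (σ b ^ e - σ a ^ e) := by
    intro a e
    rw [← Finset.add_sum_erase _ _ (Finset.mem_univ a), scatteringJacobian_apply_self hσ,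
      neg_mul, Finset.sum_mul, ← Finset.sum_neg_distrib, ← Finset.sum_add_distrib]
    refine Finset.sum_congr rfl fun b hb => ?_
    rw [scatteringJacobian_apply_ne hσ (Finset.ne_of_mem_erase hb).symm]
    ring
  have hs : ∀ a, ∑ b ∈ Finset.univ.erase a, 2 * B (k a) (k b) = 0 := by
    intro a
    rw [← Finset.mul_sum, sum_erase_pairing_eq_zero hk, mul_zero]
  ext a m
  rw [Matrix.mul_apply, Matrix.zero_apply]
  simp only [generatorMatrix, Matrix.of_apply, key]
  have hne : ∀ b ∈ Finset.univ.erase a, σ a - σ b ≠ 0 := fun b hb =>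
    sub_ne_zero.2 (hσ.ne (Finset.ne_of_mem_erase hb).symm)
  fin_cases m
  · simp
  · have : ∀ b ∈ Finset.univ.erase a, 2 * B (k a) (k b) / (σ a - σ b) ^ 2 * (σ b ^ 1 - σ a ^ 1)
        = -(2 * B (k a) (k b) / (σ a - σ b)) := by
      intro b hb
      have := hne b hb
      field_simp
      ring
    rw [Finset.sum_congr rfl this, Finset.sum_neg_distrib, neg_eq_zero]
    exact hE a
  · have : ∀ b ∈ Finset.univ.erase a, 2 * B (k a) (k b) / (σ a - σ b) ^ 2 * (σ b ^ 2 - σ a ^ 2)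
        = 2 * B (k a) (k b) - 2 * σ a * (2 * B (k a) (k b) / (σ a - σ b)) := by
      intro b hb
      have := hne b hb
      field_simp
      ring
    rw [Finset.sum_congr rfl this, Finset.sum_sub_distrib, hs, ← Finset.mul_sum]
    have := hE a
    rw [scatteringFn] at this
    rw [this]
    simp

theorem scatteringJacobian_transpose (hB : B.IsSymm) (hσ : Function.Injective σ) :
    (scatteringJacobian B k σ)ᵀ = scatteringJacobian B k σ := by
  ext a b
  rw [Matrix.transpose_apply]
  by_cases hab : a = b
  · rw [hab]
  · rw [scatteringJacobian_apply_ne hσ hab, scatteringJacobian_apply_ne hσ (Ne.symm hab),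
      ← hB.eq (k a) (k b), ← neg_sub (σ a), neg_sq]

/-- The Jacobian is symmetric, and transposing the bordered matrix exchanges the two borders.
Independence of `q` thereby follows from independence of `p`. -/
theorem reducedMinor_comm (hB : B.IsSymm) (hσ : Function.Injective σ) (p q : Fin 3 ↪ Fin n) :
    reducedMinor B k p q σ = reducedMinor B k q p σ := by
  rw [reducedMinor_eq_det_bordered, reducedMinor_eq_det_bordered, ← Matrix.det_transpose,
    fromBlocks_transpose, scatteringJacobian_transpose hB hσ, transpose_transpose, transpose_zero]

theorem reducedMinor_mul_tripleFactor (hk : IsMasslessKinematics B k)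
    (hσ : Function.Injective σ) (hE : ∀ a, scatteringFn B k σ a = 0) (p p' q : Fin 3 ↪ Fin n) :
    reducedMinor B k p q σ * tripleFactor p' σ = reducedMinor B k p' q σ * tripleFactor p σ := by
  rw [reducedMinor_eq_det_bordered, reducedMinor_eq_det_bordered, neg_mul, neg_mul, neg_inj,
    ← det_tripleRows_mul_generatorMatrix, ← det_tripleRows_mul_generatorMatrix]
  apply det_bordered_mul_det (scatteringJacobian_mul_generatorMatrix hk hσ hE)
  · rw [det_tripleRows_mul_generatorMatrix]; exact tripleFactor_ne_zero hσ p
  · rw [det_tripleRows_mul_generatorMatrix]; exact tripleFactor_ne_zero hσ p'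

/-- The reduced determinant does not depend on the removed rows and columns. -/
theorem reducedMinor_mul_tripleFactor_mul (hB : B.IsSymm) (hk : IsMasslessKinematics B k)
    (hσ : Function.Injective σ) (hE : ∀ a, scatteringFn B k σ a = 0)
    (p q p' q' : Fin 3 ↪ Fin n) :
    reducedMinor B k p q σ * (tripleFactor p' σ * tripleFactor q' σ)
      = reducedMinor B k p' q' σ * (tripleFactor p σ * tripleFactor q σ) := by
  have h1 := reducedMinor_mul_tripleFactor hk hσ hE p p' q
  have h2 := reducedMinor_mul_tripleFactor hk hσ hE q q' p'
  rw [reducedMinor_comm hB hσ q p', reducedMinor_comm hB hσ q' p'] at h2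
  linear_combination tripleFactor q' σ * h1 + tripleFactor p σ * h2

/-- The identities `∑ E_a σ_a^m = 0` for `m = 0, 1, 2` hold at every configuration of distinct
punctures. If only three of the `E_a` can be nonzero, these are a Vandermonde system for them. -/
theorem scatteringFn_eq_zero_of_notMem_range (hB : B.IsSymm) (hk : IsMasslessKinematics B k)
    (hσ : Function.Injective σ) {q : Fin 3 ↪ Fin n}
    (hE : ∀ a, a ∉ Set.range q → scatteringFn B k σ a = 0) (a : Fin n) :
    scatteringFn B k σ a = 0 := by
  -- Symmetrisation in `a` and `b` turns the simple poles into divided differences of `σ^e`.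
  have hpair : ∀ e : ℕ, 2 * ∑ a, scatteringFn B k σ a * σ a ^ e
      = ∑ a, ∑ b ∈ Finset.univ.erase a,
        2 * B (k a) (k b) * ((σ a ^ e - σ b ^ e) / (σ a - σ b)) := by
    intro e
    have h1 : ∑ a, scatteringFn B k σ a * σ a ^ e = ∑ a, ∑ b,
        if a = b then 0 else 2 * B (k a) (k b) / (σ a - σ b) * σ a ^ e := by
      refine Finset.sum_congr rfl fun a _ => ?_
      rw [scatteringFn, Finset.sum_mul, ← Finset.add_sum_erase _ (fun b => if a = b then 0 else _)
        (Finset.mem_univ a), if_pos rfl, zero_add]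
      exact Finset.sum_congr rfl fun b hb => by rw [if_neg (Finset.ne_of_mem_erase hb).symm]
    rw [two_mul]
    nth_rewrite 2 [h1]
    rw [Finset.sum_comm, h1, ← Finset.sum_add_distrib]
    refine Finset.sum_congr rfl fun a _ => ?_
    rw [← Finset.sum_add_distrib, ← Finset.add_sum_erase _ _ (Finset.mem_univ a), if_pos rfl,
      add_zero, zero_add]
    refine Finset.sum_congr rfl fun b hb => ?_
    have hba := Finset.ne_of_mem_erase hb
    rw [if_neg hba.symm, if_neg hba, ← hB.eq (k a) (k b)]
    have h2 : σ a - σ b ≠ 0 := sub_ne_zero.2 (hσ.ne hba.symm)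
    have h3 : σ b - σ a ≠ 0 := sub_ne_zero.2 (hσ.ne hba)
    rw [← neg_sub (σ a) (σ b)]
    field_simp
    ring
  have hzero : ∀ m : Fin 3, ∑ a, scatteringFn B k σ a * σ a ^ m.val = 0 := by
    intro m
    suffices h : 2 * ∑ a, scatteringFn B k σ a * σ a ^ m.val = 0 by simpa using h
    rw [hpair]
    have hne : ∀ a, ∀ b ∈ Finset.univ.erase a, σ a - σ b ≠ 0 := fun a b hb =>
      sub_ne_zero.2 (hσ.ne (Finset.ne_of_mem_erase hb).symm)
    have hs : ∀ a, ∑ b ∈ Finset.univ.erase a, 2 * B (k a) (k b) = 0 := fun a => by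
      rw [← Finset.mul_sum, sum_erase_pairing_eq_zero hk, mul_zero]
    fin_cases m
    · simp
    · refine Finset.sum_eq_zero fun a _ => ?_
      rw [← hs a]
      refine Finset.sum_congr rfl fun b hb => ?_
      simp [div_self (hne a b hb)]
    · have h1 : ∀ a, ∑ b ∈ Finset.univ.erase a,
          2 * B (k a) (k b) * ((σ a ^ 2 - σ b ^ 2) / (σ a - σ b))
          = ∑ b, 2 * B (k a) (k b) * σ b := by
        intro a
        have h2 : ∑ b ∈ Finset.univ.erase a,
            2 * B (k a) (k b) * ((σ a ^ 2 - σ b ^ 2) / (σ a - σ b))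
            = ∑ b ∈ Finset.univ.erase a, (2 * B (k a) (k b) * σ a + 2 * B (k a) (k b) * σ b) := by
          refine Finset.sum_congr rfl fun b hb => ?_
          have := hne a b hb
          field_simp
          ring
        rw [h2, Finset.sum_add_distrib, ← Finset.sum_mul, hs, zero_mul, zero_add,
          ← Finset.add_sum_erase _ _ (Finset.mem_univ a), hk.null]
        ring
      change ∑ a, ∑ b ∈ Finset.univ.erase a,
          2 * B (k a) (k b) * ((σ a ^ 2 - σ b ^ 2) / (σ a - σ b)) = 0
      simp only [h1]
      rw [Finset.sum_comm]
      refine Finset.sum_eq_zero fun b _ => ?_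
      rw [← Finset.sum_mul, ← Finset.mul_sum]
      have : ∑ a, B (k a) (k b) = 0 := by
        rw [← LinearMap.sum_apply, ← map_sum, hk.conservation, map_zero, LinearMap.zero_apply]
      rw [this]
      ring
  by_cases ha : a ∈ Set.range q
  · have hv : Matrix.vecMul (fun m => scatteringFn B k σ (q m))
        (tripleRows q * generatorMatrix σ) = 0 := by
      ext m
      have h := hzero m
      rw [← Finset.sum_subset (Finset.subset_univ (Finset.univ.map q)) fun b _ hb => by
        rw [hE b (by simpa using hb), zero_mul], Finset.sum_map] at h
      rw [tripleRows_mul]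
      exact h
    have := Matrix.eq_zero_of_vecMul_eq_zero
      (by rw [det_tripleRows_mul_generatorMatrix]; exact tripleFactor_ne_zero hσ q) hv
    obtain ⟨m, rfl⟩ := ha
    exact congrFun this m
  · exact hE a ha

end Jacobian

end CHY

namespace CHY

open MvPolynomial

/-! ### The polynomial scattering equations and the absence of collisions. -/

section Polynomials

variable {N : ℕ}

/-- The punctures `2, …, n` in the gauge `σ_1 = ∞`, `σ_{n-1} = 1`, `σ_n = 0`. -/
def gaugeFix {α : Type*} [Zero α] [One α] (x : Fin N → α) : Fin (N + 2) → α :=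
  Fin.snoc (α := fun _ => α) (Fin.snoc (α := fun _ => α) x 1) 0

section

variable {α : Type*} [Zero α] [One α] (x : Fin N → α)

@[simp]
theorem gaugeFix_castSucc_castSucc (j : Fin N) : gaugeFix x j.castSucc.castSucc = x j := by
  simp [gaugeFix]

@[simp]
theorem gaugeFix_castSucc_last : gaugeFix x (Fin.last N).castSucc = 1 := by
  simp [gaugeFix]

@[simp]
theorem gaugeFix_last : gaugeFix x (Fin.last (N + 1)) = 0 := by
  simp [gaugeFix]

end

/-- The inclusion of the unfixed punctures. -/
def unfixed (N : ℕ) : Fin N ↪ Fin (N + 2) :=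
  ⟨fun j => j.castSucc.castSucc, fun a b h => by simpa using h⟩

variable {V : Type*} [AddCommGroup V] [Module ℂ V] {B : LinearMap.BilinForm ℂ V}
  {k : Fin (N + 3) → V}

/-- `k_S²` for a set `S` of labels other than `1`. -/
def tailMomentumSq (B : LinearMap.BilinForm ℂ V) (k : Fin (N + 3) → V)
    (S : Finset (Fin (N + 2))) : ℂ :=
  momentumSq B k (S.map (Fin.succEmb (N + 2)))

theorem tailMomentumSq_eq_sum (hk : IsMasslessKinematics B k) (S : Finset (Fin (N + 2))) :
    tailMomentumSq B k S = ∑ a ∈ S, ∑ b ∈ S.erase a, B (k a.succ) (k b.succ) := by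
  rw [tailMomentumSq, momentumSq]
  simp only [map_sum, LinearMap.sum_apply]
  rw [Finset.sum_comm, Finset.sum_map]
  refine Finset.sum_congr rfl fun a ha => ?_
  rw [Finset.sum_map, ← Finset.add_sum_erase _ _ ha]
  simp [hk.null]

theorem tailMomentumSq_of_card_le_one (hk : IsMasslessKinematics B k) {S : Finset (Fin (N + 2))}
    (hS : S.card ≤ 1) : tailMomentumSq B k S = 0 := by
  rw [tailMomentumSq_eq_sum hk]
  refine Finset.sum_eq_zero fun a ha => ?_
  have : S.erase a = ∅ := by
    rw [← Finset.card_eq_zero, Finset.card_erase_of_mem ha]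
    omega
  rw [this, Finset.sum_empty]

theorem tailMomentumSq_compl (hk : IsMasslessKinematics B k) (S : Finset (Fin (N + 2))) :
    tailMomentumSq B k Sᶜ = momentumSq B k (insert 0 (S.map (Fin.succEmb (N + 2)))) := by
  have h : ∑ i ∈ Sᶜ.map (Fin.succEmb (N + 2)), k i
      = -∑ i ∈ insert 0 (S.map (Fin.succEmb (N + 2))), k i := by
    rw [eq_neg_iff_add_eq_zero, ← hk.conservation, Fin.sum_univ_succ, Finset.sum_insert (by simp),
      Finset.sum_map, Finset.sum_map, ← Finset.sum_add_sum_compl S]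
    simp only [Fin.coe_succEmb]
    abel
  rw [tailMomentumSq, momentumSq, h, momentumSq]
  simp only [map_neg, LinearMap.neg_apply, neg_neg]

theorem tailMomentumSq_univ (hk : IsMasslessKinematics B k) :
    tailMomentumSq B k Finset.univ = 0 := by
  have := tailMomentumSq_compl hk ∅
  rw [Finset.compl_empty] at this
  rw [this]
  simp [momentumSq, hk.null]

theorem tailMomentumSq_ne_zero
    (hgen : ∀ I : Finset (Fin (N + 3)), 2 ≤ I.card → I.card + 2 ≤ N + 3 → momentumSq B k I ≠ 0)
    {S : Finset (Fin (N + 2))} (h2 : 2 ≤ S.card) (hS : S.card ≤ N + 1) :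
    tailMomentumSq B k S ≠ 0 :=
  hgen _ (by simpa using h2) (by simp; omega)

/-- The polynomial scattering equations of Dolan and Goddard in the gauge `gaugeFix`. -/
noncomputable def ladderPoly (B : LinearMap.BilinForm ℂ V) (k : Fin (N + 3) → V) (m : Fin N) :
    MvPolynomial (Fin N) ℂ :=
  ∑ I ∈ Finset.powersetCard (m.val + 1) Finset.univ,
    C (tailMomentumSq B k Iᶜ) * ∏ a ∈ I, gaugeFix (X : Fin N → MvPolynomial (Fin N) ℂ) a

theorem eval_gaugeFix_X (x : Fin N → ℂ) (a : Fin (N + 2)) :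
    eval x (gaugeFix (X : Fin N → MvPolynomial (Fin N) ℂ) a) = gaugeFix x a := by
  induction a using Fin.lastCases with
  | last => simp
  | cast a =>
    induction a using Fin.lastCases with
    | last => simp
    | cast a => simp

theorem eval_ladderPoly (x : Fin N → ℂ) (m : Fin N) :
    eval x (ladderPoly B k m) = ∑ I ∈ Finset.powersetCard (m.val + 1) Finset.univ,
      tailMomentumSq B k Iᶜ * ∏ a ∈ I, gaugeFix x a := by
  simp [ladderPoly, eval_gaugeFix_X]

theorem totalDegree_gaugeFix_X_le (a : Fin (N + 2)) :
    (gaugeFix (X : Fin N → MvPolynomial (Fin N) ℂ) a).totalDegree ≤ 1 := by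
  induction a using Fin.lastCases with
  | last => simp
  | cast a =>
    induction a using Fin.lastCases with
    | last => simp
    | cast a => simp

theorem totalDegree_gaugeFix_X_eq_zero {a : Fin (N + 2)} (ha : a ∉ Set.range (unfixed N)) :
    (gaugeFix (X : Fin N → MvPolynomial (Fin N) ℂ) a).totalDegree = 0 := by
  induction a using Fin.lastCases with
  | last => simp
  | cast a =>
    induction a using Fin.lastCases with
    | last => simp
    | cast a => exact absurd ⟨a, rfl⟩ ha

/-- A monomial that involves one of the fixed punctures `1` and `0` loses at least one degree, so
the top form consists of the sets of unfixed labels. -/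
theorem totalDegree_ladderPoly_sub_le (m : Fin N) :
    (ladderPoly B k m - multilinearForm
      (fun I => tailMomentumSq B k (I.map (unfixed N))ᶜ) m).totalDegree ≤ m.val := by
  classical
  set T := (Finset.powersetCard (m.val + 1) (Finset.univ : Finset (Fin N))).map
    (Finset.mapEmbedding (unfixed N)).toEmbedding
  have hT : T ⊆ Finset.powersetCard (m.val + 1) Finset.univ := by
    intro I hI
    simp only [T, Finset.mem_map, Finset.mem_powersetCard] at hI ⊢
    obtain ⟨J, ⟨-, hJ⟩, rfl⟩ := hI
    exact ⟨Finset.subset_univ _, by simpa using hJ⟩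
  have h1 : multilinearForm (fun I => tailMomentumSq B k (I.map (unfixed N))ᶜ) m
      = ∑ I ∈ T, C (tailMomentumSq B k Iᶜ) *
        ∏ a ∈ I, gaugeFix (X : Fin N → MvPolynomial (Fin N) ℂ) a := by
    rw [Finset.sum_map, multilinearForm]
    refine Finset.sum_congr rfl fun I _ => ?_
    simp only [RelEmbedding.coe_toEmbedding, Finset.mapEmbedding_apply, Finset.prod_map]
    congr 1
    exact Finset.prod_congr rfl fun i _ => (gaugeFix_castSucc_castSucc _ _).symm
  rw [ladderPoly, h1, ← Finset.sum_sdiff hT, add_sub_cancel_right]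
  refine totalDegree_finsetSum_le fun I hI => ?_
  rw [Finset.mem_sdiff, Finset.mem_powersetCard] at hI
  obtain ⟨⟨-, hcard⟩, hIT⟩ := hI
  obtain ⟨a, haI, ha⟩ : ∃ a ∈ I, a ∉ Set.range (unfixed N) := by
    by_contra! h
    apply hIT
    have hmap : (Finset.univ.filter fun j => unfixed N j ∈ I).map (unfixed N) = I := by
      ext a
      simp only [Finset.mem_map, Finset.mem_filter, Finset.mem_univ, true_and]
      constructor
      · rintro ⟨j, hj, rfl⟩
        exact hj
      · intro haI
        obtain ⟨j, rfl⟩ := h a haI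
        exact ⟨j, haI, rfl⟩
    simp only [T, Finset.mem_map, Finset.mem_powersetCard]
    refine ⟨_, ⟨Finset.subset_univ _, ?_⟩, hmap⟩
    rw [← hcard, ← hmap, Finset.card_map, hmap]
  refine (totalDegree_mul _ _).trans ?_
  rw [totalDegree_C, zero_add, ← Finset.mul_prod_erase _ _ haI]
  refine (totalDegree_mul _ _).trans ?_
  rw [totalDegree_gaugeFix_X_eq_zero ha, zero_add]
  refine (totalDegree_finsetProd _ _).trans ((Finset.sum_le_sum fun a _ =>
    totalDegree_gaugeFix_X_le a).trans ?_)
  rw [Finset.sum_const, Finset.card_erase_of_mem haI, hcard]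
  simp

/-- The generating function of the polynomial scattering equations. -/
noncomputable def scatteringGenerating {R : Type*} [CommRing R] (β : Fin (N + 2) → Fin (N + 2) → R)
    (y : Fin (N + 2) → R) (z : R) : R :=
  ∑ a, ∑ b ∈ Finset.univ.erase a, β a b * ∏ c ∈ (Finset.univ.erase a).erase b, (z - y c)

theorem card_erase_erase {a b : Fin (N + 2)} (hb : b ∈ Finset.univ.erase a) :
    ((Finset.univ.erase a).erase b).card = N := by
  rw [Finset.card_erase_of_mem hb, Finset.card_erase_of_mem (Finset.mem_univ a)]
  simp

/-- Each product is expanded over the set `I` of factors contributing `-y c`, and the sums are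
exchanged. The truncated exponent `N - I.card` is harmless: for `|I| > N` the complement has at most
one element and the inner sum is empty. -/
theorem scatteringGenerating_eq_sum_powerset (β : Fin (N + 2) → Fin (N + 2) → ℂ)
    (y : Fin (N + 2) → ℂ) (z : ℂ) :
    scatteringGenerating β y z = ∑ I ∈ (Finset.univ : Finset (Fin (N + 2))).powerset,
      (∑ a ∈ Iᶜ, ∑ b ∈ Iᶜ.erase a, β a b) * ((-1) ^ I.card * z ^ (N - I.card) * ∏ c ∈ I, y c) := by
  have h1 : ∀ a, ∀ b ∈ Finset.univ.erase a,
      β a b * ∏ c ∈ (Finset.univ.erase a).erase b, (z - y c)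
      = ∑ I ∈ ((Finset.univ.erase a).erase b).powerset,
        β a b * ((-1) ^ I.card * z ^ (N - I.card) * ∏ c ∈ I, y c) := by
    intro a b hb
    rw [← Finset.mul_sum]
    congr 1
    rw [Finset.prod_congr rfl fun c _ => show z - y c = -y c + z by ring, Finset.prod_add]
    refine Finset.sum_congr rfl fun I hI => ?_
    rw [Finset.prod_neg, Finset.prod_const, Finset.card_sdiff_of_subset (Finset.mem_powerset.1 hI),
      card_erase_erase hb]
    ring
  rw [scatteringGenerating, Finset.sum_congr rfl fun a _ => Finset.sum_congr rfl (h1 a)]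
  have h2 : ∀ a, ∑ b ∈ Finset.univ.erase a, ∑ I ∈ ((Finset.univ.erase a).erase b).powerset,
      β a b * ((-1) ^ I.card * z ^ (N - I.card) * ∏ c ∈ I, y c)
      = ∑ I ∈ (Finset.univ.erase a).powerset, ∑ b ∈ Iᶜ.erase a,
        β a b * ((-1) ^ I.card * z ^ (N - I.card) * ∏ c ∈ I, y c) := by
    intro a
    refine Finset.sum_comm' fun b I => ?_
    simp only [Finset.mem_powerset, Finset.mem_erase, Finset.mem_univ, Finset.mem_compl,
      Finset.subset_iff, and_true]
    grind
  rw [Finset.sum_congr rfl fun a _ => h2 a]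
  rw [Finset.sum_comm' (t' := Finset.univ.powerset) (s' := fun I => Iᶜ) fun a I => by
    simp only [Finset.mem_powerset, Finset.mem_erase, Finset.mem_univ, Finset.mem_compl,
      Finset.subset_iff, and_true]
    grind]
  simp only [Finset.sum_mul]

/-- Only orders `1` to `N` survive: order `0` carries `k_{2…n}² = k_1² = 0`, and orders `N + 1` and
`N + 2` the square of at most one massless momentum. -/
theorem scatteringGenerating_gaugeFix (hk : IsMasslessKinematics B k) (x : Fin N → ℂ) (z : ℂ) :
    scatteringGenerating (fun a b => B (k a.succ) (k b.succ)) (gaugeFix x) z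
      = ∑ m : Fin N, (-1) ^ (m.val + 1) * z ^ (N - (m.val + 1)) * eval x (ladderPoly B k m) := by
  rw [scatteringGenerating_eq_sum_powerset]
  simp only [← tailMomentumSq_eq_sum hk]
  rw [Finset.sum_powerset, Finset.card_univ, Fintype.card_fin, Finset.sum_range_succ,
    Finset.sum_range_succ, Finset.sum_range_succ', Finset.sum_range]
  have hsmall : ∀ j, N + 1 ≤ j → ∑ I ∈ Finset.powersetCard j (Finset.univ : Finset (Fin (N + 2))),
      tailMomentumSq B k Iᶜ * ((-1) ^ I.card * z ^ (N - I.card) * ∏ c ∈ I, gaugeFix x c) = 0 := by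
    intro j hj
    refine Finset.sum_eq_zero fun I hI => ?_
    rw [Finset.mem_powersetCard] at hI
    rw [tailMomentumSq_of_card_le_one hk, zero_mul]
    rw [Finset.card_compl, Fintype.card_fin, hI.2]
    omega
  rw [hsmall _ le_rfl, hsmall (N + 2) (by omega), add_zero, add_zero]
  simp only [Finset.powersetCard_zero, Finset.sum_singleton, Finset.compl_empty,
    tailMomentumSq_univ hk, zero_mul, add_zero]
  refine Finset.sum_congr rfl fun m _ => ?_
  rw [eval_ladderPoly, Finset.mul_sum]
  refine Finset.sum_congr rfl fun I hI => ?_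
  rw [(Finset.mem_powersetCard.1 hI).2]
  ring

/-- Orders of vanishing at `z = v` are compared. With `|S| = r + 2`, a product that omits two
members of `S` vanishes to order exactly `r`, every other one to order at least `r + 1`. The
coefficient of `(z - v)^r` is the sum over `S` times the nonzero `∏_{c ∉ S} (v - y c)`. -/
theorem sum_eq_zero_of_scatteringGenerating_eq_zero {β : Fin (N + 2) → Fin (N + 2) → ℂ}
    {y : Fin (N + 2) → ℂ} (h : ∀ z, scatteringGenerating β y z = 0) (v : ℂ)
    (hS : 2 ≤ (Finset.univ.filter fun a => y a = v).card) :
    ∑ a ∈ Finset.univ.filter (fun a => y a = v),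
      ∑ b ∈ (Finset.univ.filter fun a => y a = v).erase a, β a b = 0 := by
  classical
  set S := Finset.univ.filter fun a => y a = v
  obtain ⟨r, hr⟩ : ∃ r, S.card = r + 2 := ⟨S.card - 2, by omega⟩
  set L : Polynomial ℂ := Polynomial.X - Polynomial.C v
  set Y : Fin (N + 2) → Polynomial ℂ := fun c => Polynomial.X - Polynomial.C (y c)
  have hYS : ∀ c ∈ S, Y c = L := fun c hc => by
    have : y c = v := by simpa [S] using hc
    simp [Y, L, this]
  have hpoly : ∑ a, ∑ b ∈ Finset.univ.erase a, Polynomial.C (β a b) *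
      ∏ c ∈ (Finset.univ.erase a).erase b, Y c = 0 := by
    refine Polynomial.funext fun z => ?_
    have := h z
    rw [scatteringGenerating] at this
    simpa [Polynomial.eval_finsetSum, Polynomial.eval_prod, Y] using this
  have hT : ∀ T : Finset (Fin (N + 2)), T ⊆ S → ∏ c ∈ T, Y c = L ^ T.card := by
    intro T hTS
    rw [Finset.prod_congr rfl fun c hc => hYS c (hTS hc), Finset.prod_const]
  have hin : ∀ a ∈ S, ∀ b ∈ S.erase a,
      ∏ c ∈ (Finset.univ.erase a).erase b, Y c = L ^ r * ∏ c ∈ Sᶜ, Y c := by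
    intro a ha b hb
    have hsub : (S.erase a).erase b ⊆ (Finset.univ.erase a).erase b := by
      intro c; simp only [Finset.mem_erase]; grind
    have hdiff : (Finset.univ.erase a).erase b \ (S.erase a).erase b = Sᶜ := by
      ext c; simp only [Finset.mem_sdiff, Finset.mem_erase, Finset.mem_compl] at hb ⊢; grind
    rw [← Finset.prod_sdiff hsub, hdiff, hT _ ((Finset.erase_subset _ _).trans
      (Finset.erase_subset _ _)), Finset.card_erase_of_mem hb, Finset.card_erase_of_mem ha, hr,
      mul_comm]
    simp
  have hout : ∀ a, ∀ b ∈ Finset.univ.erase a, (a ∉ S ∨ b ∉ S) →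
      L ^ (r + 1) ∣ ∏ c ∈ (Finset.univ.erase a).erase b, Y c := by
    intro a b hb hab
    have hsub : (S.erase a).erase b ⊆ (Finset.univ.erase a).erase b := by
      intro c; simp only [Finset.mem_erase]; grind
    refine dvd_trans ?_ (Finset.prod_dvd_prod_of_subset _ _ _ hsub)
    rw [hT _ ((Finset.erase_subset _ _).trans (Finset.erase_subset _ _))]
    apply pow_dvd_pow
    rcases hab with ha | hb'
    · rw [Finset.erase_eq_of_notMem ha]
      have := Finset.pred_card_le_card_erase (s := S) (a := b)
      omega
    · rw [Finset.erase_right_comm, Finset.erase_eq_of_notMem hb']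
      have := Finset.pred_card_le_card_erase (s := S) (a := a)
      omega
  set κ := ∑ a ∈ S, ∑ b ∈ S.erase a, β a b
  have hdvd : L ^ (r + 1) ∣ L ^ r * (Polynomial.C κ * ∏ c ∈ Sᶜ, Y c) := by
    have hmain : L ^ r * (Polynomial.C κ * ∏ c ∈ Sᶜ, Y c) = ∑ a ∈ S, ∑ b ∈ S.erase a,
        Polynomial.C (β a b) * ∏ c ∈ (Finset.univ.erase a).erase b, Y c := by
      simp only [κ, map_sum, Finset.sum_mul, Finset.mul_sum]
      refine Finset.sum_congr rfl fun a ha => Finset.sum_congr rfl fun b hb => ?_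
      rw [hin a ha b hb]
      ring
    rw [hmain, ← dvd_add_left (c := ∑ a ∈ S, ∑ b ∈ Sᶜ, Polynomial.C (β a b) *
      ∏ c ∈ (Finset.univ.erase a).erase b, Y c), ← Finset.sum_add_distrib]
    · rw [← dvd_add_left (c := ∑ a ∈ Sᶜ, ∑ b ∈ Finset.univ.erase a, Polynomial.C (β a b) *
        ∏ c ∈ (Finset.univ.erase a).erase b, Y c)]
      · convert dvd_zero (L ^ (r + 1))
        rw [← hpoly, ← Finset.sum_add_sum_compl S]
        congr 1
        refine Finset.sum_congr rfl fun a ha => ?_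
        have h1 : Disjoint (S.erase a) Sᶜ :=
          Finset.disjoint_of_subset_left (Finset.erase_subset _ _) disjoint_compl_right
        have h2 : S.erase a ∪ Sᶜ = Finset.univ.erase a := by
          ext c; simp only [Finset.mem_union, Finset.mem_erase, Finset.mem_compl]; grind
        rw [← Finset.sum_union h1, h2]
      · refine Finset.dvd_sum fun a ha => Finset.dvd_sum fun b hb => Dvd.dvd.mul_left ?_ _
        exact hout a b hb (Or.inl (Finset.mem_compl.1 ha))
    · refine Finset.dvd_sum fun a ha => Finset.dvd_sum fun b hb => Dvd.dvd.mul_left ?_ _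
      rw [Finset.mem_compl] at hb
      exact hout a b (Finset.mem_erase.2 ⟨fun h => hb (h ▸ ha), Finset.mem_univ _⟩) (Or.inr hb)
  rw [pow_succ, mul_dvd_mul_iff_left (pow_ne_zero _ (Polynomial.X_sub_C_ne_zero v)),
    Polynomial.dvd_iff_isRoot, Polynomial.IsRoot, Polynomial.eval_mul, Polynomial.eval_C,
    Polynomial.eval_prod, mul_eq_zero] at hdvd
  refine hdvd.resolve_right (Finset.prod_ne_zero_iff.2 fun c hc => ?_)
  have : y c ≠ v := by simpa [S] using hc
  simpa [Y, sub_eq_zero] using this.symm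

/-- Punctures of a set `S` colliding at one value would force `k_S² = 0`, contrary to genericity. -/
theorem gaugeFix_injective (hk : IsMasslessKinematics B k)
    (hgen : ∀ I : Finset (Fin (N + 3)), 2 ≤ I.card → I.card + 2 ≤ N + 3 → momentumSq B k I ≠ 0)
    {x : Fin N → ℂ} (hx : ∀ m, eval x (ladderPoly B k m) = 0) :
    Function.Injective (gaugeFix x) := by
  classical
  intro a b hab
  by_contra hne
  set S := Finset.univ.filter fun c => gaugeFix x c = gaugeFix x a
  have h2 : 2 ≤ S.card := by
    have : ({a, b} : Finset (Fin (N + 2))) ⊆ S := by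
      intro c hc
      simp only [Finset.mem_insert, Finset.mem_singleton] at hc
      rcases hc with rfl | rfl <;> simp [S, hab]
    simpa [Finset.card_pair hne] using Finset.card_le_card this
  -- Not all punctures can coincide, because two of them are fixed at `0` and `1`.
  have hS : S.card ≤ N + 1 := by
    by_contra! hlt
    have : S = Finset.univ := Finset.eq_univ_of_card _ (by
      have := S.card_le_univ
      simp only [Fintype.card_fin] at this ⊢
      omega)
    have h0 : Fin.last (N + 1) ∈ S := this ▸ Finset.mem_univ _
    have h1 : (Fin.last N).castSucc ∈ S := this ▸ Finset.mem_univ _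
    simp only [S, Finset.mem_filter, Finset.mem_univ, true_and, gaugeFix_last,
      gaugeFix_castSucc_last] at h0 h1
    exact zero_ne_one (h0.trans h1.symm)
  refine tailMomentumSq_ne_zero hgen h2 hS ?_
  rw [tailMomentumSq_eq_sum hk]
  refine sum_eq_zero_of_scatteringGenerating_eq_zero (fun z => ?_) _ h2
  rw [scatteringGenerating_gaugeFix hk]
  simp [hx]

end Polynomials

end CHY

namespace CHY

open MvPolynomial

/-! ### Cross ratios, and the equivalence of the two systems of equations. -/

section GaugeCoordinates

variable {N : ℕ}

/-- The factor relating differences of punctures to differences of cross ratios. -/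
noncomputable def gaugeScale (σ : Fin (N + 3) → ℂ) : ℂ :=
  (σ (Fin.last N).castSucc.succ - σ 0) * (σ (Fin.last (N + 1)).succ - σ 0)
    / (σ (Fin.last N).castSucc.succ - σ (Fin.last (N + 1)).succ)

/-- The cross ratios of the punctures with the three fixed ones. -/
noncomputable def crossRatio (σ : Fin (N + 3) → ℂ) (a : Fin (N + 2)) : ℂ :=
  gaugeScale σ * (σ a.succ - σ (Fin.last (N + 1)).succ)
    / ((σ a.succ - σ 0) * (σ (Fin.last (N + 1)).succ - σ 0))

/-- The cross ratios of the unfixed punctures. -/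
noncomputable def gaugeCoord (σ : Fin (N + 3) → ℂ) (j : Fin N) : ℂ :=
  crossRatio σ j.castSucc.castSucc

variable {σ : Fin (N + 3) → ℂ}

theorem sub_zero_ne_zero (hσ : Function.Injective σ) (a : Fin (N + 2)) : σ a.succ - σ 0 ≠ 0 :=
  sub_ne_zero.2 (hσ.ne (Fin.succ_ne_zero a))

theorem succ_sub_succ_ne_zero (hσ : Function.Injective σ) {a b : Fin (N + 2)} (hab : a ≠ b) :
    σ a.succ - σ b.succ ≠ 0 :=
  sub_ne_zero.2 (hσ.ne fun h => hab (Fin.succ_injective _ h))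

theorem castSucc_last_ne_last : (Fin.last N).castSucc ≠ Fin.last (N + 1) :=
  (Fin.castSucc_lt_last _).ne

theorem gaugeScale_ne_zero (hσ : Function.Injective σ) : gaugeScale σ ≠ 0 :=
  div_ne_zero (mul_ne_zero (sub_zero_ne_zero hσ _) (sub_zero_ne_zero hσ _))
    (succ_sub_succ_ne_zero hσ castSucc_last_ne_last)

theorem crossRatio_sub (hσ : Function.Injective σ) (a b : Fin (N + 2)) :
    crossRatio σ a - crossRatio σ b
      = gaugeScale σ * (σ a.succ - σ b.succ) / ((σ a.succ - σ 0) * (σ b.succ - σ 0)) := by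
  have ha := sub_zero_ne_zero hσ a
  have hb := sub_zero_ne_zero hσ b
  have hl := sub_zero_ne_zero hσ (Fin.last (N + 1))
  unfold crossRatio
  rw [div_sub_div _ _ (mul_ne_zero ha hl) (mul_ne_zero hb hl), div_eq_div_iff
    (mul_ne_zero (mul_ne_zero ha hl) (mul_ne_zero hb hl)) (mul_ne_zero ha hb)]
  ring

theorem crossRatio_injective (hσ : Function.Injective σ) : Function.Injective (crossRatio σ) := by
  intro a b h
  by_contra hab
  have h1 := crossRatio_sub hσ a b
  rw [h, sub_self, eq_comm] at h1
  exact div_ne_zero (mul_ne_zero (gaugeScale_ne_zero hσ) (succ_sub_succ_ne_zero hσ hab))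
    (mul_ne_zero (sub_zero_ne_zero hσ a) (sub_zero_ne_zero hσ b)) h1

theorem crossRatio_last (σ : Fin (N + 3) → ℂ) : crossRatio σ (Fin.last (N + 1)) = 0 := by
  simp [crossRatio]

theorem crossRatio_castSucc_last (hσ : Function.Injective σ) :
    crossRatio σ (Fin.last N).castSucc = 1 := by
  have h1 := sub_zero_ne_zero hσ (Fin.last N).castSucc
  have h2 := sub_zero_ne_zero hσ (Fin.last (N + 1))
  have h3 := succ_sub_succ_ne_zero hσ (castSucc_last_ne_last (N := N))
  unfold crossRatio gaugeScale
  rw [div_mul_cancel₀ _ h3, div_self (mul_ne_zero h1 h2)]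

theorem gaugeFix_gaugeCoord (hσ : Function.Injective σ) :
    gaugeFix (gaugeCoord σ) = crossRatio σ := by
  ext a
  induction a using Fin.lastCases with
  | last => rw [gaugeFix_last, crossRatio_last]
  | cast a =>
    induction a using Fin.lastCases with
    | last => rw [gaugeFix_castSucc_last, crossRatio_castSucc_last hσ]
    | cast a => rw [gaugeFix_castSucc_castSucc]; rfl

variable {V : Type*} [AddCommGroup V] [Module ℂ V] {B : LinearMap.BilinForm ℂ V}
  {k : Fin (N + 3) → V}

theorem scatteringFn_succ (a : Fin (N + 2)) : scatteringFn B k σ a.succ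
    = 2 * B (k a.succ) (k 0) / (σ a.succ - σ 0)
      + ∑ b ∈ Finset.univ.erase a, 2 * B (k a.succ) (k b.succ) / (σ a.succ - σ b.succ) := by
  have h : Finset.univ.erase a.succ
      = insert 0 ((Finset.univ.erase a).map (Fin.succEmb (N + 2))) := by
    ext i
    induction i using Fin.cases with
    | zero => simp [(Fin.succ_ne_zero a).symm]
    | succ i => simp
  rw [scatteringFn, h, Finset.sum_insert (by simp), Finset.sum_map]
  rfl

/-- At `z = y_a` only pairs containing `a` survive, and each gives `∏ (y_a - y_c)` divided by `y_a -
y_b`. Writing `σ_b - σ_1 = (σ_a - σ_1) - σ_ab` in that quotient splits off a constant part, whose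
sum is the missing term of puncture `1` by momentum conservation. -/
theorem scatteringGenerating_crossRatio (hB : B.IsSymm) (hk : IsMasslessKinematics B k)
    (hσ : Function.Injective σ) (a : Fin (N + 2)) :
    scatteringGenerating (fun a b => B (k a.succ) (k b.succ)) (crossRatio σ) (crossRatio σ a)
      = (∏ c ∈ Finset.univ.erase a, (crossRatio σ a - crossRatio σ c))
        * ((σ a.succ - σ 0) ^ 2 / gaugeScale σ) * scatteringFn B k σ a.succ := by
  set y := crossRatio σ
  have hy : ∀ b ∈ Finset.univ.erase a, y a - y b ≠ 0 := fun b hb =>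
    sub_ne_zero.2 ((crossRatio_injective hσ).ne (Finset.ne_of_mem_erase hb).symm)
  have hprod : ∀ b ∈ Finset.univ.erase a, ∏ c ∈ (Finset.univ.erase a).erase b, (y a - y c)
      = (∏ c ∈ Finset.univ.erase a, (y a - y c)) / (y a - y b) := by
    intro b hb
    rw [eq_div_iff (hy b hb), Finset.prod_erase_mul _ _ hb]
  have h1 : scatteringGenerating (fun a b => B (k a.succ) (k b.succ)) y (y a)
      = ∑ b ∈ Finset.univ.erase a, 2 * B (k a.succ) (k b.succ)
        * ∏ c ∈ (Finset.univ.erase a).erase b, (y a - y c) := by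
    rw [scatteringGenerating, ← Finset.add_sum_erase _ _ (Finset.mem_univ a),
      ← Finset.sum_add_distrib]
    refine Finset.sum_congr rfl fun b hb => ?_
    have hab := Finset.ne_of_mem_erase hb
    rw [Finset.sum_eq_single a, Finset.erase_right_comm, hB.eq]
    · ring
    · intro c _ hca
      rw [Finset.prod_eq_zero (i := a), mul_zero]
      · simp [hca.symm, hab.symm]
      · exact sub_self _
    · intro h
      exact absurd (Finset.mem_erase.2 ⟨hab.symm, Finset.mem_univ a⟩) h
  have hua := sub_zero_ne_zero hσ a
  have hD := gaugeScale_ne_zero hσ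
  have hterm : ∀ b ∈ Finset.univ.erase a, 2 * B (k a.succ) (k b.succ)
        * ∏ c ∈ (Finset.univ.erase a).erase b, (y a - y c)
      = (∏ c ∈ Finset.univ.erase a, (y a - y c)) * ((σ a.succ - σ 0) / gaugeScale σ)
        * ((σ a.succ - σ 0) * (2 * B (k a.succ) (k b.succ) / (σ a.succ - σ b.succ))
          - 2 * B (k a.succ) (k b.succ)) := by
    intro b hb
    rw [hprod b hb, crossRatio_sub hσ a b]
    have hub := sub_zero_ne_zero hσ b
    have hab := succ_sub_succ_ne_zero hσ (Finset.ne_of_mem_erase hb).symm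
    field_simp
    ring
  have hcons : ∑ b ∈ Finset.univ.erase a, 2 * B (k a.succ) (k b.succ)
      = -(2 * B (k a.succ) (k 0)) := by
    have h : ∑ b, B (k a.succ) (k b) = 0 := by rw [← map_sum, hk.conservation, map_zero]
    rw [Fin.sum_univ_succ, ← Finset.add_sum_erase _ _ (Finset.mem_univ a), hk.null, zero_add] at h
    rw [← Finset.mul_sum]
    linear_combination 2 * h
  rw [h1, Finset.sum_congr rfl hterm, ← Finset.mul_sum, Finset.sum_sub_distrib, hcons,
    ← Finset.mul_sum, scatteringFn_succ]
  field_simp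
  ring

/-- The polynomial equations at the cross ratios are combinations of the scattering equations. -/
theorem sum_eval_ladderPoly (hB : B.IsSymm) (hk : IsMasslessKinematics B k)
    (hσ : Function.Injective σ) (a : Fin (N + 2)) :
    ∑ m : Fin N, (-1) ^ (m.val + 1) * crossRatio σ a ^ (N - (m.val + 1))
        * eval (gaugeCoord σ) (ladderPoly B k m)
      = (∏ c ∈ Finset.univ.erase a, (crossRatio σ a - crossRatio σ c))
        * ((σ a.succ - σ 0) ^ 2 / gaugeScale σ) * scatteringFn B k σ a.succ := by
  rw [← scatteringGenerating_crossRatio hB hk hσ, ← gaugeFix_gaugeCoord hσ,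
    scatteringGenerating_gaugeFix hk]

/-- The Vandermonde matrix of the gauge coordinates with signs. -/
noncomputable def signedVandermonde (x : Fin N → ℂ) : Matrix (Fin N) (Fin N) ℂ :=
  Matrix.of fun a m => (-1) ^ (m.val + 1) * x a ^ (N - (m.val + 1))

theorem det_signedVandermonde (x : Fin N → ℂ) :
    (signedVandermonde x).det = (-1) ^ N * ∏ i, ∏ j ∈ Finset.Ioi i, (x j - x i) := by
  have h : signedVandermonde x = (-1 : ℂ) ^ N • Matrix.projVandermonde 1 (fun a => -x a) := by
    ext a m
    rw [signedVandermonde, Matrix.of_apply, Matrix.smul_apply, Matrix.projVandermonde_apply,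
      smul_eq_mul, neg_pow (x a), Fin.val_rev]
    have : (-1 : ℂ) ^ N * (-1) ^ (N - (m.val + 1)) = (-1) ^ (m.val + 1) := by
      rw [← pow_add, show N + (N - (m.val + 1)) = (N - (m.val + 1)) * 2 + (m.val + 1) by omega,
        pow_add, pow_mul']
      simp
    rw [← this]
    simp
    ring
  rw [h, Matrix.det_smul, Matrix.det_projVandermonde, Fintype.card_fin, ← pow_mul]
  congr 1
  · rcases Nat.even_or_odd N with hN | hN
    · rw [hN.neg_one_pow, (hN.mul_left N).neg_one_pow]
    · rw [hN.neg_one_pow, (hN.mul hN).neg_one_pow]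
  · refine Finset.prod_congr rfl fun i _ => Finset.prod_congr rfl fun j _ => ?_
    simp
    ring

/-- The identities at the `N` unfixed punctures form a Vandermonde system for the values of the
polynomials, invertible since the cross ratios are distinct. -/
theorem eval_ladderPoly_eq_zero (hB : B.IsSymm) (hk : IsMasslessKinematics B k)
    (hσ : Function.Injective σ) (hE : ∀ a, scatteringFn B k σ a = 0) (m : Fin N) :
    eval (gaugeCoord σ) (ladderPoly B k m) = 0 := by
  have h : (signedVandermonde (gaugeCoord σ)).mulVec
      (fun m => eval (gaugeCoord σ) (ladderPoly B k m)) = 0 := by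
    ext a
    have := sum_eval_ladderPoly hB hk hσ a.castSucc.castSucc
    rwa [hE, mul_zero] at this
  refine congrFun (Matrix.eq_zero_of_mulVec_eq_zero ?_ h) m
  rw [det_signedVandermonde]
  refine mul_ne_zero (by simp) (Finset.prod_ne_zero_iff.2 fun i _ =>
    Finset.prod_ne_zero_iff.2 fun j hj => sub_ne_zero.2 fun heq => ?_)
  have := crossRatio_injective hσ heq
  simp only [Fin.castSucc_inj] at this
  exact (Finset.mem_Ioi.1 hj).ne' this

/-- The labels fixed in the gauge `gaugeFix`. -/
def fixedLabels (N : ℕ) : Fin 3 ↪ Fin (N + 3) where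
  toFun := ![0, (Fin.last N).castSucc.succ, (Fin.last (N + 1)).succ]
  inj' := by
    intro a b h
    fin_cases a <;> fin_cases b <;> simp [Fin.ext_iff] at h ⊢

/-- The remaining labels. -/
def unfixedLabel (j : Fin N) : Fin (N + 3) := j.castSucc.castSucc.succ

theorem scatteringFn_eq_zero_of_eval (hB : B.IsSymm) (hk : IsMasslessKinematics B k)
    (hσ : Function.Injective σ) (hx : ∀ m, eval (gaugeCoord σ) (ladderPoly B k m) = 0)
    (a : Fin (N + 3)) : scatteringFn B k σ a = 0 := by
  refine scatteringFn_eq_zero_of_notMem_range hB hk hσ (q := fixedLabels N) (fun b hb => ?_) a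
  induction b using Fin.cases with
  | zero => exact absurd ⟨0, rfl⟩ hb
  | succ b =>
    have h := sum_eval_ladderPoly hB hk hσ b
    simp only [hx, mul_zero, Finset.sum_const_zero] at h
    refine (mul_eq_zero.1 h.symm).resolve_left (mul_ne_zero (Finset.prod_ne_zero_iff.2 fun c hc =>
      sub_ne_zero.2 ((crossRatio_injective hσ).ne (Finset.ne_of_mem_erase hc).symm)) ?_)
    exact div_ne_zero (pow_ne_zero _ (sub_zero_ne_zero hσ b)) (gaugeScale_ne_zero hσ)

end GaugeCoordinates

/-! ### Comparison of the two Jacobians at a solution. -/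

section Derivatives

/-- Where one factor vanishes the other need only be continuous; the prefactors then never have to
be differentiated. -/
theorem hasDerivAt_mul_of_eq_zero {f g : ℂ → ℂ} {f' z : ℂ} (hf : HasDerivAt f f' z) (h0 : f z = 0)
    (hg : ContinuousAt g z) : HasDerivAt (fun w => g w * f w) (g z * f') z := by
  rw [hasDerivAt_iff_tendsto_slope] at hf ⊢
  refine ((hg.tendsto.mono_left nhdsWithin_le_nhds).mul hf).congr fun w => ?_
  simp only [slope_def_field, h0, mul_zero, sub_zero]
  ring

theorem hasDerivAt_eval_update {ι : Type*} [Fintype ι] [DecidableEq ι] (p : MvPolynomial ι ℂ)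
    (x : ι → ℂ) (b : ι) :
    HasDerivAt (fun w => eval (Function.update x b w) p) (eval x (pderiv b p)) (x b) := by
  induction p using MvPolynomial.induction_on with
  | C c => simpa using hasDerivAt_const (x b) c
  | add p q hp hq =>
    simp only [map_add]
    exact hp.add hq
  | mul_X p i hp =>
    have hX : HasDerivAt (fun w => Function.update x b w i) (if b = i then 1 else 0) (x b) := by
      by_cases h : b = i
      · subst h; simpa using hasDerivAt_id' (x b)
      · simpa [h, Ne.symm h] using hasDerivAt_const (x b) (x i)
    have := hp.mul hX
    simp only [map_mul, eval_X, pderiv_mul, map_add]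
    refine this.congr_deriv ?_
    by_cases h : b = i
    · subst h; simp
    · simp [h, Ne.symm h]

variable {N : ℕ} {σ : Fin (N + 3) → ℂ}

theorem continuousAt_gaugeScale (hσ : Function.Injective σ) :
    ContinuousAt (fun τ : Fin (N + 3) → ℂ => gaugeScale τ) σ := by
  unfold gaugeScale
  exact ContinuousAt.div (by fun_prop) (by fun_prop)
    (succ_sub_succ_ne_zero hσ castSucc_last_ne_last)

theorem continuousAt_crossRatio (hσ : Function.Injective σ) (a : Fin (N + 2)) :
    ContinuousAt (fun τ : Fin (N + 3) → ℂ => crossRatio τ a) σ := by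
  unfold crossRatio
  exact ContinuousAt.div ((continuousAt_gaugeScale hσ).mul (by fun_prop)) (by fun_prop)
    (mul_ne_zero (sub_zero_ne_zero hσ a) (sub_zero_ne_zero hσ _))

theorem gaugeCoord_update (b : Fin N) (z : ℂ) :
    gaugeCoord (Function.update σ (unfixedLabel b) z) = Function.update (gaugeCoord σ) b
      (gaugeScale σ * (z - σ (Fin.last (N + 1)).succ)
        / ((z - σ 0) * (σ (Fin.last (N + 1)).succ - σ 0))) := by
  have h0 : (0 : Fin (N + 3)) ≠ unfixedLabel b := (Fin.succ_ne_zero _).symm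
  have h1 : (Fin.last N).castSucc.succ ≠ unfixedLabel b := by
    simp [unfixedLabel, Fin.ext_iff]; omega
  have h2 : (Fin.last (N + 1)).succ ≠ unfixedLabel b := by
    simp [unfixedLabel, Fin.ext_iff]; omega
  ext j
  have hs : gaugeScale (Function.update σ (unfixedLabel b) z) = gaugeScale σ := by
    rw [gaugeScale, gaugeScale, Function.update_of_ne h0, Function.update_of_ne h1,
      Function.update_of_ne h2]
  rw [gaugeCoord, crossRatio, hs, Function.update_of_ne h0, Function.update_of_ne h2]
  by_cases hj : j = b
  · subst hj
    rw [Function.update_self]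
    simp [unfixedLabel]
  · have : j.castSucc.castSucc.succ ≠ unfixedLabel b := by
      simpa [unfixedLabel] using hj
    rw [Function.update_of_ne this, Function.update_of_ne hj]
    rfl

variable {V : Type*} [AddCommGroup V] [Module ℂ V] {B : LinearMap.BilinForm ℂ V}
  {k : Fin (N + 3) → V}

/-- The Jacobian of the polynomial scattering equations. -/
noncomputable def ladderJacobian (B : LinearMap.BilinForm ℂ V) (k : Fin (N + 3) → V)
    (x : Fin N → ℂ) : Matrix (Fin N) (Fin N) ℂ :=
  Matrix.of fun i j => eval x (pderiv j (ladderPoly B k i))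

theorem eventually_injective_update (hσ : Function.Injective σ) (i : Fin (N + 3)) :
    ∀ᶠ z in nhds (σ i), Function.Injective (Function.update σ i z) := by
  have h : ∀ᶠ z in nhds (σ i), ∀ j, j ≠ i → z ≠ σ j := by
    rw [Filter.eventually_all]
    intro j
    by_cases hj : j = i
    · simp [hj]
    · filter_upwards [isOpen_ne.mem_nhds (hσ.ne (Ne.symm hj))] with z hz _
      exact hz
  filter_upwards [h] with z hz a b hab
  by_cases ha : a = i
  · subst ha
    by_contra hne
    rw [Function.update_self, Function.update_of_ne (Ne.symm hne)] at hab
    exact hz b (Ne.symm hne) hab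
  · by_cases hb : b = i
    · subst hb
      rw [Function.update_self, Function.update_of_ne ha] at hab
      exact absurd hab.symm (hz a ha)
    · rw [Function.update_of_ne ha, Function.update_of_ne hb] at hab
      exact hσ hab

theorem continuousAt_comp_update {F : (Fin (N + 3) → ℂ) → ℂ} (hF : ContinuousAt F σ)
    (i : Fin (N + 3)) : ContinuousAt (fun z => F (Function.update σ i z)) (σ i) := by
  refine ContinuousAt.comp (g := F) ?_ (continuous_const.update i continuous_id).continuousAt
  simpa using hF

/-- This is `sum_eval_ladderPoly` differentiated in one unfixed puncture. The polynomials and the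
`E_a` all vanish at the solution, so only their own derivatives enter. The factor `gaugeScale σ /
(σ_b - σ_1)²` is the derivative of the single cross ratio that moves. -/
theorem signedVandermonde_mul_ladderJacobian (hB : B.IsSymm) (hk : IsMasslessKinematics B k)
    (hσ : Function.Injective σ) (hE : ∀ a, scatteringFn B k σ a = 0) (a b : Fin N) :
    (∑ m, signedVandermonde (gaugeCoord σ) a m * ladderJacobian B k (gaugeCoord σ) m b)
        * (gaugeScale σ / (σ (unfixedLabel b) - σ 0) ^ 2)
      = (∏ c ∈ Finset.univ.erase a.castSucc.castSucc, (gaugeCoord σ a - crossRatio σ c))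
        * ((σ (unfixedLabel a) - σ 0) ^ 2 / gaugeScale σ)
        * scatteringJacobian B k σ (unfixedLabel a) (unfixedLabel b) := by
  set z₀ := σ (unfixedLabel b)
  set A := a.castSucc.castSucc
  have hu : z₀ - σ 0 ≠ 0 := sub_zero_ne_zero hσ _
  have hl := sub_zero_ne_zero hσ (Fin.last (N + 1))
  have hy : HasDerivAt (fun z => gaugeScale σ * (z - σ (Fin.last (N + 1)).succ)
        / ((z - σ 0) * (σ (Fin.last (N + 1)).succ - σ 0)))
      (gaugeScale σ / (z₀ - σ 0) ^ 2) z₀ := by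
    have := (((hasDerivAt_id' z₀).sub_const (σ (Fin.last (N + 1)).succ)).const_mul
      (gaugeScale σ)).fun_div (((hasDerivAt_id' z₀).sub_const (σ 0)).mul_const
        (σ (Fin.last (N + 1)).succ - σ 0)) (mul_ne_zero hu hl)
    refine this.congr_deriv ?_
    field_simp
    ring
  have hf : ∀ m, HasDerivAt
      (fun z => eval (gaugeCoord (Function.update σ (unfixedLabel b) z)) (ladderPoly B k m))
      (ladderJacobian B k (gaugeCoord σ) m b * (gaugeScale σ / (z₀ - σ 0) ^ 2)) z₀ := by
    intro m
    simp only [gaugeCoord_update]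
    exact HasDerivAt.comp z₀ (hasDerivAt_eval_update (ladderPoly B k m) (gaugeCoord σ) b) hy
  have hcont := fun c => continuousAt_comp_update (continuousAt_crossRatio hσ c) (unfixedLabel b)
  have hupd : Function.update σ (unfixedLabel b) z₀ = σ := Function.update_eq_self _ _
  have hL : HasDerivAt (fun z => ∑ m : Fin N, (-1) ^ (m.val + 1)
        * crossRatio (Function.update σ (unfixedLabel b) z) A ^ (N - (m.val + 1))
        * eval (gaugeCoord (Function.update σ (unfixedLabel b) z)) (ladderPoly B k m))
      (∑ m : Fin N, (-1) ^ (m.val + 1) * crossRatio σ A ^ (N - (m.val + 1))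
        * (ladderJacobian B k (gaugeCoord σ) m b * (gaugeScale σ / (z₀ - σ 0) ^ 2))) z₀ := by
    refine HasDerivAt.fun_sum fun m _ => ?_
    have hc : ContinuousAt (fun z => (-1) ^ (m.val + 1)
        * crossRatio (Function.update σ (unfixedLabel b) z) A ^ (N - (m.val + 1))) z₀ :=
      continuousAt_const.mul ((hcont A).pow _)
    have := hasDerivAt_mul_of_eq_zero (hf m)
      (by rw [hupd]; exact eval_ladderPoly_eq_zero hB hk hσ hE m) hc
    rwa [hupd] at this
  have hR : HasDerivAt (fun z => (∏ c ∈ Finset.univ.erase A,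
        (crossRatio (Function.update σ (unfixedLabel b) z) A
          - crossRatio (Function.update σ (unfixedLabel b) z) c))
        * ((Function.update σ (unfixedLabel b) z A.succ
          - Function.update σ (unfixedLabel b) z 0) ^ 2
          / gaugeScale (Function.update σ (unfixedLabel b) z))
        * scatteringFn B k (Function.update σ (unfixedLabel b) z) A.succ)
      ((∏ c ∈ Finset.univ.erase A, (crossRatio σ A - crossRatio σ c))
        * ((σ A.succ - σ 0) ^ 2 / gaugeScale σ)
        * scatteringJacobian B k σ A.succ (unfixedLabel b)) z₀ := by
    have hK : ContinuousAt (fun z => (∏ c ∈ Finset.univ.erase A,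
        (crossRatio (Function.update σ (unfixedLabel b) z) A
          - crossRatio (Function.update σ (unfixedLabel b) z) c))
        * ((Function.update σ (unfixedLabel b) z A.succ
          - Function.update σ (unfixedLabel b) z 0) ^ 2
          / gaugeScale (Function.update σ (unfixedLabel b) z))) z₀ := by
      have hF : ContinuousAt (fun τ : Fin (N + 3) → ℂ => (∏ c ∈ Finset.univ.erase A,
          (crossRatio τ A - crossRatio τ c)) * ((τ A.succ - τ 0) ^ 2 / gaugeScale τ)) σ := by
        refine ContinuousAt.mul (tendsto_finsetProd _ fun c _ =>
          (continuousAt_crossRatio hσ A).sub (continuousAt_crossRatio hσ c)) ?_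
        exact ContinuousAt.div (by fun_prop) (continuousAt_gaugeScale hσ) (gaugeScale_ne_zero hσ)
      exact continuousAt_comp_update hF (unfixedLabel b)
    have := hasDerivAt_mul_of_eq_zero
      (differentiableAt_scatteringFn (B := B) (k := k) hσ A.succ (unfixedLabel b)).hasDerivAt
      (by rw [hupd]; exact hE _) hK
    rwa [hupd] at this
  -- The identity is available only for distinct punctures, a condition that persists near the
  -- solution.
  have heq := hR.congr_of_eventuallyEq (f₁ := fun z => ∑ m : Fin N, (-1) ^ (m.val + 1)
        * crossRatio (Function.update σ (unfixedLabel b) z) A ^ (N - (m.val + 1))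
        * eval (gaugeCoord (Function.update σ (unfixedLabel b) z)) (ladderPoly B k m)) (by
    filter_upwards [eventually_injective_update hσ (unfixedLabel b)] with z hz
    exact sum_eval_ladderPoly hB hk hz A)
  have := hL.unique heq
  rw [Finset.sum_mul]
  refine Eq.trans (Finset.sum_congr rfl fun m _ => ?_) this
  rw [signedVandermonde, Matrix.of_apply, mul_assoc]
  rfl

end Derivatives

end CHY

namespace CHY

open MvPolynomial

/-! ### The factors of the integrand in cross ratios. -/

section ProductFormula

variable {N : ℕ}

/-- All labels, split into the fixed and the unfixed ones. -/
noncomputable def labelEquiv (N : ℕ) : Fin 3 ⊕ Fin N ≃ Fin (N + 3) :=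
  Equiv.ofBijective (Sum.elim (fixedLabels N) unfixedLabel) <| by
    rw [Fintype.bijective_iff_injective_and_card]
    refine ⟨Function.Injective.sumElim (fixedLabels N).injective (fun a b h => ?_) ?_, ?_⟩
    · simpa [unfixedLabel] using h
    · intro m j
      fin_cases m <;> simp [fixedLabels, unfixedLabel, Fin.ext_iff] <;> omega
    · simp [add_comm]

variable {V : Type*} [AddCommGroup V] [Module ℂ V] {B : LinearMap.BilinForm ℂ V}
  {k : Fin (N + 3) → V} {σ : Fin (N + 3) → ℂ}

theorem reducedMinor_fixedLabels :
    reducedMinor B k (fixedLabels N) (fixedLabels N) σ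
      = (Matrix.of fun a b : Fin N =>
          scatteringJacobian B k σ (unfixedLabel a) (unfixedLabel b)).det := by
  rw [reducedMinor, ← Matrix.det_submatrix_equiv_self (labelEquiv N)]
  set M := Matrix.of fun i j : Fin (N + 3) =>
    if i = fixedLabels N 0 then (if j = fixedLabels N 0 then (1 : ℂ) else 0)
    else if i = fixedLabels N 1 then (if j = fixedLabels N 1 then (1 : ℂ) else 0)
    else if i = fixedLabels N 2 then (if j = fixedLabels N 2 then (1 : ℂ) else 0)
    else scatteringJacobian B k σ i j
  have hinl : ∀ m, labelEquiv N (Sum.inl m) = fixedLabels N m := fun _ => rfl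
  have hinr : ∀ j, labelEquiv N (Sum.inr j) = unfixedLabel j := fun _ => rfl
  have hne : ∀ (j : Fin N) m, unfixedLabel j ≠ fixedLabels N m := fun j m h =>
    Sum.inr_ne_inl ((labelEquiv N).injective ((hinr j).trans (h.trans (hinl m).symm)))
  have hrow : ∀ m j, M (fixedLabels N m) j = if j = fixedLabels N m then 1 else 0 := by
    intro m j
    fin_cases m <;> simp [M, (fixedLabels N).injective.eq_iff]
  have h : M.submatrix (labelEquiv N) (labelEquiv N)
      = Matrix.fromBlocks 1 0 (Matrix.of fun a m => M (unfixedLabel a) (fixedLabels N m))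
        (Matrix.of fun a b : Fin N =>
          scatteringJacobian B k σ (unfixedLabel a) (unfixedLabel b)) := by
    ext i j
    rcases i with m | a <;> rcases j with m' | b
    · simp [hinl, hrow, Matrix.one_apply, (fixedLabels N).injective.eq_iff, eq_comm]
    · simp [hinl, hinr, hrow, hne]
    · simp [hinl, hinr]
    · simp [hinr, M, hne]
  rw [h, Matrix.det_fromBlocks_zero₁₂, Matrix.det_one, one_mul]

theorem prod_erase_sub (x : Fin N → ℂ) :
    ∏ a, ∏ c ∈ Finset.univ.erase a, (x a - x c)
      = (∏ i, ∏ j ∈ Finset.Ioi i, (x i - x j)) * ∏ i, ∏ j ∈ Finset.Ioi i, (x j - x i) := by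
  have h : ∀ a : Fin N, ∏ c ∈ Finset.univ.erase a, (x a - x c)
      = (∏ j ∈ Finset.Ioi a, (x a - x j)) * ∏ j ∈ Finset.Iio a, (x a - x j) := by
    intro a
    have hd : Disjoint (Finset.Ioi a) (Finset.Iio a) := by
      rw [Finset.disjoint_left]
      intro c h1 h2
      exact lt_asymm (Finset.mem_Ioi.1 h1) (Finset.mem_Iio.1 h2)
    rw [← Finset.prod_union hd]
    congr 1
    ext c
    simp only [Finset.mem_erase, Finset.mem_univ, and_true, Finset.mem_union, Finset.mem_Ioi,
      Finset.mem_Iio]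
    exact ne_iff_lt_or_gt.trans or_comm
  rw [Finset.prod_congr rfl fun a _ => h a, Finset.prod_mul_distrib]
  congr 1
  exact Finset.prod_comm' fun a c => by simp

@[simp]
theorem unfixed_apply (j : Fin N) : unfixed N j = j.castSucc.castSucc := rfl

theorem prod_erase_unfixed (hσ : Function.Injective σ) (a : Fin N) :
    ∏ c ∈ Finset.univ.erase a.castSucc.castSucc, (gaugeCoord σ a - crossRatio σ c)
      = (∏ c ∈ Finset.univ.erase a, (gaugeCoord σ a - gaugeCoord σ c))
        * (gaugeCoord σ a * (gaugeCoord σ a - 1)) := by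
  have h : Finset.univ.erase a.castSucc.castSucc
      = insert (Fin.last (N + 1)) (insert (Fin.last N).castSucc
        ((Finset.univ.erase a).map (unfixed N))) := by
    ext i
    induction i using Fin.lastCases with
    | last => simp [(Fin.castSucc_lt_last _).ne']
    | cast i =>
      induction i using Fin.lastCases with
      | last => simp [(Fin.castSucc_lt_last _).ne']
      | cast i => simp [(Fin.castSucc_lt_last _).ne]
  rw [h, Finset.prod_insert, Finset.prod_insert, Finset.prod_map, crossRatio_last,
    crossRatio_castSucc_last hσ]
  · simp only [unfixed_apply, gaugeCoord]
    ring
  · simp [(Fin.castSucc_lt_last _).ne]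
  · simp [(Fin.castSucc_lt_last _).ne, (Fin.castSucc_lt_last _).ne']

theorem gaugeCoord_injective (hσ : Function.Injective σ) : Function.Injective (gaugeCoord σ) :=
  fun a b h => by simpa using crossRatio_injective hσ h

/-- The reduced determinant in terms of the Jacobian of the polynomial equations. -/
theorem reducedMinor_mul_prod (hB : B.IsSymm) (hk : IsMasslessKinematics B k)
    (hσ : Function.Injective σ) (hE : ∀ a, scatteringFn B k σ a = 0) :
    reducedMinor B k (fixedLabels N) (fixedLabels N) σ
      * (∏ j, (gaugeCoord σ j * (gaugeCoord σ j - 1) * (σ (unfixedLabel j) - σ 0) ^ 4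
          / gaugeScale σ ^ 2))
      * ∏ i, ∏ j ∈ Finset.Ioi i, (gaugeCoord σ i - gaugeCoord σ j)
      = (-1) ^ N * (ladderJacobian B k (gaugeCoord σ)).det := by
  set x := gaugeCoord σ
  set D := gaugeScale σ
  have hD : D ≠ 0 := gaugeScale_ne_zero hσ
  set u : Fin N → ℂ := fun j => σ (unfixedLabel j) - σ 0
  have hu : ∀ j, u j ≠ 0 := fun j => sub_zero_ne_zero hσ _
  set w : Fin N → ℂ := fun a =>
    (∏ c ∈ Finset.univ.erase a.castSucc.castSucc, (x a - crossRatio σ c)) * (u a ^ 2 / D)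
  set Φ := Matrix.of fun a b : Fin N =>
    scatteringJacobian B k σ (unfixedLabel a) (unfixedLabel b)
  have hmat : signedVandermonde x * ladderJacobian B k x * Matrix.diagonal (fun b => D / u b ^ 2)
      = Matrix.diagonal w * Φ := by
    ext a b
    rw [Matrix.mul_diagonal, Matrix.diagonal_mul, Matrix.mul_apply]
    exact signedVandermonde_mul_ladderJacobian hB hk hσ hE a b
  have hdet := congrArg Matrix.det hmat
  rw [Matrix.det_mul, Matrix.det_mul, Matrix.det_mul, Matrix.det_diagonal, Matrix.det_diagonal,
    det_signedVandermonde] at hdet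
  have hw : ∏ a, w a = (∏ i, ∏ j ∈ Finset.Ioi i, (x i - x j))
      * (∏ i, ∏ j ∈ Finset.Ioi i, (x j - x i)) * ∏ a, (x a * (x a - 1) * u a ^ 2 / D) := by
    rw [← prod_erase_sub, ← Finset.prod_mul_distrib]
    refine Finset.prod_congr rfl fun a _ => ?_
    simp only [w]
    rw [prod_erase_unfixed hσ]
    ring
  have hV : ∏ i, ∏ j ∈ Finset.Ioi i, (x j - x i) ≠ 0 :=
    Finset.prod_ne_zero_iff.2 fun i _ => Finset.prod_ne_zero_iff.2 fun j hj =>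
      sub_ne_zero.2 ((gaugeCoord_injective hσ).ne (Finset.mem_Ioi.1 hj).ne')
  have hP : ∏ b, (D / u b ^ 2) ≠ 0 :=
    Finset.prod_ne_zero_iff.2 fun b _ => div_ne_zero hD (pow_ne_zero _ (hu b))
  -- The left factor is the product in the statement; it absorbs the chain-rule factors `D / u_b²`
  -- of the change of variables.
  have hprod : (∏ j, (x j * (x j - 1) * u j ^ 4 / D ^ 2)) * ∏ b, (D / u b ^ 2)
      = ∏ a, (x a * (x a - 1) * u a ^ 2 / D) := by
    rw [← Finset.prod_mul_distrib]
    refine Finset.prod_congr rfl fun a _ => ?_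
    have := hu a
    field_simp
  rw [hw] at hdet
  rw [reducedMinor_fixedLabels]
  apply mul_right_cancel₀ (mul_ne_zero hV hP)
  linear_combination -hdet + Φ.det * (∏ i, ∏ j ∈ Finset.Ioi i, (x i - x j))
    * (∏ i, ∏ j ∈ Finset.Ioi i, (x j - x i)) * hprod

/-- The numerator of the half-ladder integrand in the gauge `gaugeFix`. -/
noncomputable def ladderNumerator (N : ℕ) : MvPolynomial (Fin N) ℂ :=
  ∏ m : Fin N, ∏ i ∈ Finset.Iio m,
    (X i - gaugeFix (X : Fin N → MvPolynomial (Fin N) ℂ) m.succ.castSucc)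

/-- The adjacent differences supply the missing pairs `i = m`. The result is the product over all
pairs from the list `x_0, …, x_{N-1}, 1`. -/
theorem eval_ladderNumerator_mul (x : Fin N → ℂ) :
    eval x (ladderNumerator N) * ∏ m : Fin N, (x m - gaugeFix x m.succ.castSucc)
      = (∏ i, (x i - 1)) * ∏ i, ∏ j ∈ Finset.Ioi i, (x i - x j) := by
  have h1 : eval x (ladderNumerator N) * ∏ m : Fin N, (x m - gaugeFix x m.succ.castSucc)
      = ∏ m : Fin N, ∏ i ∈ Finset.Iic m, (x i - gaugeFix x m.succ.castSucc) := by
    rw [ladderNumerator, map_prod, ← Finset.prod_mul_distrib]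
    refine Finset.prod_congr rfl fun m _ => ?_
    rw [map_prod, ← Finset.Iic_erase,
      ← Finset.prod_erase_mul (Finset.Iic m) _ (Finset.mem_Iic.2 le_rfl)]
    simp [eval_gaugeFix_X]
  rw [h1, ← Finset.prod_mul_distrib, Finset.prod_comm' (t' := Finset.univ)
    (s' := fun i => Finset.Ici i) fun a c => by simp]
  refine Finset.prod_congr rfl fun i _ => ?_
  have h2 : (Finset.Ici i).map (Fin.succEmb N)
      = insert (Fin.last N) ((Finset.Ioi i).map Fin.castSuccEmb) := by
    ext a
    induction a using Fin.lastCases with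
    | last =>
      simp only [Finset.mem_map, Finset.mem_Ici, Fin.coe_succEmb, Finset.mem_insert, true_or,
        iff_true]
      have := i.isLt
      exact ⟨⟨N - 1, by omega⟩, by rw [Fin.le_def]; simp; omega, by ext; simp; omega⟩
    | cast a =>
      simp only [Finset.mem_map, Finset.mem_Ici, Fin.coe_succEmb, Finset.mem_insert,
        (Fin.castSucc_lt_last a).ne, false_or, Fin.coe_castSuccEmb, Finset.mem_Ioi,
        Fin.castSucc_inj, exists_eq_right]
      constructor
      · rintro ⟨b, hb, h⟩
        rw [Fin.ext_iff] at h
        rw [Fin.lt_def]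
        rw [Fin.le_def] at hb
        simp at h
        omega
      · intro h
        rw [Fin.lt_def] at h
        refine ⟨⟨a - 1, by omega⟩, by rw [Fin.le_def]; simp; omega, ?_⟩
        ext
        simp
        omega
  calc ∏ m ∈ Finset.Ici i, (x i - gaugeFix x m.succ.castSucc)
      = ∏ a ∈ (Finset.Ici i).map (Fin.succEmb N), (x i - gaugeFix x a.castSucc) := by
        rw [Finset.prod_map]; rfl
    _ = _ := by
      rw [h2, Finset.prod_insert (by simp), Finset.prod_map]
      simp

/-- The product of the differences from the first puncture. -/
noncomputable def rootDifferences (σ : Fin (N + 3) → ℂ) : ℂ := ∏ a : Fin (N + 2), (σ a.succ - σ 0)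

theorem rootDifferences_ne_zero (hσ : Function.Injective σ) : rootDifferences σ ≠ 0 :=
  Finset.prod_ne_zero_iff.2 fun _ _ => sub_zero_ne_zero hσ _

/-- The chain `2, …, n` has `N + 1` differences, each a difference of cross ratios times `(σ_a -
σ_1)(σ_b - σ_1) / D`. Its two ends meet their root factor once only, and the links to puncture `1`
supply the second. The sign comes from `σ_12`, and the last difference of cross ratios is `1 - 0`.
-/
theorem parkeTaylor_eq (hσ : Function.Injective σ) :
    parkeTaylor σ * gaugeScale σ ^ (N + 1) = -(rootDifferences σ ^ 2
      * ∏ m : Fin N, (gaugeCoord σ m - crossRatio σ m.succ.castSucc)) := by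
  have hD := gaugeScale_ne_zero hσ
  have h1 : parkeTaylor σ = (σ 0 - σ (0 : Fin (N + 2)).succ)
      * ((∏ j : Fin (N + 1), (σ j.castSucc.succ - σ j.succ.succ))
        * (σ (Fin.last (N + 1)).succ - σ 0)) := by
    have hrot : ∀ j : Fin (N + 1), finRotate (N + 3) j.castSucc.succ = j.succ.succ := by
      intro j
      rw [finRotate_apply]
      ext
      rw [Fin.val_add_one_of_lt]
      · simp
      · rw [Fin.lt_def]; simp; omega
    rw [parkeTaylor, Fin.prod_univ_succ, Fin.prod_univ_castSucc, Fin.succ_last, finRotate_last,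
      Finset.prod_congr rfl fun j _ => by rw [hrot j]]
    simp
  have h2 : ∀ j : Fin (N + 1), (σ j.castSucc.succ - σ j.succ.succ) * gaugeScale σ
      = (crossRatio σ j.castSucc - crossRatio σ j.succ)
        * ((σ j.castSucc.succ - σ 0) * (σ j.succ.succ - σ 0)) := by
    intro j
    rw [crossRatio_sub hσ, div_mul_cancel₀ _ (mul_ne_zero (sub_zero_ne_zero hσ _)
      (sub_zero_ne_zero hσ _)), mul_comm]
  have h3 : (∏ j : Fin (N + 1), (σ j.castSucc.succ - σ j.succ.succ)) * gaugeScale σ ^ (N + 1)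
      = (∏ m : Fin N, (gaugeCoord σ m - crossRatio σ m.succ.castSucc))
        * ((∏ j : Fin (N + 1), (σ j.castSucc.succ - σ 0))
          * ∏ j : Fin (N + 1), (σ j.succ.succ - σ 0)) := by
    have : gaugeScale σ ^ (N + 1) = ∏ j : Fin (N + 1), gaugeScale σ := by simp
    rw [this, ← Finset.prod_mul_distrib, Finset.prod_congr rfl fun j _ => h2 j,
      Finset.prod_mul_distrib, Finset.prod_mul_distrib, Fin.prod_univ_castSucc (n := N)]
    congr 1
    rw [Fin.succ_last, crossRatio_last, crossRatio_castSucc_last hσ, sub_zero, mul_one]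
    rfl
  have h4 : rootDifferences σ = (∏ j : Fin (N + 1), (σ j.castSucc.succ - σ 0))
      * (σ (Fin.last (N + 1)).succ - σ 0) := Fin.prod_univ_castSucc _
  have h5 : rootDifferences σ = (σ (0 : Fin (N + 2)).succ - σ 0)
      * ∏ j : Fin (N + 1), (σ j.succ.succ - σ 0) := Fin.prod_univ_succ _
  rw [h1, sq]
  nth_rewrite 1 [h4]
  rw [h5]
  linear_combination (σ 0 - σ (0 : Fin (N + 2)).succ) * (σ (Fin.last (N + 1)).succ - σ 0) * h3

theorem erase_zero_erase_last : (Finset.univ.erase (0 : Fin (N + 3))).erase (Fin.last (N + 1)).succ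
    = (Finset.univ : Finset (Fin (N + 1))).map
      (Fin.castSuccEmb.trans (Fin.succEmb (N + 2))) := by
  ext i
  induction i using Fin.cases with
  | zero => simp
  | succ i =>
    induction i using Fin.lastCases with
    | last => simp [(Fin.castSucc_lt_last _).ne]
    | cast i =>
      refine iff_of_true ?_ (Finset.mem_map.2 ⟨i, Finset.mem_univ _, rfl⟩)
      simp only [Finset.mem_erase, ne_eq, Fin.succ_inj, Finset.mem_univ, and_true]
      exact ⟨(Fin.castSucc_lt_last i).ne, Fin.succ_ne_zero _⟩

/-- Each of the `N + 1` inner punctures contributes one factor `-gaugeScale σ`. Puncture `n - 1` has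
cross ratio `1` and is therefore absent from the product. -/
theorem halfLadderFactorRev_eq (hσ : Function.Injective σ) :
    halfLadderFactorRev 0 (Fin.last (N + 1)).succ σ
        * ((∏ j, gaugeCoord σ j) * rootDifferences σ ^ 2)
      = (-gaugeScale σ) ^ (N + 1) := by
  have hl := sub_zero_ne_zero hσ (Fin.last (N + 1))
  have h1 : ∀ j : Fin (N + 1), (σ (Fin.last (N + 1)).succ - σ 0)
      / ((σ 0 - σ j.castSucc.succ) * (σ j.castSucc.succ - σ (Fin.last (N + 1)).succ))
      * (crossRatio σ j.castSucc * (σ j.castSucc.succ - σ 0) ^ 2) = -gaugeScale σ := by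
    intro j
    have hj := sub_zero_ne_zero hσ j.castSucc
    have hjl := succ_sub_succ_ne_zero hσ (Fin.castSucc_lt_last j).ne
    rw [crossRatio, ← neg_sub (σ j.castSucc.succ) (σ 0)]
    field_simp
  have h2 : ∏ j : Fin (N + 1), crossRatio σ j.castSucc = ∏ j, gaugeCoord σ j := by
    rw [Fin.prod_univ_castSucc, crossRatio_castSucc_last hσ, mul_one]
    rfl
  have h4 : rootDifferences σ = (∏ j : Fin (N + 1), (σ j.castSucc.succ - σ 0))
      * (σ (Fin.last (N + 1)).succ - σ 0) := Fin.prod_univ_castSucc _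
  have h5 : (-gaugeScale σ) ^ (N + 1) = ∏ j : Fin (N + 1), -gaugeScale σ := by simp
  rw [h5, ← Finset.prod_congr rfl fun j _ => h1 j, Finset.prod_mul_distrib,
    Finset.prod_mul_distrib, Finset.prod_pow, h2, h4, halfLadderFactorRev, erase_zero_erase_last,
    Finset.prod_map]
  simp only [Function.Embedding.trans_apply, Fin.coe_castSuccEmb, Fin.coe_succEmb]
  rw [← neg_sub (σ (Fin.last (N + 1)).succ) (σ 0)]
  field_simp

theorem tripleFactor_fixedLabels_mul (hσ : Function.Injective σ) :
    tripleFactor (fixedLabels N) σ * gaugeScale σ * (∏ j, (σ (unfixedLabel j) - σ 0)) ^ 2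
      = -rootDifferences σ ^ 2 := by
  have h1 : rootDifferences σ = (∏ j : Fin N, (σ (unfixedLabel j) - σ 0))
      * (σ (Fin.last N).castSucc.succ - σ 0) * (σ (Fin.last (N + 1)).succ - σ 0) := by
    rw [rootDifferences, Fin.prod_univ_castSucc, Fin.prod_univ_castSucc]
    rfl
  have h3 := succ_sub_succ_ne_zero hσ (castSucc_last_ne_last (N := N))
  have h4 : tripleFactor (fixedLabels N) σ = (σ 0 - σ (Fin.last N).castSucc.succ)
      * (σ (Fin.last N).castSucc.succ - σ (Fin.last (N + 1)).succ)
      * (σ (Fin.last (N + 1)).succ - σ 0) := rfl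
  rw [h1, h4, gaugeScale, ← neg_sub (σ (Fin.last N).castSucc.succ) (σ 0)]
  field_simp

theorem reducedMinor_ne_zero_of_ne_zero (hB : B.IsSymm) (hk : IsMasslessKinematics B k)
    (hσ : Function.Injective σ) (hE : ∀ a, scatteringFn B k σ a = 0) (p q p' q' : Fin 3 ↪ Fin (N + 3))
    (h : reducedMinor B k p q σ ≠ 0) : reducedMinor B k p' q' σ ≠ 0 := by
  intro h0
  have h1 := reducedMinor_mul_tripleFactor_mul hB hk hσ hE p q p' q'
  rw [h0, zero_mul] at h1
  exact mul_ne_zero h (mul_ne_zero (tripleFactor_ne_zero hσ p') (tripleFactor_ne_zero hσ q')) h1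

theorem gaugeCoord_ne_zero (hσ : Function.Injective σ) (j : Fin N) : gaugeCoord σ j ≠ 0 := by
  rw [← crossRatio_last σ]
  exact (crossRatio_injective hσ).ne (Fin.castSucc_lt_last _).ne

theorem gaugeCoord_ne_one (hσ : Function.Injective σ) (j : Fin N) : gaugeCoord σ j ≠ 1 := by
  rw [← crossRatio_castSucc_last hσ]
  exact (crossRatio_injective hσ).ne fun h =>
    (Fin.castSucc_lt_last j).ne (Fin.castSucc_injective _ h)

theorem prod_sub_gaugeCoord_ne_zero (hσ : Function.Injective σ) :
    ∏ i, ∏ j ∈ Finset.Ioi i, (gaugeCoord σ i - gaugeCoord σ j) ≠ 0 :=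
  Finset.prod_ne_zero_iff.2 fun _ _ => Finset.prod_ne_zero_iff.2 fun _ hj =>
    sub_ne_zero.2 ((gaugeCoord_injective hσ).ne (Finset.mem_Ioi.1 hj).ne)

theorem det_ladderJacobian_ne_zero (hB : B.IsSymm) (hk : IsMasslessKinematics B k)
    (hσ : Function.Injective σ) (hE : ∀ a, scatteringFn B k σ a = 0) (p q : Fin 3 ↪ Fin (N + 3))
    (h : reducedMinor B k p q σ ≠ 0) : (ladderJacobian B k (gaugeCoord σ)).det ≠ 0 := by
  intro h0
  have h1 := reducedMinor_mul_prod hB hk hσ hE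
  rw [h0, mul_zero] at h1
  refine mul_ne_zero (mul_ne_zero (reducedMinor_ne_zero_of_ne_zero hB hk hσ hE p q _ _ h)
    (Finset.prod_ne_zero_iff.2 fun j _ => ?_)) (prod_sub_gaugeCoord_ne_zero hσ) h1
  exact div_ne_zero (mul_ne_zero (mul_ne_zero (gaugeCoord_ne_zero hσ j)
    (sub_ne_zero.2 (gaugeCoord_ne_one hσ j))) (pow_ne_zero _ (sub_zero_ne_zero hσ _)))
    (pow_ne_zero _ (gaugeScale_ne_zero hσ))

/-- A localisation point of the half-ladder integral contributes the local residue. -/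
theorem localisation_term_eq (hB : B.IsSymm) (hk : IsMasslessKinematics B k)
    (hσ : Function.Injective σ) (hE : ∀ a, scatteringFn B k σ a = 0) (p q : Fin 3 ↪ Fin (N + 3))
    (h : reducedMinor B k p q σ ≠ 0) :
    tripleFactor p σ * tripleFactor q σ / reducedMinor B k p q σ
        * (halfLadderFactorRev 0 (Fin.last (N + 1)).succ σ * (1 / parkeTaylor σ))
      = eval (gaugeCoord σ) (ladderNumerator N) / (ladderJacobian B k (gaugeCoord σ)).det := by
  set x := gaugeCoord σ
  set p₀ := fixedLabels N
  have hJ := det_ladderJacobian_ne_zero hB hk hσ hE p q h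
  have hm₀ := reducedMinor_ne_zero_of_ne_zero hB hk hσ hE p q p₀ p₀ h
  have hD := gaugeScale_ne_zero hσ
  have hR := rootDifferences_ne_zero hσ
  have hx : ∏ j, x j ≠ 0 := Finset.prod_ne_zero_iff.2 fun j _ => gaugeCoord_ne_zero hσ j
  have hU : ∏ j, (σ (unfixedLabel j) - σ 0) ≠ 0 :=
    Finset.prod_ne_zero_iff.2 fun j _ => sub_zero_ne_zero hσ _
  have hadj : ∏ m : Fin N, (x m - crossRatio σ m.succ.castSucc) ≠ 0 :=
    Finset.prod_ne_zero_iff.2 fun m _ => sub_ne_zero.2 ((crossRatio_injective hσ).ne fun heq =>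
      (Fin.castSucc_lt_succ (i := m)).ne (Fin.castSucc_injective _ heq))
  have h1 : tripleFactor p σ * tripleFactor q σ / reducedMinor B k p q σ
      = tripleFactor p₀ σ ^ 2 / reducedMinor B k p₀ p₀ σ := by
    rw [div_eq_div_iff h hm₀]
    linear_combination -reducedMinor_mul_tripleFactor_mul hB hk hσ hE p q p₀ p₀
  have h2 := reducedMinor_mul_prod hB hk hσ hE
  have h3 := parkeTaylor_eq hσ
  have h4 := halfLadderFactorRev_eq hσ
  have h5 := tripleFactor_fixedLabels_mul hσ
  have h6 := eval_ladderNumerator_mul x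
  rw [gaugeFix_gaugeCoord hσ] at h6
  have h7 : ∏ j, (x j * (x j - 1) * (σ (unfixedLabel j) - σ 0) ^ 4 / gaugeScale σ ^ 2)
      = (∏ j, x j) * (∏ j, (x j - 1)) * (∏ j, (σ (unfixedLabel j) - σ 0)) ^ 4
        / (gaugeScale σ ^ N) ^ 2 := by
    simp [Finset.prod_div_distrib, Finset.prod_mul_distrib, Finset.prod_pow, ← pow_mul, mul_comm]
  rw [h7] at h2
  have hT : tripleFactor p₀ σ = -rootDifferences σ ^ 2
      / (gaugeScale σ * (∏ j, (σ (unfixedLabel j) - σ 0)) ^ 2) := by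
    rw [eq_div_iff (mul_ne_zero hD (pow_ne_zero _ hU)), ← h5]
    ring
  have hH : halfLadderFactorRev 0 (Fin.last (N + 1)).succ σ
      = (-gaugeScale σ) ^ (N + 1) / ((∏ j, x j) * rootDifferences σ ^ 2) := by
    rw [eq_div_iff (mul_ne_zero hx (pow_ne_zero _ hR)), h4]
  have hPT : parkeTaylor σ = -(rootDifferences σ ^ 2
      * ∏ m : Fin N, (x m - crossRatio σ m.succ.castSucc)) / gaugeScale σ ^ (N + 1) := by
    rw [eq_div_iff (pow_ne_zero _ hD), h3]
  rw [h1, hT, hH, hPT, neg_pow]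
  set R := rootDifferences σ
  set D := gaugeScale σ
  set U := ∏ j, (σ (unfixedLabel j) - σ 0)
  set A := ∏ m : Fin N, (x m - crossRatio σ m.succ.castSucc)
  set M := reducedMinor B k p₀ p₀ σ
  set J := (ladderJacobian B k x).det
  set Δ := ∏ i, ∏ j ∈ Finset.Ioi i, (x i - x j)
  have hs : ((-1 : ℂ) ^ N) ^ 2 = 1 := by rw [← pow_mul, mul_comm, pow_mul]; simp
  have hDN : D ^ N ≠ 0 := pow_ne_zero _ hD
  have h8 : M * ((∏ j, x j) * (∏ j, (x j - 1)) * U ^ 4) * Δ = (-1) ^ N * J * (D ^ N) ^ 2 := by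
    rw [← h2]
    field_simp
  rw [eq_div_iff hJ]
  -- Multiplication by the adjacent differences clears the Parke-Taylor denominator and completes
  -- the numerator to `∏ (x_i - 1)` times a Vandermonde product, the form in which `h8` gives the
  -- Jacobian.
  apply mul_right_cancel₀ hadj
  rw [h6]
  have h9 : (-R ^ 2 / (D * U ^ 2)) ^ 2 / M
      * ((-1) ^ (N + 1) * D ^ (N + 1) / ((∏ j, x j) * R ^ 2) * (1 / (-(R ^ 2 * A) / D ^ (N + 1))))
      * J * A = (-1) ^ N * J * (D ^ N) ^ 2 / (M * (∏ j, x j) * U ^ 4) := by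
    rw [pow_succ D N, pow_succ (-1 : ℂ) N]
    field_simp
  rw [h9, ← h8]
  field_simp

end ProductFormula

end CHY

namespace CHY

open MvPolynomial

/-! ### Cross ratios as coordinates on the moduli space. -/

section Moebius

variable {N : ℕ} {σ : Fin (N + 3) → ℂ}

/-- The coefficients are divided by a square root of the determinant. -/
theorem moebiusRel_of_det_ne_zero {n : ℕ} {σ τ : Config n} (a b c d : ℂ)
    (hdet : a * d - b * c ≠ 0)
    (h : ∀ i, c * σ.1 i + d ≠ 0 ∧ τ.1 i = (a * σ.1 i + b) / (c * σ.1 i + d)) :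
    MoebiusRel σ τ := by
  obtain ⟨r, hr⟩ := IsAlgClosed.exists_pow_nat_eq (a * d - b * c) (n := 2) (by norm_num)
  have hr0 : r ≠ 0 := by
    rintro rfl
    exact hdet (by rw [← hr]; norm_num)
  refine ⟨a / r, b / r, c / r, d / r, ?_, fun i => ?_⟩
  · field_simp
    rw [hr]
  · obtain ⟨h1, h2⟩ := h i
    have h3 : c / r * σ.1 i + d / r = (c * σ.1 i + d) / r := by ring
    refine ⟨by rw [h3]; exact div_ne_zero h1 hr0, ?_⟩
    rw [h3, h2, show a / r * σ.1 i + b / r = (a * σ.1 i + b) / r by ring,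
      div_div_div_cancel_right₀ hr0]

theorem crossRatio_eq_of_moebiusRel {σ τ : Config (N + 3)} (h : MoebiusRel σ τ) :
    crossRatio σ.1 = crossRatio τ.1 := by
  obtain ⟨a, b, c, d, hdet, h⟩ := h
  have hsub : ∀ i j, τ.1 i - τ.1 j
      = (σ.1 i - σ.1 j) / ((c * σ.1 i + d) * (c * σ.1 j + d)) := by
    intro i j
    rw [(h i).2, (h j).2, div_sub_div _ _ (h i).1 (h j).1]
    congr 1
    linear_combination (σ.1 i - σ.1 j) * hdet
  ext e
  unfold crossRatio gaugeScale
  simp only [hsub]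
  have h0 := (h 0).1
  have h1 := (h (Fin.last N).castSucc.succ).1
  have h2 := (h (Fin.last (N + 1)).succ).1
  have he := (h e.succ).1
  generalize c * σ.1 0 + d = w₀ at *
  generalize c * σ.1 (Fin.last N).castSucc.succ + d = w₁ at *
  generalize c * σ.1 (Fin.last (N + 1)).succ + d = w₂ at *
  generalize c * σ.1 e.succ + d = w at *
  have s1 := sub_zero_ne_zero σ.2 (Fin.last N).castSucc
  have s2 := sub_zero_ne_zero σ.2 (Fin.last (N + 1))
  have s3 := sub_zero_ne_zero σ.2 e
  have s4 := succ_sub_succ_ne_zero σ.2 (castSucc_last_ne_last (N := N))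
  field_simp

/-- Affine punctures with the cross ratios `y`, the first puncture being at the origin. -/
noncomputable def normalForm (y : Fin (N + 2) → ℂ) (s : ℂ) : Fin (N + 3) → ℂ :=
  Fin.cons (α := fun _ => ℂ) 0 fun a => 1 / (y a - s)

theorem normalForm_injective {y : Fin (N + 2) → ℂ} (hy : Function.Injective y) {s : ℂ}
    (hs : s ∉ Set.range y) : Function.Injective (normalForm y s) := by
  have hne : ∀ a, y a - s ≠ 0 := fun a h => hs ⟨a, sub_eq_zero.1 h⟩
  rw [normalForm, Fin.cons_injective_iff]
  refine ⟨?_, fun a b hab => hy ?_⟩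
  · rintro ⟨a, ha⟩
    exact one_div_ne_zero (hne a) ha
  · simpa using hab

theorem crossRatio_normalForm {y : Fin (N + 2) → ℂ} {s : ℂ} (hs : s ∉ Set.range y)
    (h1 : y (Fin.last N).castSucc = 1) (h0 : y (Fin.last (N + 1)) = 0) :
    crossRatio (normalForm y s) = y := by
  have hne : ∀ a, y a - s ≠ 0 := fun a h => hs ⟨a, sub_eq_zero.1 h⟩
  have e1 := hne (Fin.last N).castSucc
  have e0 := hne (Fin.last (N + 1))
  ext a
  have ea := hne a
  rw [h1] at e1
  rw [h0] at e0
  unfold crossRatio gaugeScale normalForm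
  simp only [Fin.cons_succ, Fin.cons_zero, h1, h0]
  have e2 : 1 / (1 - s) - 1 / (0 - s) = -1 / ((1 - s) * (0 - s)) := by
    field_simp
    ring
  have e3 : 1 / (y a - s) - 1 / (0 - s) = -y a / ((y a - s) * (0 - s)) := by
    field_simp
    ring
  rw [e2, e3]
  field_simp
  ring

theorem moebiusRel_normalForm (σ : Config (N + 3)) {s : ℂ} (hs : s ∉ Set.range (crossRatio σ.1)) :
    MoebiusRel σ ⟨normalForm (crossRatio σ.1) s,
      normalForm_injective (crossRatio_injective σ.2) hs⟩ := by
  obtain ⟨σ, hσ⟩ := σ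
  set D := gaugeScale σ
  set l := σ (Fin.last (N + 1)).succ
  have hD : D ≠ 0 := gaugeScale_ne_zero hσ
  have hl : l - σ 0 ≠ 0 := sub_zero_ne_zero hσ _
  have hne : ∀ a, crossRatio σ a - s ≠ 0 := fun a h => hs ⟨a, sub_eq_zero.1 h⟩
  have h0 : D / (l - σ 0) * (l - σ 0) = D := div_mul_cancel₀ _ hl
  dsimp only at hs
  -- The map is `σ ↦ 1 / (y(σ) - s)`, with numerator `σ - σ_1` and denominator `(y(σ) - s)(σ -
  -- σ_1)`. The latter is affine in `σ` because `y` has its only pole, a simple one, at `σ_1`.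
  refine moebiusRel_of_det_ne_zero 1 (-σ 0) (D / (l - σ 0) - s)
    (-(D / (l - σ 0)) * l + s * σ 0) ?_ fun i => ?_
  · rw [show 1 * (-(D / (l - σ 0)) * l + s * σ 0) - -σ 0 * (D / (l - σ 0) - s)
      = -(D / (l - σ 0) * (l - σ 0)) by ring, h0]
    exact neg_ne_zero.2 hD
  · induction i using Fin.cases with
    | zero =>
      dsimp only
      rw [show (D / (l - σ 0) - s) * σ 0 + (-(D / (l - σ 0)) * l + s * σ 0)
        = -(D / (l - σ 0) * (l - σ 0)) by ring, h0]
      exact ⟨neg_ne_zero.2 hD, by simp [normalForm]⟩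
    | succ a =>
      dsimp only
      have ha := sub_zero_ne_zero hσ a
      have h1 : (D / (l - σ 0) - s) * σ a.succ + (-(D / (l - σ 0)) * l + s * σ 0)
          = (crossRatio σ a - s) * (σ a.succ - σ 0) := by
        have : crossRatio σ a = D / (l - σ 0) * (σ a.succ - l) / (σ a.succ - σ 0) := by
          rw [crossRatio, mul_comm (σ a.succ - σ 0), ← div_div, mul_div_right_comm]
        rw [sub_mul (crossRatio σ a), this, div_mul_cancel₀ _ ha]
        ring
      rw [h1]
      refine ⟨mul_ne_zero (hne a) ha, ?_⟩
      have := hne a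
      simp only [normalForm, Fin.cons_succ, one_mul, ← sub_eq_add_neg]
      field_simp

/-- Both configurations are equivalent to the same normal form, for an `s` that avoids the common
cross ratios and so keeps every puncture finite. -/
theorem moebiusRel_of_crossRatio_eq {σ τ : Config (N + 3)}
    (h : crossRatio σ.1 = crossRatio τ.1) : MoebiusRel σ τ := by
  obtain ⟨s, hs⟩ := (Set.finite_range (crossRatio σ.1)).exists_notMem
  have h1 := moebiusRel_normalForm σ hs
  have h2 := moebiusRel_normalForm τ (h ▸ hs : s ∉ Set.range (crossRatio τ.1))
  have h3 : (⟨normalForm (crossRatio σ.1) s,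
      normalForm_injective (crossRatio_injective σ.2) hs⟩ : Config (N + 3))
      = ⟨normalForm (crossRatio τ.1) s,
        normalForm_injective (crossRatio_injective τ.2) (h ▸ hs)⟩ :=
    Subtype.ext (by simp only [h])
  rw [h3] at h1
  exact moebiusRel_trans h1 (moebiusRel_symm h2)

theorem exists_gaugeCoord_eq {x : Fin N → ℂ} (hx : Function.Injective (gaugeFix x)) :
    ∃ σ : Config (N + 3), gaugeCoord σ.1 = x := by
  obtain ⟨s, hs⟩ := (Set.finite_range (gaugeFix x)).exists_notMem
  refine ⟨⟨normalForm (gaugeFix x) s, normalForm_injective hx hs⟩, ?_⟩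
  ext j
  rw [gaugeCoord, crossRatio_normalForm hs (by simp) (by simp), gaugeFix_castSucc_castSucc]

end Moebius

/-! ### Assembly: from localisation points to the global residue. -/

section Main

variable {V : Type*} [AddCommGroup V] [Module ℂ V] {B : LinearMap.BilinForm ℂ V} {N : ℕ}
  {k : Fin (N + 3) → V}

/-- By momentum conservation the coefficient attached to `Iic m` is `k_{12…m+2}²`. -/
theorem prod_tailMomentumSq (hk : IsMasslessKinematics B k) :
    ∏ m : Fin N, tailMomentumSq B k ((Finset.Iic m).map (unfixed N))ᶜ
      = ∏ i ∈ Finset.Icc 2 (N + 3 - 2),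
        momentumSq B k (Finset.univ.filter fun j : Fin (N + 3) => j.val < i) := by
  have h1 : Finset.Icc 2 (N + 3 - 2) = Finset.Ico 2 (N + 2) := by
    ext i
    simp only [Finset.mem_Icc, Finset.mem_Ico]
    omega
  rw [h1, Finset.prod_Ico_eq_prod_range, Nat.add_sub_cancel, Finset.prod_range]
  refine Finset.prod_congr rfl fun m _ => ?_
  rw [tailMomentumSq_compl hk]
  congr 1
  ext i
  simp only [Finset.mem_insert, Finset.mem_map, Finset.mem_filter, Finset.mem_univ, true_and,
    exists_exists_and_eq_and, Finset.mem_Iic, Fin.coe_succEmb, unfixed_apply]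
  constructor
  · rintro (rfl | ⟨j, hj, rfl⟩)
    · simp
    · rw [Fin.le_def] at hj
      simp
      omega
  · intro hi
    induction i using Fin.cases with
    | zero => exact Or.inl rfl
    | succ i =>
      right
      have hm := m.isLt
      simp only [Fin.val_succ] at hi
      exact ⟨⟨i, by omega⟩, by rw [Fin.le_def]; simp; omega, by ext; simp⟩

theorem integral_halfLadderFactorRev (hB : B.IsSymm) (hk : IsMasslessKinematics B k)
    (hgen : ∀ I : Finset (Fin (N + 3)), 2 ≤ I.card → I.card + 2 ≤ N + 3 → momentumSq B k I ≠ 0)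
    (p q : Fin 3 ↪ Fin (N + 3))
    (hsimple : ∀ σ : Fin (N + 3) → ℂ, Function.Injective σ →
      (∀ a, scatteringFn B k σ a = 0) → reducedMinor B k p q σ ≠ 0)
    (rep : ModuliSpace (N + 3) → Config (N + 3)) (hrep : ∀ x, Quotient.mk _ (rep x) = x) :
    integral B k p q rep (fun σ =>
      halfLadderFactorRev 0 (Fin.last (N + 1)).succ σ * (1 / parkeTaylor σ))
      = halfLadderDiagram B k := by
  have hpre : ∀ x : Fin N → ℂ, (∀ m, eval x (ladderPoly B k m) = 0) →
      ∃ σ : Config (N + 3), gaugeCoord σ.1 = x ∧ ∀ a, scatteringFn B k σ.1 a = 0 := by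
    intro x hx
    obtain ⟨σ, rfl⟩ := exists_gaugeCoord_eq (gaugeFix_injective hk hgen hx)
    exact ⟨σ, rfl, scatteringFn_eq_zero_of_eval hB hk σ.2 hx⟩
  obtain ⟨Z, hZ, hsum⟩ := exists_sum_numerator_div_jacobian (f := ladderPoly B k)
    (c := fun I => tailMomentumSq B k (I.map (unfixed N))ᶜ)
    (z := fun m => gaugeFix (X : Fin N → MvPolynomial (Fin N) ℂ) m.succ.castSucc)
    (fun I hI => by
      have h1 := Finset.card_pos.2 hI
      have h2 : I.card ≤ N := by simpa using I.card_le_univ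
      apply tailMomentumSq_ne_zero hgen <;>
        rw [Finset.card_compl, Finset.card_map, Fintype.card_fin] <;> omega)
    totalDegree_ladderPoly_sub_le (fun m => totalDegree_gaugeFix_X_le _)
    (fun m => by
      by_cases hm : m.val + 1 < N
      · refine Or.inl ⟨⟨m + 1, hm⟩, le_rfl, ?_⟩
        rw [← gaugeFix_castSucc_castSucc (X : Fin N → MvPolynomial (Fin N) ℂ)]
        rfl
      · have hm' : m.val + 1 = N := by omega
        refine Or.inr ⟨hm', ?_⟩
        rw [show m.succ.castSucc = (Fin.last N).castSucc by ext; simpa using hm',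
          gaugeFix_castSucc_last])
    (fun x hx => by
      obtain ⟨σ, rfl, hE⟩ := hpre x hx
      exact det_ladderJacobian_ne_zero hB hk σ.2 hE p q (hsimple σ.1 σ.2 hE))
  rw [halfLadderDiagram, ← prod_tailMomentumSq hk, ← hsum, integral,
    ← finsum_mem_coe_finset]
  have hall : ∀ x ∈ {x : ModuliSpace (N + 3) |
      ∀ a, a ∉ Set.range q → scatteringFn B k (rep x).1 a = 0},
      ∀ a, scatteringFn B k (rep x).1 a = 0 := fun x hx =>
    scatteringFn_eq_zero_of_notMem_range hB hk (rep x).2 hx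
  -- Gauge coordinates map the localisation points bijectively onto the zeros: injectively because
  -- cross ratios determine the class, surjectively because every zero has distinct punctures.
  refine finsum_mem_eq_of_bijOn (fun x => gaugeCoord (rep x).1) ⟨fun x hx => ?_,
    fun x hx y hy hxy => ?_, fun x hx => ?_⟩ fun x hx => ?_
  · exact Finset.mem_coe.2 ((hZ _).2 (eval_ladderPoly_eq_zero hB hk (rep x).2 (hall x hx)))
  · rw [← hrep x, ← hrep y]
    refine Quotient.sound (moebiusRel_of_crossRatio_eq ?_)
    rw [← gaugeFix_gaugeCoord (rep x).2, ← gaugeFix_gaugeCoord (rep y).2]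
    exact congrArg gaugeFix hxy
  · have hx' := (hZ x).1 (Finset.mem_coe.1 hx)
    obtain ⟨σ, rfl, -⟩ := hpre x hx'
    have hrel : MoebiusRel (rep (Quotient.mk _ σ)) σ := Quotient.exact (hrep (Quotient.mk _ σ))
    have hcoord : gaugeCoord (rep (Quotient.mk _ σ)).1 = gaugeCoord σ.1 := by
      ext j
      rw [gaugeCoord, crossRatio_eq_of_moebiusRel hrel]
      rfl
    refine ⟨Quotient.mk _ σ, fun a _ => ?_, hcoord⟩
    exact scatteringFn_eq_zero_of_eval hB hk (rep _).2 (by rw [hcoord]; exact hx') a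
  · exact localisation_term_eq hB hk (rep x).2 (hall x hx) p q
      (hsimple _ (rep x).2 (hall x hx))

theorem halfLadderFactor_eq (σ : Fin (N + 3) → ℂ) :
    halfLadderFactor 0 (Fin.last (N + 1)).succ σ
      = (-1) ^ (N + 1) * halfLadderFactorRev 0 (Fin.last (N + 1)).succ σ := by
  have h : ∀ j, (σ 0 - σ (Fin.last (N + 1)).succ)
      / ((σ 0 - σ j) * (σ j - σ (Fin.last (N + 1)).succ))
      = -1 * ((σ (Fin.last (N + 1)).succ - σ 0)
        / ((σ 0 - σ j) * (σ j - σ (Fin.last (N + 1)).succ))) := fun j => by ring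
  rw [halfLadderFactor, halfLadderFactorRev, Finset.prod_congr rfl fun j _ => h j,
    Finset.prod_mul_distrib, Finset.prod_const, erase_zero_erase_last, Finset.card_map,
    Finset.card_univ, Fintype.card_fin]
  ring

theorem integral_const_mul {n : ℕ} {k : Fin n → V} (p q : Fin 3 ↪ Fin n)
    (rep : ModuliSpace n → Config n) (c : ℂ) (I : (Fin n → ℂ) → ℂ) :
    integral B k p q rep (fun σ => c * I σ) = c * integral B k p q rep I := by
  rw [integral, integral, mul_finsum_mem]
  simp only [mul_left_comm c]

end Main

end CHY

theorem mainTheorem7 {V : Type*} [AddCommGroup V] [Module ℂ V]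
    (B : LinearMap.BilinForm ℂ V) (hB : B.IsSymm) (n : ℕ) (hn : 3 ≤ n)
    (k : Fin n → V) (hk : CHY.IsMasslessKinematics B k)
    (hgen : ∀ I : Finset (Fin n), 2 ≤ I.card → I.card + 2 ≤ n → CHY.momentumSq B k I ≠ 0)
    (p q : Fin 3 ↪ Fin n)
    (hsimple : ∀ σ : Fin n → ℂ, Function.Injective σ →
      (∀ a, CHY.scatteringFn B k σ a = 0) → CHY.reducedMinor B k p q σ ≠ 0)
    (rep : CHY.ModuliSpace n → CHY.Config n) (hrep : ∀ x, Quotient.mk _ (rep x) = x) :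
    CHY.integral B k p q rep (fun σ =>
        CHY.halfLadderFactor (⟨0, by omega⟩ : Fin n) (⟨n - 1, by omega⟩ : Fin n) σ
          * (1 / CHY.parkeTaylor σ))
      = (-1) ^ n * CHY.halfLadderDiagram B k ∧
    CHY.integral B k p q rep (fun σ =>
        CHY.halfLadderFactorRev (⟨0, by omega⟩ : Fin n) (⟨n - 1, by omega⟩ : Fin n) σ
          * (1 / CHY.parkeTaylor σ))
      = CHY.halfLadderDiagram B k := by
  obtain ⟨N, rfl⟩ : ∃ N, n = N + 3 := ⟨n - 3, by omega⟩
  have hrev := CHY.integral_halfLadderFactorRev hB hk hgen p q hsimple rep hrep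
  refine ⟨?_, hrev⟩
  rw [← hrev, ← CHY.integral_const_mul p q rep]
  congr 1
  ext σ
  have h := CHY.halfLadderFactor_eq σ
  -- Reversing the `n - 2 = N + 1` numerators gives `(-1)^(N+1)`, which has the parity of `n`.
  rw [show (-1 : ℂ) ^ (N + 3) = (-1) ^ (N + 1) by rw [pow_add, pow_add]; norm_num, ← mul_assoc, ← h]
  rfl
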